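/- **Definitions.** Let $\mathbb C^+=\{\operatorname{Im} z\ge 0\}$. A *surface with nodes* is a Hausdorff space $\Sigma$ with a set $\mathcal D\subset\Sigma$ without accumulation points in $\Sigma$, such that each point of $\Sigma$ has a neighbourhood homeomorphic to an open subset of $\mathbb C$, of $\mathbb C^+$, of $\{(z,w)\in\mathbb C^2: zw=0\}$ or of $\{(z,w)\in(\mathbb C^+)^2: zw=0\}$, and each point of $\mathcal D$ has one homeomorphic to an open subset of $\mathbb C$. Points corresponding to $(0,0)$ in the third (fourth) model are the *conic nodes* $N(\Sigma,1)$ (the *boundary nodes* $N(\Sigma,3)$); the points of $N(\Sigma,2)=\mathcal D$ are the *inessential nodes*; $N(\Sigma)=N(\Sigma,1)\cup N(\Sigma,2)\cup N(\Sigma,3)$. The boundary $\partial\Sigma$ consists of the points with real coordinate in the models with boundary, including the boundary nodes. A *Klein surface with nodes* is a surface with nodes with an atlas of such charts whose transition maps are dianalytic (locally analytic or antianalytic) outside the nodes; it is a *Riemann surface with nodes* if only the first and third models occur, $\mathcal D=\emptyset$, and the transition maps are analytic outside the nodes. Klein and Riemann surfaces are those without nodes. The *normalization* $p:\widehat X\to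 X$ of $X$ is the Klein surface obtained by separating the two branches at each conic and each boundary node (and forgetting $\mathcal D$). A *map* $f:X_1\to X_2$ of surfaces with nodes is a continuous map with $f^{-1}(N(X_2,i))\subset N(X_1,i)\cup N(X_1,1)$ for $i=1,2,3$ and $f(\partial X_1)\subset\partial X_2$; its *lifting* is the continuous $\widehat f:\widehat{X_1}\to\widehat{X_2}$ with $p_2\widehat f=fp_1$. It is *complete* if $\widehat f(p_1^{-1}(z))=p_2^{-1}(f(z))$ for all $z$. A *morphism* is a complete map that is dianalytic outside the nodes, i.e. given locally in charts by an analytic or antianalytic function or, where the chart of $X_2$ has values in $\mathbb C^+$, by $\phi\circ F$ with $F$ analytic and $\phi(x+iy)=x+i|y|$. A morphism of Klein surfaces is a *double cover* if every fibre has two points, each point counted with its ramification index times its relative degree ($2$ at interior points mapped to the boundary, $1$ otherwise); it is *unbranched* if all ramification indices are $1$. A morphism of Klein surfaces with nodes is an unbranched double cover if its lifting is one. A *symmetric Riemann surface with nodes* $(Y,\sigma)$ is a Riemann surface with nodes with an antianalytic involution $\sigma$. A *complex double* of $X$ is a triple $(Y,\pi,\sigma)$ with $(Y,\sigma)$ a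 symmetric Riemann surface with nodes and $\pi:Y\to X$ an unbranched double cover such that $\pi\sigma=\pi$ and $\pi(N(Y))=N(X)$. **Statement.** Let $X$ be a Klein surface with nodes, $p:\widehat X\to X$ its normalization, and $(\widehat{X_c},\widehat{\pi_c},\widehat{\sigma_c})$ the complex double of the Klein surface $\widehat X$. For each node $z$ of $X$ consider the following identifications of points of $\widehat{X_c}$ over $z$: - if $z\in N(X,3)$, then $p^{-1}(z)=\{z_1,z_2\}$ with $z_1\ne z_2$, $\widehat{\pi_c}^{-1}(z_i)=\{w_i\}$, and $w_1\sim w_2$; - if $z\in N(X,2)$, then $p^{-1}(z)=\{z_1\}$, $\widehat{\pi_c}^{-1}(z_1)=\{w_1,w_2\}$ with $w_1\neq w_2$, and $w_1\sim w_2$; - if $z\in N(X,1)$, then $p^{-1}(z)=\{z_1,z_2\}$ with $z_1\ne z_2$, $\widehat{\pi_c}^{-1}(z_i)=\{w_{i,1},w_{i,2}\}$ with $w_{i,1}\ne w_{i,2}$, and either $w_{1,1}\sim w_{2,1}$ and $w_{1,2}\sim w_{2,2}$, or $w_{1,1}\sim w_{2,2}$ and $w_{1,2}\sim w_{2,1}$.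 Then exactly one identification is possible over each boundary node and each inessential node, and exactly two over each conic node. Hence there are $2^{\#N(X,1)}$ choices of one identification over each node, and different choices generate different equivalence relations on $\widehat{X_c}$. For each choice let $X_c$ be the quotient space of $\widehat{X_c}$ by the equivalence relation generated by the chosen identifications, with quotient map $p_c:\widehat{X_c}\to X_c$. Then $X_c$ carries a structure of Riemann surface with nodes whose normalization is $p_c:\widehat{X_c}\to X_c$; there are exactly one map $\pi_c:X_c\to X$ with $\pi_c p_c=p\,\widehat{\pi_c}$ and exactly one map $\sigma_c:X_c\to X_c$ with $\sigma_c p_c=p_c\widehat{\sigma_c}$; and $(X_c,\sigma_c)$ is a symmetric Riemann surface with nodes and $(X_c,\pi_c,\sigma_c)$ is a complex double of $X$. -/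

import Mathlib

open Set Filter Topology ComplexConjugate

universe u

noncomputable section

namespace Nodal

/-! ### Local models and charts -/

/-- The four local models of a surface with nodes. -/
inductive ModelKind
  | plane
  | halfPlane
  | node
  | halfNode

/-- The models as subsets of `ℂ²`: the plane `ℂ × {0}`, the closed half plane `ℂ⁺ × {0}`, two planes
glued at one point, and two closed half planes glued at one boundary point. -/
def ModelKind.carrier : ModelKind → Set (ℂ × ℂ)
  | .plane => {q | q.2 = 0}
  | .halfPlane => {q | q.2 = 0 ∧ 0 ≤ q.1.im}
  | .node => {q | q.1 * q.2 = 0}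
  | .halfNode => {q | q.1 * q.2 = 0 ∧ 0 ≤ q.1.im ∧ 0 ≤ q.2.im}

/-- The models with boundary. -/
def ModelKind.IsHalf : ModelKind → Prop
  | .plane => False
  | .halfPlane => True
  | .node => False
  | .halfNode => True

/-- The models with a crossing point. -/
def ModelKind.IsNodal : ModelKind → Prop
  | .plane => False
  | .halfPlane => False
  | .node => True
  | .halfNode => True

/-- The model of one branch. -/
def ModelKind.flat : ModelKind → ModelKind
  | .plane => .plane
  | .halfPlane => .halfPlane
  | .node => .plane
  | .halfNode => .halfPlane

/-- A chart: a homeomorphism of an open set of `X` onto a (relatively) open set of a model. -/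
structure NodalChart (X : Type u) [TopologicalSpace X] where
  kind : ModelKind
  homeo : OpenPartialHomeomorph X kind.carrier

namespace NodalChart

variable {X : Type u} [TopologicalSpace X]

def source (e : NodalChart X) : Set X := e.homeo.source

/-- The value of a chart, as a point of `ℂ²`. -/
def val (e : NodalChart X) (x : X) : ℂ × ℂ := (e.homeo x : ℂ × ℂ)

/-- The local complex coordinate. At most one component of `e.val x` is nonzero, so the sum is that
component: it is the coordinate of `x` on its branch. -/
def coord (e : NodalChart X) (x : X) : ℂ := (e.val x).1 + (e.val x).2

/-- `x` is the crossing point of the chart `e`. -/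
def Crossing (e : NodalChart X) (x : X) : Prop :=
  x ∈ e.source ∧ e.kind.IsNodal ∧ e.val x = 0

end NodalChart

/-- A surface with nodes `(Σ, 𝒟)` together with an atlas: a Hausdorff space covered by charts, with
a set `𝒟` (`inessential`) of distinguished points that has no accumulation point and all of whose
points have planar neighbourhoods. The atlas need not be maximal. -/
structure NodalSurface (X : Type u) [TopologicalSpace X] where
  t2 : T2Space X
  atlas : Set (NodalChart X)
  cover : ∀ x, ∃ e ∈ atlas, x ∈ e.source
  inessential : Set X
  discrete : ∀ x, ∃ U ∈ 𝓝 x, U ∩ inessential ⊆ {x}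
  planar : ∀ x ∈ inessential, ∀ e ∈ atlas, x ∈ e.source →
    ¬ e.Crossing x ∧ ¬ (e.kind.IsHalf ∧ (e.coord x).im = 0)

namespace NodalSurface

variable {X : Type u} [TopologicalSpace X] (S : NodalSurface X)

/-- The conic nodes `N(X,1)`. -/
def conic : Set X := {x | ∃ e ∈ S.atlas, e.Crossing x ∧ ¬ e.kind.IsHalf}

/-- The boundary nodes `N(X,3)`. -/
def boundaryNodes : Set X := {x | ∃ e ∈ S.atlas, e.Crossing x ∧ e.kind.IsHalf}

/-- The nodes, `N(X) = N(X,1) ∪ N(X,2) ∪ N(X,3)`. -/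
def nodes : Set X := S.conic ∪ S.inessential ∪ S.boundaryNodes

/-- The boundary of the surface (it contains the boundary nodes). -/
def boundary : Set X := {x | ∃ e ∈ S.atlas, x ∈ e.source ∧ e.kind.IsHalf ∧ (e.coord x).im = 0}

/-- The points at which two branches meet, `N(X,1) ∪ N(X,3)`. -/
def crossing : Set X := {x | ∃ e ∈ S.atlas, e.Crossing x}

end NodalSurface

/-! ### Analytic and dianalytic structures -/

/-- Near `x`, the function `b` is an analytic function of the coordinate `a`. -/
def AnalyticRel {X : Type u} [TopologicalSpace X] (a b : X → ℂ) (x : X) : Prop :=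
  ∃ F : ℂ → ℂ, AnalyticAt ℂ F (a x) ∧ ∀ᶠ y in 𝓝 x, b y = F (a y)

/-- Near `x`, the function `b` is an antianalytic function of the coordinate `a`. -/
def AntianalyticRel {X : Type u} [TopologicalSpace X] (a b : X → ℂ) (x : X) : Prop :=
  ∃ F : ℂ → ℂ, AnalyticAt ℂ F (a x) ∧ ∀ᶠ y in 𝓝 x, b y = conj (F (a y))

namespace NodalSurface

variable {X : Type u} [TopologicalSpace X] (S : NodalSurface X)

/-- Klein surface with nodes: outside the nodes the transition maps are dianalytic. -/
def IsKlein : Prop :=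
  ∀ e ∈ S.atlas, ∀ e' ∈ S.atlas, ∀ x ∈ e.source ∩ e'.source, x ∉ S.nodes →
    AnalyticRel e.coord e'.coord x ∨ AntianalyticRel e.coord e'.coord x

/-- Riemann surface with nodes: no boundary, no distinguished points, and outside the nodes the
transition maps are analytic. -/
def IsRiemann : Prop :=
  S.inessential = ∅ ∧ (∀ e ∈ S.atlas, ¬ e.kind.IsHalf) ∧
  ∀ e ∈ S.atlas, ∀ e' ∈ S.atlas, ∀ x ∈ e.source ∩ e'.source, x ∉ S.nodes →
    AnalyticRel e.coord e'.coord x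

end NodalSurface

/-! ### The normalization -/

/-- The component of a point of `ℂ²` along the branch `k`. -/
def axis (k : Bool) (q : ℂ × ℂ) : ℂ := if k then q.2 else q.1

/-- The point with coordinate `a` on the branch `k`. -/
def inject (k : Bool) (a : ℂ) : ℂ × ℂ := if k then (0, a) else (a, 0)

lemma axis_inject (k : Bool) (a : ℂ) : axis k (inject k a) = a := by
  cases k <;> simp [axis, inject]

lemma axis_not_inject (k : Bool) (a : ℂ) : axis (!k) (inject k a) = 0 := by
  cases k <;> simp [axis, inject]

lemma inject_axis {k : Bool} {q : ℂ × ℂ} (h : axis (!k) q = 0) : inject k (axis k q) = q := by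
  cases k <;> simp_all [axis, inject, Prod.ext_iff]

lemma continuous_axis (k : Bool) : Continuous (axis k) := by
  cases k
  · exact continuous_fst
  · exact continuous_snd

lemma continuous_inject (k : Bool) : Continuous (inject k) := by
  cases k
  · exact Continuous.prodMk_left 0
  · exact Continuous.prodMk_right 0

lemma axis_mem {κ : ModelKind} (k : Bool) {q : ℂ × ℂ} (h : q ∈ κ.carrier) :
    ((axis k q, 0) : ℂ × ℂ) ∈ κ.flat.carrier := by
  cases κ <;> cases k <;> simp_all [axis, ModelKind.carrier, ModelKind.flat]

lemma inject_mem {κ : ModelKind} {k : Bool} (hk : κ.IsNodal ∨ k = false) {q : ℂ × ℂ}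
    (h : q ∈ κ.flat.carrier) : inject k q.1 ∈ κ.carrier := by
  cases κ <;> cases k <;> simp_all [inject, ModelKind.carrier, ModelKind.flat, ModelKind.IsNodal]

lemma axis_or {κ : ModelKind} {q : ℂ × ℂ} (h : q ∈ κ.carrier) :
    ∃ k, (κ.IsNodal ∨ k = false) ∧ axis (!k) q = 0 := by
  cases κ
  · exact ⟨false, by simp, by simpa [axis, ModelKind.carrier] using h⟩
  · exact ⟨false, by simp, by simpa [axis, ModelKind.carrier] using h.1⟩
  · rcases mul_eq_zero.1 (show q.1 * q.2 = 0 from h) with h | h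
    · exact ⟨true, by simp [ModelKind.IsNodal], by simpa [axis] using h⟩
    · exact ⟨false, by simp, by simpa [axis] using h⟩
  · rcases mul_eq_zero.1 (show q.1 * q.2 = 0 from h.1) with h | h
    · exact ⟨true, by simp [ModelKind.IsNodal], by simpa [axis] using h⟩
    · exact ⟨false, by simp, by simpa [axis] using h⟩

lemma axis_not_eq_zero_iff {κ : ModelKind} {k : Bool} (hk : κ.IsNodal ∨ k = false) {q : ℂ × ℂ}
    (h : q ∈ κ.carrier) : (axis (!k) q = 0 ∧ ¬ (κ.IsNodal ∧ q = 0)) ↔ (¬ κ.IsNodal ∨ axis k q ≠ 0) := by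
  obtain ⟨a, b⟩ := q
  cases κ <;> cases k <;>
    simp_all [axis, ModelKind.carrier, ModelKind.IsNodal] <;> grind


/-- The set of coordinates of a model on one branch. -/
def ModelKind.half (κ : ModelKind) : Set ℂ := {a | κ.IsHalf → 0 ≤ a.im}

lemma ModelKind.mem_half {κ : ModelKind} {k : Bool} {q : ℂ × ℂ} (h : q ∈ κ.carrier) :
    axis k q ∈ κ.half := by
  cases κ <;> cases k <;> simp_all [ModelKind.half, axis, ModelKind.carrier, ModelKind.IsHalf]

lemma inject_mem_half {κ : ModelKind} {k : Bool} (hk : κ.IsNodal ∨ k = false) {a : ℂ}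
    (h : a ∈ κ.half) : inject k a ∈ κ.carrier := by
  cases κ <;> cases k <;>
    simp_all [inject, ModelKind.carrier, ModelKind.half, ModelKind.IsNodal, ModelKind.IsHalf]

lemma isPreconnected_polar (a : ℂ) {r s : ℝ} (P : Set ℂ)
    (hP : P = {b | b ≠ a ∧ ‖b - a‖ < r ∧ s ≤ (b - a).arg})
    (h : ∀ ρ θ : ℝ, 0 < ρ → ρ < r → s ≤ θ → θ ≤ Real.pi →
      (a + ρ * Complex.exp (θ * Complex.I)) ∈ P) : IsPreconnected P := by
  have h1 : P = (fun t : ℝ × ℝ => a + t.1 * Complex.exp (t.2 * Complex.I)) ''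
      (Ioo 0 r ×ˢ Icc s Real.pi) := by
    apply Subset.antisymm
    · intro b hb
      rw [hP] at hb
      refine ⟨(‖b - a‖, (b - a).arg), ⟨⟨?_, hb.2.1⟩, hb.2.2, Complex.arg_le_pi _⟩, ?_⟩
      · simpa [sub_eq_zero] using hb.1
      · simp
    · rintro _ ⟨t, ⟨⟨h1, h2⟩, h3, h4⟩, rfl⟩
      exact h _ _ h1 h2 h3 h4
  rw [h1]
  refine (isPreconnected_Ioo.prod isPreconnected_Icc).image _ ?_
  fun_prop

lemma norm_polar (a : ℂ) {ρ θ : ℝ} (h : 0 < ρ) :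
    a + ρ * Complex.exp (θ * Complex.I) ≠ a ∧
      ‖a + ρ * Complex.exp (θ * Complex.I) - a‖ = ρ := by
  refine ⟨?_, ?_⟩
  · simp [h.ne']
  · simp [Complex.norm_exp_ofReal_mul_I, abs_of_pos h]

lemma exists_preconnected {κ : ModelKind} {a : ℂ} (ha : a ∈ κ.half) {ε : ℝ} (hε : 0 < ε) :
    ∃ r, 0 < r ∧ r ≤ ε ∧ IsPreconnected ((Metric.ball a r ∩ κ.half) \ {a}) := by
  by_cases hb : κ.IsHalf ∧ a.im = 0
  · refine ⟨ε, hε, le_rfl, isPreconnected_polar a (r := ε) (s := 0) _ ?_ ?_⟩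
    · ext b
      simp only [ModelKind.half, hb.1, true_imp_iff, Set.mem_sdiff, mem_inter_iff, Metric.mem_ball,
        dist_eq_norm, mem_ofPred_eq, mem_singleton_iff, Complex.arg_nonneg_iff, Complex.sub_im, hb.2,
        sub_zero]
      tauto
    · intro ρ θ h1 h2 h3 h4
      obtain ⟨h5, h6⟩ := norm_polar a (θ := θ) h1
      refine ⟨⟨by rw [Metric.mem_ball, dist_eq_norm, h6]; exact h2, fun _ => ?_⟩, h5⟩
      rw [Complex.add_im, Complex.im_ofReal_mul, Complex.exp_ofReal_mul_I_im, hb.2, zero_add]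
      exact mul_nonneg h1.le (Real.sin_nonneg_of_nonneg_of_le_pi h3 h4)
  · obtain ⟨r, hr, hrε, hsub⟩ : ∃ r, 0 < r ∧ r ≤ ε ∧ Metric.ball a r ⊆ κ.half := by
      by_cases hk : κ.IsHalf
      · have h0 : 0 < a.im := lt_of_le_of_ne (ha hk) (fun h => hb ⟨hk, h.symm⟩)
        refine ⟨min ε a.im, lt_min hε h0, min_le_left _ _, fun b hb _ => ?_⟩
        rw [Metric.mem_ball, dist_eq_norm] at hb
        have h1 := (Complex.abs_im_le_norm (b - a)).trans hb.le
        have h2 := (abs_le.1 (h1.trans (min_le_right _ _))).1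
        simp only [Complex.sub_im] at h2
        linarith
      · exact ⟨ε, hε, le_rfl, fun b _ h => absurd h hk⟩
    refine ⟨r, hr, hrε, ?_⟩
    rw [inter_eq_left.2 hsub]
    refine isPreconnected_polar a (r := r) (s := -Real.pi) _ ?_ ?_
    · ext b
      simp only [Set.mem_sdiff, Metric.mem_ball, dist_eq_norm, mem_singleton_iff, mem_ofPred_eq,
        (Complex.neg_pi_lt_arg (b - a)).le, and_true]
      tauto
    · intro ρ θ h1 h2 h3 h4
      obtain ⟨h5, h6⟩ := norm_polar a (θ := θ) h1
      exact ⟨by rw [Metric.mem_ball, dist_eq_norm, h6]; exact h2, h5⟩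

lemma exists_punctured {κ : ModelKind} (q : κ.carrier) (hq : ¬ (κ.IsNodal ∧ (q : ℂ × ℂ) = 0))
    {U : Set κ.carrier} (hU : U ∈ 𝓝 q) :
    ∃ P : Set κ.carrier, P ⊆ U ∧ q ∉ P ∧ IsPreconnected P ∧ insert q P ∈ 𝓝 q := by
  obtain ⟨k, hk, hkq⟩ := axis_or q.2
  set a := axis k q with ha
  let j : κ.half → κ.carrier := fun b => ⟨inject k b, inject_mem_half hk b.2⟩
  have hj : Continuous j := ((continuous_inject k).comp continuous_subtype_val).subtype_mk _
  let a' : κ.half := ⟨a, ModelKind.mem_half q.2⟩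
  have hja : j a' = q := Subtype.ext (inject_axis hkq)
  have hU' : j ⁻¹' U ∈ 𝓝 a' := hj.continuousAt.preimage_mem_nhds (by rwa [hja])
  obtain ⟨ε, hε, hεU⟩ := Metric.mem_nhds_iff.1 hU'
  obtain ⟨r, hr, hrε, hP⟩ := exists_preconnected (κ := κ) (a := a) a'.2 hε
  let Q : Set κ.half := (↑) ⁻¹' ((Metric.ball a r ∩ κ.half) \ {a})
  have hQ : IsPreconnected Q := by
    rw [← Topology.IsInducing.subtypeVal.isPreconnected_image, Subtype.image_preimage_coe]
    rwa [inter_eq_right.2]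
    exact fun b hb => hb.1.2
  refine ⟨j '' Q, ?_, ?_, hQ.image _ hj.continuousOn, ?_⟩
  · rintro _ ⟨b, hb, rfl⟩
    exact hεU (Metric.ball_subset_ball hrε hb.1.1)
  · rintro ⟨b, hb, hbq⟩
    refine hb.2 ?_
    have := congrArg (fun t : κ.carrier => axis k t) hbq
    simpa [j, axis_inject] using this
  · have h1 : ∀ᶠ t : κ.carrier in 𝓝 q, axis (!k) (t : ℂ × ℂ) = 0 := by
      have h2 := (axis_not_eq_zero_iff hk q.2).1 ⟨hkq, hq⟩
      rcases h2 with h2 | h2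
      · exact Eventually.of_forall fun t =>
          ((axis_not_eq_zero_iff hk t.2).2 (Or.inl h2)).1
      · have h3 : ContinuousAt (fun t : κ.carrier => axis k (t : ℂ × ℂ)) q :=
          ((continuous_axis k).comp continuous_subtype_val).continuousAt
        filter_upwards [h3.eventually_ne h2] with t ht
        exact ((axis_not_eq_zero_iff hk t.2).2 (Or.inr ht)).1
    have h4 : ∀ᶠ t : κ.carrier in 𝓝 q, axis k (t : ℂ × ℂ) ∈ Metric.ball a r :=
      ((continuous_axis k).comp continuous_subtype_val).continuousAt.preimage_mem_nhds
        (Metric.ball_mem_nhds _ hr)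
    filter_upwards [h1, h4] with t ht1 ht4
    by_cases htq : t = q
    · exact Or.inl htq
    · refine Or.inr ⟨⟨axis k t, ModelKind.mem_half t.2⟩, ⟨⟨ht4, ModelKind.mem_half t.2⟩, ?_⟩,
        Subtype.ext (inject_axis ht1)⟩
      intro h
      apply htq
      apply Subtype.ext
      rw [← inject_axis ht1, ← inject_axis hkq]
      exact congrArg _ h

namespace NodalChart

variable {X : Type u} [TopologicalSpace X]

lemma val_mem (e : NodalChart X) (x : X) : e.val x ∈ e.kind.carrier := (e.homeo x).2

lemma val_injOn (e : NodalChart X) {x y : X} (hx : x ∈ e.source) (hy : y ∈ e.source)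
    (h : e.val x = e.val y) : x = y := e.homeo.injOn hx hy (Subtype.ext h)

/-- Whether a point is a crossing point does not depend on the chart. -/
lemma Crossing.of_mem {e e' : NodalChart X} {x : X} (h : e.Crossing x) (hx : x ∈ e'.source) :
    e'.Crossing x := by
  obtain ⟨hxe, hn, h0⟩ := h
  by_contra hc
  have hq : ¬ (e'.kind.IsNodal ∧ (e'.homeo x : ℂ × ℂ) = 0) := fun h => hc ⟨hx, h.1, h.2⟩
  have hU : e'.homeo.target ∩ e'.homeo.symm ⁻¹' e.homeo.source ∈ 𝓝 (e'.homeo x) := by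
    refine (e'.homeo.isOpen_inter_preimage_symm e.homeo.open_source).mem_nhds
      ⟨e'.homeo.map_source hx, ?_⟩
    rw [mem_preimage, e'.homeo.left_inv hx]
    exact hxe
  obtain ⟨P, hPU, hqP, hP, hPn⟩ := exists_punctured (e'.homeo x) hq hU
  let R : Set X := e'.homeo.symm '' P
  have hR : IsPreconnected R :=
    hP.image _ (e'.homeo.continuousOn_symm.mono fun t ht => (hPU ht).1)
  have hRe : R ⊆ e.homeo.source := by
    rintro _ ⟨t, ht, rfl⟩
    exact (hPU ht).2
  have hxR : x ∉ R := by
    rintro ⟨t, ht, htx⟩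
    apply hqP
    rw [← htx, e'.homeo.right_inv (hPU ht).1]
    exact ht
  have hRn : insert x R ∈ 𝓝 x := by
    filter_upwards [e'.homeo.open_source.mem_nhds hx,
      (e'.homeo.continuousAt hx).preimage_mem_nhds hPn] with y hy hy'
    rcases hy' with hy' | hy'
    · exact Or.inl (e'.homeo.injOn hy hx hy')
    · exact Or.inr ⟨_, hy', e'.homeo.left_inv hy⟩
  have hval : ContinuousOn e.val R :=
    continuous_subtype_val.comp_continuousOn (e.homeo.continuousOn.mono hRe)
  have hI : IsPreconnected (e.val '' R) := hR.image _ hval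
  have hIn : ∀ᶠ t : e.kind.carrier in 𝓝 (e.homeo x), (t : ℂ × ℂ) ∈ insert (e.val x) (e.val '' R) := by
    have hs : e.homeo x ∈ e.homeo.target := e.homeo.map_source hxe
    have h2 := (e.homeo.symm.continuousAt hs).preimage_mem_nhds
      (by rw [e.homeo.left_inv hxe]; exact hRn)
    filter_upwards [h2, e.homeo.open_target.mem_nhds hs] with t ht ht'
    rcases ht with ht | ht
    · left
      rw [← ht, val, e.homeo.right_inv ht']
    · right
      exact ⟨_, ht, by rw [val, e.homeo.right_inv ht']⟩
  rw [h0] at hIn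
  have hax : ∀ k, ∃ c : ℂ, c ≠ 0 ∧ inject k c ∈ e.val '' R := by
    intro k
    have hm : ∀ s : ℝ, (s : ℂ) ∈ e.kind.half := fun s _ => by simp
    let g : ℝ → e.kind.carrier := fun s => ⟨inject k s, inject_mem_half (Or.inl hn) (hm s)⟩
    have hg : Continuous g :=
      ((continuous_inject k).comp Complex.continuous_ofReal).subtype_mk _
    have hg0 : g 0 = e.homeo x := by
      apply Subtype.ext
      change inject k ((0 : ℝ) : ℂ) = e.val x
      rw [h0]
      cases k <;> simp [inject]
    have h3 : ∀ᶠ s in 𝓝[≠] (0 : ℝ), (g s : ℂ × ℂ) ∈ insert 0 (e.val '' R) :=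
      (hg.continuousAt.eventually (by rw [hg0]; exact hIn)).filter_mono nhdsWithin_le_nhds
    obtain ⟨s, hs, hs0⟩ := (h3.and self_mem_nhdsWithin).exists
    have hs0' : (s : ℂ) ≠ 0 := by exact_mod_cast hs0
    refine ⟨s, hs0', hs.resolve_left fun h => hs0' ?_⟩
    have := congrArg (axis k) h
    rw [show ((g s : ℂ × ℂ)) = inject k s from rfl, axis_inject] at this
    rw [this]
    cases k <;> rfl
  obtain ⟨c, hc0, hc1⟩ := hax false
  obtain ⟨d, hd0, hd1⟩ := hax true
  obtain ⟨t, ⟨y, hy, rfl⟩, ht1, ht2⟩ := hI {t | t.1 ≠ 0} {t | t.2 ≠ 0}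
    (isOpen_ne_fun continuous_fst continuous_const) (isOpen_ne_fun continuous_snd continuous_const)
    (by
      rintro _ ⟨y, hy, rfl⟩
      by_contra hcon
      simp only [mem_union, mem_ofPred_eq, not_or, not_not] at hcon
      have : e.val y = e.val x := by rw [h0]; exact Prod.ext hcon.1 hcon.2
      exact hxR (e.val_injOn (hRe hy) hxe this ▸ hy))
    ⟨_, hc1, by simpa [inject] using hc0⟩ ⟨_, hd1, by simpa [inject] using hd0⟩
  have := e.val_mem y
  revert this hn
  generalize e.kind = κ
  cases κ <;> simp_all [ModelKind.carrier, ModelKind.IsNodal]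

end NodalChart


namespace NodalSurface

variable {X : Type u} [TopologicalSpace X] (S : NodalSurface X)

lemma crossing_eq : S.crossing = S.conic ∪ S.boundaryNodes := by
  ext x
  simp only [crossing, conic, boundaryNodes, mem_union, mem_ofPred_eq]
  grind

lemma nodes_eq : S.nodes = S.crossing ∪ S.inessential := by
  rw [crossing_eq, nodes, union_assoc, union_comm S.inessential, ← union_assoc]

/-- A chosen chart around each point. -/
def chartAt (x : X) : NodalChart X := (S.cover x).choose

lemma chartAt_mem (x : X) : S.chartAt x ∈ S.atlas := (S.cover x).choose_spec.1

lemma mem_chartAt (x : X) : x ∈ (S.chartAt x).source := (S.cover x).choose_spec.2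

lemma crossing_iff {e : NodalChart X} (he : e ∈ S.atlas) {x : X} (hx : x ∈ e.source) :
    x ∈ S.crossing ↔ e.Crossing x :=
  ⟨fun ⟨_, _, h⟩ => h.of_mem hx, fun h => ⟨e, he, h⟩⟩

/-- The points of `X`, except that each crossing point is doubled: `(x, false)` and `(x, true)` are
the centres of the two branches at `x` in the chart `S.chartAt x`. -/
def Normalization : Type u := {q : X × Bool // q.2 = true → q.1 ∈ S.crossing}

/-- The projection of the normalization. -/
def proj (q : S.Normalization) : X := q.1.1

/-- The branch `k` at the crossing point `x`. -/
def branch (x : X) (k : Bool) : Set S.Normalization :=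
  {q | S.proj q ∈ (S.chartAt x).source ∧ axis (!k) ((S.chartAt x).val (S.proj q)) = 0 ∧
    (S.proj q = x → q.1.2 = k)}

/-- The coarsest topology for which the projection is continuous and the branches are open. -/
instance instTopNormalization : TopologicalSpace S.Normalization :=
  TopologicalSpace.induced S.proj inferInstance ⊓
    TopologicalSpace.generateFrom {B | ∃ x ∈ S.crossing, ∃ k, B = S.branch x k}

lemma continuous_proj : Continuous S.proj :=
  continuous_iff_le_induced.2 inf_le_left

lemma isOpen_branch {x : X} (hx : x ∈ S.crossing) (k : Bool) : IsOpen (S.branch x k) :=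
  (TopologicalSpace.le_generateFrom_iff_subset_isOpen.1
    (inf_le_right : (inferInstance : TopologicalSpace S.Normalization) ≤ _)) ⟨x, hx, k, rfl⟩

/-- The part of a chart that lies on the branch `k`, without its crossing point, is open. -/
lemma isOpen_axis (e : NodalChart X) {k : Bool} (hk : e.kind.IsNodal ∨ k = false) :
    IsOpen {y | y ∈ e.source ∧ axis (!k) (e.val y) = 0 ∧ ¬ e.Crossing y} := by
  have h : {y | y ∈ e.source ∧ axis (!k) (e.val y) = 0 ∧ ¬ e.Crossing y} =
      e.homeo.source ∩ e.homeo ⁻¹' {t | ¬ e.kind.IsNodal ∨ axis k (t : ℂ × ℂ) ≠ 0} := by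
    ext y
    have := axis_not_eq_zero_iff hk (e.val_mem y)
    simp only [NodalChart.Crossing, NodalChart.source, NodalChart.val, mem_ofPred_eq, mem_inter_iff,
      mem_preimage] at this ⊢
    rw [← this]
    tauto
  rw [h]
  refine e.homeo.isOpen_inter_preimage ?_
  by_cases hn : e.kind.IsNodal
  · simpa [hn] using isOpen_ne_fun ((continuous_axis k).comp continuous_subtype_val)
      (continuous_const (y := (0 : ℂ)))
  · simp [hn]

lemma exists_nhds_nodes (x : X) : ∃ U ∈ 𝓝 x, U ∩ S.nodes ⊆ {x} := by
  obtain ⟨U, hU, hUD⟩ := S.discrete x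
  suffices ∃ V ∈ 𝓝 x, V ∩ S.crossing ⊆ {x} by
    obtain ⟨V, hV, hVC⟩ := this
    refine ⟨U ∩ V, inter_mem hU hV, ?_⟩
    rw [nodes_eq]
    rintro y ⟨⟨hyU, hyV⟩, hy | hy⟩
    · exact hVC ⟨hyV, hy⟩
    · exact hUD ⟨hyU, hy⟩
  have hs := (S.chartAt x).homeo.open_source.mem_nhds (S.mem_chartAt x)
  by_cases hx : x ∈ S.crossing
  · refine ⟨_, hs, fun y hy => ?_⟩
    have h1 := (S.crossing_iff (S.chartAt_mem x) (S.mem_chartAt x)).1 hx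
    have h2 := (S.crossing_iff (S.chartAt_mem x) hy.1).1 hy.2
    exact (S.chartAt x).val_injOn h2.1 h1.1 (h2.2.2.trans h1.2.2.symm)
  · obtain ⟨k, hk, hkx⟩ := axis_or ((S.chartAt x).val_mem x)
    refine ⟨_, (isOpen_axis (S.chartAt x) hk).mem_nhds ⟨S.mem_chartAt x, hkx, ?_⟩, ?_⟩
    · rwa [← S.crossing_iff (S.chartAt_mem x) (S.mem_chartAt x)]
    · rintro y ⟨⟨hy1, hy2, hy3⟩, hy4⟩
      exact absurd ((S.crossing_iff (S.chartAt_mem x) hy1).1 hy4) hy3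

/-- The complement of the nodes other than `x`. -/
def away (x : X) : Set X := {y | y ∈ S.nodes → y = x}

lemma isOpen_away (x : X) : IsOpen (S.away x) := by
  rw [isOpen_iff_mem_nhds]
  intro y hy
  obtain ⟨U, hU, hUN⟩ := S.exists_nhds_nodes y
  filter_upwards [hU] with t ht htN
  have : t = y := hUN ⟨ht, htN⟩
  subst this
  exact hy htN

lemma eq_of_mem_away {x y : X} (h : y ∈ S.away x) (hy : y ∈ S.crossing) : y = x :=
  h (by rw [nodes_eq]; exact Or.inl hy)

/-- The domain of the chart `branchChart` below. -/
def branchSource (x : X) (k : Bool) : Set S.Normalization :=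
  {q | S.proj q ∈ S.away x ∧ S.proj q ∈ (S.chartAt x).source ∧
    axis (!k) ((S.chartAt x).val (S.proj q)) = 0 ∧ (S.proj q ∈ S.crossing → q.1.2 = k)}

lemma isOpen_branchSource (x : X) {k : Bool} (hk : (S.chartAt x).kind.IsNodal ∨ k = false) :
    IsOpen (S.branchSource x k) := by
  rw [isOpen_iff_mem_nhds]
  rintro q ⟨h1, h2, h3, h4⟩
  have hW := S.continuous_proj.continuousAt.preimage_mem_nhds ((S.isOpen_away x).mem_nhds h1)
  by_cases hq : S.proj q ∈ S.crossing
  · have hqx := S.eq_of_mem_away h1 hq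
    have hx : x ∈ S.crossing := hqx ▸ hq
    filter_upwards [hW, (S.isOpen_branch hx k).mem_nhds ⟨h2, h3, fun _ => h4 hq⟩] with t ht ht'
    exact ⟨ht, ht'.1, ht'.2.1, fun hc => ht'.2.2 (S.eq_of_mem_away ht hc)⟩
  · filter_upwards [hW, S.continuous_proj.continuousAt.preimage_mem_nhds
      ((isOpen_axis (S.chartAt x) hk).mem_nhds
        ⟨h2, h3, by rwa [← S.crossing_iff (S.chartAt_mem x) h2]⟩)] with t ht ht'
    exact ⟨ht, ht'.1, ht'.2.1,
      fun hc => absurd ((S.crossing_iff (S.chartAt_mem x) ht'.1).1 hc) ht'.2.2⟩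

open Classical in
/-- The point of the normalization over `y` on the branch `k`. -/
def liftPoint (k : Bool) (y : X) : S.Normalization :=
  ⟨(y, if y ∈ S.crossing then k else false), by grind⟩

lemma proj_lift (k : Bool) (y : X) : S.proj (S.liftPoint k y) = y := rfl

lemma lift_proj {k : Bool} {q : S.Normalization} (h : S.proj q ∈ S.crossing → q.1.2 = k) :
    S.liftPoint k (S.proj q) = q := by
  apply Subtype.ext
  refine Prod.ext rfl ?_
  have h2 := q.2
  classical
  simp only [liftPoint]
  split_ifs with hc
  · exact (h hc).symm
  · rcases hb : q.1.2 with _ | _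
    · rfl
    · exact absurd (h2 hb) hc

/-- The inclusion of the model of one branch. -/
def injectModel {κ : ModelKind} {k : Bool} (hk : κ.IsNodal ∨ k = false) (a : κ.flat.carrier) :
    κ.carrier := ⟨inject k (a : ℂ × ℂ).1, inject_mem hk a.2⟩

lemma continuous_injectModel {κ : ModelKind} {k : Bool} (hk : κ.IsNodal ∨ k = false) :
    Continuous (injectModel hk) :=
  ((continuous_inject k).comp (continuous_fst.comp continuous_subtype_val)).subtype_mk _

lemma flat_snd {κ : ModelKind} (a : κ.flat.carrier) : (a : ℂ × ℂ).2 = 0 := by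
  obtain ⟨a, ha⟩ := a
  revert ha
  cases κ <;> simp +contextual [ModelKind.flat, ModelKind.carrier]

/-- The set of coordinates of the points in the domain of `branchChart` below. -/
def branchTarget (x : X) {k : Bool} (hk : (S.chartAt x).kind.IsNodal ∨ k = false) :
    Set (S.chartAt x).kind.flat.carrier :=
  injectModel hk ⁻¹' ((S.chartAt x).homeo.target ∩ (S.chartAt x).homeo.symm ⁻¹' S.away x)

lemma continuousOn_lift (x : X) {k : Bool} (hk : (S.chartAt x).kind.IsNodal ∨ k = false) :
    ContinuousOn (fun a => S.liftPoint k ((S.chartAt x).homeo.symm (injectModel hk a)))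
      (S.branchTarget x hk) := by
  have hc : ContinuousOn (fun a => (S.chartAt x).homeo.symm (injectModel hk a))
      (S.branchTarget x hk) :=
    (S.chartAt x).homeo.continuousOn_symm.comp (continuous_injectModel hk).continuousOn
      fun a ha => ha.1
  rw [continuousOn_iff_continuous_domRestrict]
  refine (continuous_inf_rng (t₂ := TopologicalSpace.induced S.proj inferInstance)
    (t₃ := TopologicalSpace.generateFrom {B | ∃ x ∈ S.crossing, ∃ k, B = S.branch x k})).2
    ⟨continuous_induced_rng.2 (continuousOn_iff_continuous_domRestrict.1 hc),
      continuous_generateFrom_iff.2 ?_⟩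
  rintro _ ⟨x', hx', k', rfl⟩
  rw [isOpen_iff_mem_nhds]
  rintro ⟨a, ha⟩ hB
  have hca := (continuousOn_iff_continuous_domRestrict.1 hc).continuousAt (x := ⟨a, ha⟩)
  set y := (S.chartAt x).homeo.symm (injectModel hk a) with hy
  obtain ⟨h1, h2, h3⟩ : y ∈ (S.chartAt x').source ∧ axis (!k') ((S.chartAt x').val y) = 0 ∧
    (y = x' → (S.liftPoint k y).1.2 = k') := hB
  have hx'c := (S.crossing_iff (S.chartAt_mem x') (S.mem_chartAt x')).1 hx'
  by_cases hyc : y ∈ S.crossing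
  · have hyx := S.eq_of_mem_away ha.2 hyc
    have hyx' : y = x' := by
      have h4 := (S.crossing_iff (S.chartAt_mem x') h1).1 hyc
      exact (S.chartAt x').val_injOn h4.1 hx'c.1 (h4.2.2.trans hx'c.2.2.symm)
    have hxx : x = x' := hyx.symm.trans hyx'
    subst hxx
    have hkk : k = k' := by
      have := h3 hyx'
      simpa [liftPoint, hyc] using this
    subst hkk
    refine Filter.univ_mem' ?_
    rintro ⟨b, hb⟩
    refine ⟨(S.chartAt x).homeo.map_target hb.1, ?_, fun h => ?_⟩
    · change axis (!k) (((S.chartAt x).homeo ((S.chartAt x).homeo.symm (injectModel hk b)) :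
        (S.chartAt x).kind.carrier) : ℂ × ℂ) = 0
      rw [(S.chartAt x).homeo.right_inv hb.1]
      exact axis_not_inject k _
    · have h5 : (S.chartAt x).homeo.symm (injectModel hk b) ∈ S.crossing := by
        have h6 : (S.chartAt x).homeo.symm (injectModel hk b) = x := h
        rw [h6]
        exact hx'
      simp [domRestrict, liftPoint, h5]
  · have h4 : ¬ (S.chartAt x').Crossing y := by
      rwa [← S.crossing_iff (S.chartAt_mem x') h1]
    filter_upwards [hca.preimage_mem_nhds
      ((isOpen_axis (S.chartAt x') (Or.inl hx'c.2.1)).mem_nhds ⟨h1, h2, h4⟩)] with b hb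
    obtain ⟨hb1, hb2, hb3⟩ := hb
    refine ⟨hb1, hb2, fun h => ?_⟩
    exfalso
    apply hb3
    have h6 : (S.chartAt x).homeo.symm (injectModel hk b.1) = x' := h
    change (S.chartAt x').Crossing ((S.chartAt x).homeo.symm (injectModel hk b.1))
    rw [h6]
    exact hx'c

/-- The chart of the normalization given by the branch `k` of the chosen chart at `x`, away from
the nodes other than `x`. -/
def branchChart (x : X) (k : Bool) (hk : (S.chartAt x).kind.IsNodal ∨ k = false) :
    NodalChart S.Normalization where
  kind := (S.chartAt x).kind.flat
  homeo :=
    { toFun := fun q => ⟨(axis k ((S.chartAt x).val (S.proj q)), 0),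
        axis_mem k ((S.chartAt x).val_mem _)⟩
      invFun := fun a => S.liftPoint k ((S.chartAt x).homeo.symm (injectModel hk a))
      source := S.branchSource x k
      target := S.branchTarget x hk
      map_source' := by
        rintro q ⟨h1, h2, h3, h4⟩
        have : injectModel hk ⟨(axis k ((S.chartAt x).val (S.proj q)), 0),
            axis_mem k ((S.chartAt x).val_mem _)⟩ = (S.chartAt x).homeo (S.proj q) :=
          Subtype.ext (inject_axis h3)
        rw [branchTarget, mem_preimage, this]
        refine ⟨(S.chartAt x).homeo.map_source h2, ?_⟩
        rw [mem_preimage, (S.chartAt x).homeo.left_inv h2]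
        exact h1
      map_target' := by
        intro a ha
        refine ⟨ha.2, (S.chartAt x).homeo.map_target ha.1, ?_, fun h => if_pos h⟩
        rw [proj_lift, NodalChart.val, (S.chartAt x).homeo.right_inv ha.1]
        exact axis_not_inject k _
      left_inv' := by
        rintro q ⟨h1, h2, h3, h4⟩
        have : injectModel hk ⟨(axis k ((S.chartAt x).val (S.proj q)), 0),
            axis_mem k ((S.chartAt x).val_mem _)⟩ = (S.chartAt x).homeo (S.proj q) :=
          Subtype.ext (inject_axis h3)
        rw [this, (S.chartAt x).homeo.left_inv h2]
        exact S.lift_proj h4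
      right_inv' := by
        intro a ha
        apply Subtype.ext
        refine Prod.ext ?_ (flat_snd a).symm
        change axis k ((S.chartAt x).val (S.proj (S.liftPoint k _))) = _
        rw [proj_lift, NodalChart.val, (S.chartAt x).homeo.right_inv ha.1]
        exact axis_inject k _
      open_source := S.isOpen_branchSource x hk
      open_target := ((S.chartAt x).homeo.isOpen_inter_preimage_symm (S.isOpen_away x)).preimage
        (continuous_injectModel hk)
      continuousOn_toFun := by
        rw [Topology.IsInducing.subtypeVal.continuousOn_iff]
        refine ContinuousOn.prodMk ?_ continuousOn_const
        refine (continuous_axis k).comp_continuousOn (continuous_subtype_val.comp_continuousOn ?_)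
        exact (S.chartAt x).homeo.continuousOn.comp S.continuous_proj.continuousOn
          fun q hq => hq.2.1
      continuousOn_invFun := S.continuousOn_lift x hk }

/-- The normalization of a surface with nodes, as a surface without nodes. -/
def normalization : NodalSurface S.Normalization where
  t2 := by
    have := S.t2
    refine ⟨fun q q' hne => ?_⟩
    by_cases h : S.proj q = S.proj q'
    · have hx : S.proj q ∈ S.crossing ∧ q.1.2 ≠ q'.1.2 := by
        have h1 : q.1.2 ≠ q'.1.2 := fun h2 => hne (Subtype.ext (Prod.ext h h2))
        refine ⟨?_, h1⟩
        rcases hb : q.1.2 with _ | _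
        · rw [h]
          exact q'.2 (by grind)
        · exact q.2 hb
      have hc := (S.crossing_iff (S.chartAt_mem _) (S.mem_chartAt (S.proj q))).1 hx.1
      refine ⟨S.branch (S.proj q) q.1.2, S.branch (S.proj q) q'.1.2, S.isOpen_branch hx.1 _,
        S.isOpen_branch hx.1 _, ⟨S.mem_chartAt _, ?_, fun _ => rfl⟩,
        ⟨h ▸ S.mem_chartAt _, ?_, fun _ => rfl⟩, ?_⟩
      · rw [hc.2.2]; simp [axis]
      · rw [← h, hc.2.2]; simp [axis]
      · rw [Set.disjoint_left]
        rintro t ⟨h1, h2, h3⟩ ⟨-, h5, h6⟩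
        have ht : (S.chartAt (S.proj q)).val (S.proj t) = 0 := by
          have := hx.2
          revert h2 h5 this
          generalize q.1.2 = k
          generalize q'.1.2 = k'
          cases k <;> cases k' <;> simp_all [axis, Prod.ext_iff]
        have := (S.chartAt (S.proj q)).val_injOn h1 hc.1 (ht.trans hc.2.2.symm)
        exact hx.2 ((h3 this).symm.trans (h6 this))
    · obtain ⟨U, V, hU, hV, hqU, hqV, hd⟩ := t2_separation h
      exact ⟨_, _, hU.preimage S.continuous_proj, hV.preimage S.continuous_proj, hqU, hqV,
        hd.preimage _⟩
  atlas := {c | ∃ (x : X) (k : Bool) (hk : (S.chartAt x).kind.IsNodal ∨ k = false),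
    c = S.branchChart x k hk}
  cover := by
    intro q
    have hm := S.mem_chartAt (S.proj q)
    by_cases hx : S.proj q ∈ S.crossing
    · have hc := (S.crossing_iff (S.chartAt_mem _) hm).1 hx
      refine ⟨_, ⟨S.proj q, q.1.2, Or.inl hc.2.1, rfl⟩, fun _ => rfl, hm, ?_, fun _ => rfl⟩
      rw [hc.2.2]; simp [axis]
    · obtain ⟨k, hk, hkx⟩ := axis_or ((S.chartAt (S.proj q)).val_mem (S.proj q))
      exact ⟨_, ⟨S.proj q, k, hk, rfl⟩, fun _ => rfl, hm, hkx, fun h => absurd h hx⟩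
  inessential := ∅
  discrete := fun x => ⟨univ, Filter.univ_mem, by simp⟩
  planar := by simp

end NodalSurface

/-! ### Maps and morphisms -/

section Maps

variable {X Y : Type u} [TopologicalSpace X] [TopologicalSpace Y]

/-- Maps between surfaces with nodes. -/
def IsNodalMap (S : NodalSurface X) (T : NodalSurface Y) (f : X → Y) : Prop :=
  Continuous f ∧ f ⁻¹' T.conic ⊆ S.conic ∧ f ⁻¹' T.inessential ⊆ S.inessential ∪ S.conic ∧
    f ⁻¹' T.boundaryNodes ⊆ S.boundaryNodes ∪ S.conic ∧ f '' S.boundary ⊆ T.boundary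

/-- `g` is the lifting of `f` to the normalizations. -/
def IsLifting (S : NodalSurface X) (T : NodalSurface Y) (f : X → Y)
    (g : S.Normalization → T.Normalization) : Prop :=
  Continuous g ∧ ∀ q, T.proj (g q) = f (S.proj q)

/-- Complete maps: the lifting maps each fibre of the normalization onto the fibre over the image. -/
def IsComplete (S : NodalSurface X) (T : NodalSurface Y) (f : X → Y) : Prop :=
  ∃ g, IsLifting S T f g ∧ ∀ z, g '' (S.proj ⁻¹' {z}) = T.proj ⁻¹' {f z}

/-- Analytic maps between Riemann surfaces with nodes. -/
def IsAnalyticMap (S : NodalSurface X) (T : NodalSurface Y) (f : X → Y) : Prop :=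
  IsNodalMap S T f ∧ ∀ x ∉ S.nodes, ∃ e ∈ S.atlas, ∃ e' ∈ T.atlas, x ∈ e.source ∧ f x ∈ e'.source ∧
    AnalyticRel e.coord (fun y => e'.coord (f y)) x

/-- Antianalytic maps between Riemann surfaces with nodes. -/
def IsAntianalyticMap (S : NodalSurface X) (T : NodalSurface Y) (f : X → Y) : Prop :=
  IsNodalMap S T f ∧ ∀ x ∉ S.nodes, ∃ e ∈ S.atlas, ∃ e' ∈ T.atlas, x ∈ e.source ∧ f x ∈ e'.source ∧
    AntianalyticRel e.coord (fun y => e'.coord (f y)) x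

/-- The folding map `x + iy ↦ x + i|y|` of `ℂ` onto the closed upper half plane. -/
def fold (z : ℂ) : ℂ := ⟨z.re, |z.im|⟩

/-- In the charts `e` and `e'`, the map `f` is given near `x` by the analytic function `F`, followed
by the folding map if `e'` takes values in a half plane; in a chart with values in the plane, `f` may
also be given by the conjugate of `F`. -/
def LocalRep (e : NodalChart X) (e' : NodalChart Y) (f : X → Y) (x : X) (F : ℂ → ℂ) : Prop :=
  x ∈ e.source ∧ f x ∈ e'.source ∧ AnalyticAt ℂ F (e.coord x) ∧
    ((e'.kind.IsHalf ∧ ∀ᶠ y in 𝓝 x, e'.coord (f y) = fold (F (e.coord y))) ∨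
     (¬ e'.kind.IsHalf ∧ ∀ᶠ y in 𝓝 x, e'.coord (f y) = F (e.coord y)) ∨
     (¬ e'.kind.IsHalf ∧ ∀ᶠ y in 𝓝 x, e'.coord (f y) = conj (F (e.coord y))))

/-- `f` is dianalytic at the point `x` (where neither `x` nor `f x` is a node). -/
def IsDianalyticAt (S : NodalSurface X) (T : NodalSurface Y) (f : X → Y) (x : X) : Prop :=
  ∃ e ∈ S.atlas, ∃ e' ∈ T.atlas, ∃ F, LocalRep e e' f x F

/-- The ramification index of `f` at `x` is `n`. -/
def HasRamificationIndex (S : NodalSurface X) (T : NodalSurface Y) (f : X → Y) (x : X) (n : ℕ) :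
    Prop :=
  ∃ e ∈ S.atlas, ∃ e' ∈ T.atlas, ∃ F, LocalRep e e' f x F ∧
    analyticOrderAt (fun u => F u - F (e.coord x)) (e.coord x) = n

/-- Morphisms of Klein surfaces (surfaces without nodes). -/
def IsKleinMorphism (S : NodalSurface X) (T : NodalSurface Y) (f : X → Y) : Prop :=
  Continuous f ∧ f '' S.boundary ⊆ T.boundary ∧ ∀ x, IsDianalyticAt S T f x

open Classical in
/-- The relative degree of `f` at `x`: it is `2` where an interior point is mapped to the boundary. -/
def relativeDegree (S : NodalSurface X) (T : NodalSurface Y) (f : X → Y) (x : X) : ℕ :=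
  if x ∉ S.boundary ∧ f x ∈ T.boundary then 2 else 1

/-- Double covers of Klein surfaces: morphisms all of whose fibres have two points, counted with
ramification index and relative degree. -/
def IsKleinDoubleCover (S : NodalSurface X) (T : NodalSurface Y) (f : X → Y) : Prop :=
  IsKleinMorphism S T f ∧ ∃ ι : X → ℕ, (∀ x, HasRamificationIndex S T f x (ι x)) ∧
    ∀ y, (f ⁻¹' {y}).Finite ∧ ∑ᶠ x ∈ f ⁻¹' {y}, ι x * relativeDegree S T f x = 2

/-- Unbranched double covers of Klein surfaces. -/
def IsUnbranchedKleinDoubleCover (S : NodalSurface X) (T : NodalSurface Y) (f : X → Y) : Prop :=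
  IsKleinDoubleCover S T f ∧ ∀ x, HasRamificationIndex S T f x 1

/-- `(X, π, σ)` is a complex double of the Klein surface `Y` (both without nodes). -/
def IsKleinComplexDouble (S : NodalSurface X) (T : NodalSurface Y) (π : X → Y) (σ : X → X) : Prop :=
  S.IsRiemann ∧ S.nodes = ∅ ∧ IsAntianalyticMap S S σ ∧ (∀ x, σ (σ x) = x) ∧
    IsUnbranchedKleinDoubleCover S T π ∧ ∀ x, π (σ x) = π x

/-- Morphisms of Klein surfaces with nodes. -/
def IsMorphism (S : NodalSurface X) (T : NodalSurface Y) (f : X → Y) : Prop :=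
  IsNodalMap S T f ∧ (∀ x ∉ S.nodes, IsDianalyticAt S T f x) ∧ IsComplete S T f

/-- Unbranched double covers of Klein surfaces with nodes. -/
def IsUnbranchedDoubleCover (S : NodalSurface X) (T : NodalSurface Y) (f : X → Y) : Prop :=
  IsMorphism S T f ∧ ∃ g, IsLifting S T f g ∧
    IsUnbranchedKleinDoubleCover S.normalization T.normalization g

/-- `(X, σ)` is a symmetric Riemann surface with nodes. -/
def IsSymmetric (S : NodalSurface X) (σ : X → X) : Prop :=
  S.IsRiemann ∧ IsAntianalyticMap S S σ ∧ IsComplete S S σ ∧ ∀ x, σ (σ x) = x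

/-- `(X, π, σ)` is a complex double of the Klein surface with nodes `Y`. -/
def IsComplexDouble (S : NodalSurface X) (T : NodalSurface Y) (π : X → Y) (σ : X → X) : Prop :=
  IsSymmetric S σ ∧ IsUnbranchedDoubleCover S T π ∧ (∀ x, π (σ x) = π x) ∧ π '' S.nodes = T.nodes

end Maps

/-! ### The identifications -/

section Identifications

variable {X W : Type u} [TopologicalSpace X]

/-- The smallest equivalence relation with `a ∼ b`. -/
def identify (a b : W) : Setoid W := sInf {s | s a b}

/-- The identifications allowed over the node `z`, for a map `π` from `W` to the normalization. Over a
conic node the labels of the two points in each fibre are arbitrary. -/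
inductive IsIdentificationAt (S : NodalSurface X) (π : W → S.Normalization) (z : X) :
    Setoid W → Prop
  | boundary (z₁ z₂ : S.Normalization) (w₁ w₂ : W) (hz : z ∈ S.boundaryNodes) (hne : z₁ ≠ z₂)
      (hp : S.proj ⁻¹' {z} = {z₁, z₂}) (h₁ : π ⁻¹' {z₁} = {w₁}) (h₂ : π ⁻¹' {z₂} = {w₂}) :
      IsIdentificationAt S π z (identify w₁ w₂)
  | inessential (z₁ : S.Normalization) (w₁ w₂ : W) (hz : z ∈ S.inessential)
      (hp : S.proj ⁻¹' {z} = {z₁}) (hw : w₁ ≠ w₂) (h₁ : π ⁻¹' {z₁} = {w₁, w₂}) :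
      IsIdentificationAt S π z (identify w₁ w₂)
  | conic (z₁ z₂ : S.Normalization) (w₁₁ w₁₂ w₂₁ w₂₂ : W) (hz : z ∈ S.conic) (hne : z₁ ≠ z₂)
      (hp : S.proj ⁻¹' {z} = {z₁, z₂}) (hw₁ : w₁₁ ≠ w₁₂) (hw₂ : w₂₁ ≠ w₂₂)
      (h₁ : π ⁻¹' {z₁} = {w₁₁, w₁₂}) (h₂ : π ⁻¹' {z₂} = {w₂₁, w₂₂}) :
      IsIdentificationAt S π z (identify w₁₁ w₂₁ ⊔ identify w₁₂ w₂₂)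

/-- A choice of one allowed identification over each node. -/
def Choice (S : NodalSurface X) (π : W → S.Normalization) : Type u :=
  ∀ z : S.nodes, {s : Setoid W // IsIdentificationAt S π z s}

/-- The equivalence relation generated by the chosen identifications. -/
def Choice.rel {S : NodalSurface X} {π : W → S.Normalization} (c : Choice S π) : Setoid W :=
  ⨆ z, (c z).1

end Identifications

end Nodal

end

namespace Nodal

/-! ### Calculus of analytic relations -/

section Relations

variable {X Y : Type u} [TopologicalSpace X] [TopologicalSpace Y] {a b c : X → ℂ} {x : X}

/-! Everything is decided by the fibres of the given double of the normalization and by how its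
symmetry `σ` acts on them.

Fibres. The ramification index is the growth rate of the map in coordinates, so it does not depend
on the charts (`HasRamificationIndex.le`) and equals 1 everywhere. The weighted count then gives one
point over a boundary point of the normalization and two over an interior point. Boundary nodes lift
to boundary points, and conic and inessential nodes to interior points. For the conic nodes this
rests on the open mapping theorem: a dianalytic transition map cannot press a full disc into a half
plane so that its centre lands on the edge (`IsKlein.not_boundary`, `IsKlein.disjoint_conic`). This
gives one identification over a boundary or inessential node and two over a conic node.

Symmetry. Over the interior the covering map is, up to conjugation, a local analytic isomorphism, so
an antianalytic `σ` over it has no fixed point there (`IsKleinComplexDouble.sigma_ne`). Hence `σ`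
exchanges the two points of every interior fibre, and each admissible pairing automatically commutes
with `σ`. A choice therefore amounts to an involution `τ` that commutes with `σ`, moves exactly the
points over nodes, and sends each point to a partner such that the two together cover the whole
fibre of the normalization (`Choice.exists_involution`). The generated equivalence relation is the
orbit relation of `τ`, and its restriction to the fibre over a node recovers the identification
chosen there.

Quotient. The surface is built from any involution of a Riemann surface whose moved points are
discrete (`IsPinching`). Unmoved points keep their coordinates; two discs centred at exchanged
points are glued into a node. Separating the sheets again returns the original surface
(`IsPinching.normalizationHomeomorph`). The projection and `σ` descend because they respect `τ`,
local formulas descend at unmoved points (`LocalRep.transport`), and completeness of the projection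
is the fibre property of `τ` (`isComplexDouble_pinch`). -/

lemma AnalyticRel.trans (h : AnalyticRel a b x) (h' : AnalyticRel b c x) : AnalyticRel a c x := by
  obtain ⟨F, hF, hFe⟩ := h
  obtain ⟨G, hG, hGe⟩ := h'
  refine ⟨G ∘ F, AnalyticAt.comp (by rwa [← hFe.self_of_nhds]) hF, ?_⟩
  filter_upwards [hFe, hGe] with y h1 h2
  rw [h2, h1]
  rfl

lemma AnalyticRel.trans_anti (h : AnalyticRel a b x) (h' : AntianalyticRel b c x) :
    AntianalyticRel a c x := by
  obtain ⟨F, hF, hFe⟩ := h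
  obtain ⟨G, hG, hGe⟩ := h'
  refine ⟨G ∘ F, AnalyticAt.comp (by rwa [← hFe.self_of_nhds]) hF, ?_⟩
  filter_upwards [hFe, hGe] with y h1 h2
  rw [h2, h1]
  rfl

/-- Analyticity is complex differentiability nearby, and two conjugations preserve the latter. This
allows a conjugation to be moved from the inside of an analytic function to the outside. -/
lemma _root_.AnalyticAt.conj_comp_conj {F : ℂ → ℂ} {z : ℂ} (hF : AnalyticAt ℂ F (conj z)) :
    AnalyticAt ℂ (fun u => conj (F (conj u))) z := by
  rw [Complex.analyticAt_iff_eventually_differentiableAt] at hF ⊢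
  filter_upwards [Complex.continuous_conj.continuousAt.eventually hF] with u hu
  have := hu.hasDerivAt.conj_conj
  rw [Complex.conj_conj] at this
  exact this.differentiableAt

lemma AntianalyticRel.trans_analytic (h : AntianalyticRel a b x) (h' : AnalyticRel b c x) :
    AntianalyticRel a c x := by
  obtain ⟨F, hF, hFe⟩ := h
  obtain ⟨G, hG, hGe⟩ := h'
  refine ⟨fun u => conj (G (conj (F u))), ?_, ?_⟩
  · have h1 : AnalyticAt ℂ G (conj (F (a x))) := by rwa [← hFe.self_of_nhds]
    exact AnalyticAt.comp (g := fun u => conj (G (conj u))) h1.conj_comp_conj hF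
  · filter_upwards [hFe, hGe] with y h1 h2
    rw [h2, h1, Complex.conj_conj]

lemma AnalyticRel.of_eventuallyEq (h : b =ᶠ[𝓝 x] a) : AnalyticRel a b x :=
  ⟨id, analyticAt_id, h⟩

lemma AnalyticRel.congr {a' b' : X → ℂ} (h : AnalyticRel a b x) (ha : a =ᶠ[𝓝 x] a')
    (hb : b =ᶠ[𝓝 x] b') : AnalyticRel a' b' x :=
  (AnalyticRel.of_eventuallyEq ha).trans (h.trans (AnalyticRel.of_eventuallyEq hb.symm))

lemma AnalyticRel.comp {a b : Y → ℂ} {f : X → Y} (h : AnalyticRel a b (f x))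
    (hf : ContinuousAt f x) : AnalyticRel (fun y => a (f y)) (fun y => b (f y)) x := by
  obtain ⟨F, hF, hFe⟩ := h
  exact ⟨F, hF, hf.eventually hFe⟩

lemma AntianalyticRel.comp {a b : Y → ℂ} {f : X → Y} (h : AntianalyticRel a b (f x))
    (hf : ContinuousAt f x) : AntianalyticRel (fun y => a (f y)) (fun y => b (f y)) x := by
  obtain ⟨F, hF, hFe⟩ := h
  exact ⟨F, hF, hf.eventually hFe⟩

/-- A germ identity checked after composing with `f` holds on the target when `f` carries
neighbourhoods onto neighbourhoods. It is used for the quotient map at unmoved points and for the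
homeomorphism onto the normalization. -/
lemma AnalyticRel.descend {a b : Y → ℂ} {f : X → Y} (hf : map f (𝓝 x) = 𝓝 (f x))
    (h : AnalyticRel (fun y => a (f y)) (fun y => b (f y)) x) : AnalyticRel a b (f x) := by
  obtain ⟨F, hF, hFe⟩ := h
  exact ⟨F, hF, by rw [← hf]; exact hFe⟩

lemma AntianalyticRel.descend {a b : Y → ℂ} {f : X → Y} (hf : map f (𝓝 x) = 𝓝 (f x))
    (h : AntianalyticRel (fun y => a (f y)) (fun y => b (f y)) x) : AntianalyticRel a b (f x) := by
  obtain ⟨F, hF, hFe⟩ := h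
  exact ⟨F, hF, by rw [← hf]; exact hFe⟩

/-- An analytic change of coordinates with an analytic inverse has nonzero derivative. -/
lemma deriv_ne_zero_of_leftInverse {F G : ℂ → ℂ} {z : ℂ} (hF : AnalyticAt ℂ F z)
    (hG : AnalyticAt ℂ G (F z)) (h : ∀ᶠ u in 𝓝 z, G (F u) = u) : deriv F z ≠ 0 := by
  intro h0
  have h1 := hG.differentiableAt.hasDerivAt.comp z hF.differentiableAt.hasDerivAt
  rw [h0, mul_zero] at h1
  have h2 : HasDerivAt (G ∘ F) 1 z := (hasDerivAt_id z).congr_of_eventuallyEq h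
  exact one_ne_zero (h2.unique h1)

open Asymptotics in
-- Coordinate changes are locally Lipschitz; this is all that the invariance of the ramification
-- index needs, and it holds equally for antianalytic changes.
lemma AnalyticRel.isBigO (h : AnalyticRel a b x) (ha : ContinuousAt a x) :
    (fun y => b y - b x) =O[𝓝 x] (fun y => a y - a x) := by
  obtain ⟨F, hF, hFe⟩ := h
  have h1 : (fun u => F u - F (a x)) =O[𝓝 (a x)] (fun u => u - a x) :=
    hF.differentiableAt.isBigO_sub
  refine (h1.comp_tendsto ha).congr' ?_ EventuallyEq.rfl
  filter_upwards [hFe] with y hy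
  simp [hy, hFe.self_of_nhds]

open Asymptotics in
lemma AntianalyticRel.isBigO (h : AntianalyticRel a b x) (ha : ContinuousAt a x) :
    (fun y => b y - b x) =O[𝓝 x] (fun y => a y - a x) := by
  obtain ⟨F, hF, hFe⟩ := h
  refine (AnalyticRel.isBigO ⟨F, hF, Eventually.of_forall fun y => rfl⟩ ha).norm_left.congr'
    ?_ EventuallyEq.rfl |>.of_norm_left
  filter_upwards [hFe] with y hy
  rw [hy, hFe.self_of_nhds, ← map_sub, Complex.norm_conj]

end Relations

/-! ### Local properties of charts -/

lemma coord_inject (k : Bool) (a : ℂ) : (inject k a).1 + (inject k a).2 = a := by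
  cases k <;> simp [inject]

lemma axis_zero (k : Bool) : axis k 0 = 0 := by
  cases k <;> rfl

lemma inject_eq_zero_iff {k : Bool} {a : ℂ} : inject k a = 0 ↔ a = 0 := by
  cases k <;> simp [inject, Prod.ext_iff]

lemma ModelKind.half_eq_univ {κ : ModelKind} (h : ¬ κ.IsHalf) : κ.half = univ := by
  ext a
  simp [half, h]

/-- One branch of a model without boundary, with its crossing point removed. -/
noncomputable def branchCoord {κ : ModelKind} (hh : ¬ κ.IsHalf) {k : Bool}
    (hk : κ.IsNodal ∨ k = false) : OpenPartialHomeomorph κ.carrier ℂ where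
  toFun q := axis k q
  invFun a := ⟨inject k a, inject_mem_half hk (by simp [ModelKind.half_eq_univ hh])⟩
  source := {q | ¬ κ.IsNodal ∨ axis k (q : ℂ × ℂ) ≠ 0}
  target := {a | ¬ κ.IsNodal ∨ a ≠ 0}
  map_source' _ h := h
  map_target' a h := by simpa [axis_inject] using h
  left_inv' q h := Subtype.ext (inject_axis ((axis_not_eq_zero_iff hk q.2).2 h).1)
  right_inv' a _ := axis_inject k a
  open_source := by
    by_cases hn : κ.IsNodal
    · simpa [hn] using isOpen_ne_fun ((continuous_axis k).comp continuous_subtype_val)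
        (continuous_const (y := (0 : ℂ)))
    · simp [hn]
  open_target := by
    by_cases hn : κ.IsNodal
    · simpa [hn] using isOpen_ne (x := (0 : ℂ))
    · simp [hn]
  continuousOn_toFun := ((continuous_axis k).comp continuous_subtype_val).continuousOn
  continuousOn_invFun := ((continuous_inject k).subtype_mk _).continuousOn

namespace NodalChart

variable {X : Type u} [TopologicalSpace X] (e : NodalChart X)

lemma isOpen_source : IsOpen e.source := e.homeo.open_source

lemma continuousOn_val : ContinuousOn e.val e.source :=
  continuous_subtype_val.comp_continuousOn e.homeo.continuousOn

lemma continuousOn_coord : ContinuousOn e.coord e.source :=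
  (continuous_fst.add continuous_snd).comp_continuousOn e.continuousOn_val

lemma continuousAt_coord {x : X} (hx : x ∈ e.source) : ContinuousAt e.coord x :=
  e.continuousOn_coord.continuousAt (e.isOpen_source.mem_nhds hx)

lemma coord_eq_axis {k : Bool} {x : X} (h : axis (!k) (e.val x) = 0) :
    e.coord x = axis k (e.val x) := by
  rw [coord, ← inject_axis h, coord_inject, axis_inject]

lemma val_eq_inject {k : Bool} {x : X} (h : axis (!k) (e.val x) = 0) :
    e.val x = inject k (e.coord x) := by
  rw [e.coord_eq_axis h, inject_axis h]

lemma exists_branch {x : X} (hx : x ∈ e.source) (hc : ¬ e.Crossing x) :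
    ∃ k, (e.kind.IsNodal ∨ k = false) ∧ axis (!k) (e.val x) = 0 ∧
      ∀ᶠ y in 𝓝 x, y ∈ e.source ∧ axis (!k) (e.val y) = 0 := by
  obtain ⟨k, hk, h⟩ := axis_or (e.val_mem x)
  refine ⟨k, hk, h, ?_⟩
  filter_upwards [(NodalSurface.isOpen_axis e hk).mem_nhds ⟨hx, h, hc⟩] with y hy
  exact ⟨hy.1, hy.2.1⟩

/-- The coordinate is injective near a point that is not a crossing point. -/
lemma exists_injOn_coord {x : X} (hx : x ∈ e.source) (hc : ¬ e.Crossing x) :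
    ∃ U ∈ 𝓝 x, InjOn e.coord U := by
  obtain ⟨k, -, -, h⟩ := e.exists_branch hx hc
  refine ⟨_, h, fun y hy t ht hyt => e.val_injOn hy.1 ht.1 ?_⟩
  rw [e.val_eq_inject hy.2, e.val_eq_inject ht.2, hyt]

/-- Near an interior point that is not a crossing point, the coordinate is a homeomorphism onto an
open set of the plane. -/
lemma exists_openPartialHomeomorph {x : X} (hx : x ∈ e.source) (hc : ¬ e.Crossing x)
    (hh : ¬ e.kind.IsHalf) : ∃ φ : OpenPartialHomeomorph X ℂ, x ∈ φ.source ∧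
      φ.source ⊆ e.source ∧ ∀ y ∈ φ.source, φ y = e.coord y := by
  obtain ⟨k, hk, h, -⟩ := e.exists_branch hx hc
  have h1 := (axis_not_eq_zero_iff hk (e.val_mem x)).1
    ⟨h, fun h' => hc ⟨hx, h'⟩⟩
  refine ⟨e.homeo.trans (branchCoord hh hk), ?_, ?_, ?_⟩
  · rw [OpenPartialHomeomorph.trans_source]
    exact ⟨hx, h1⟩
  · rw [OpenPartialHomeomorph.trans_source]
    exact inter_subset_left
  · intro y hy
    rw [OpenPartialHomeomorph.trans_source] at hy
    have h2 := (axis_not_eq_zero_iff hk (e.val_mem y)).2 hy.2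
    rw [e.coord_eq_axis h2.1]
    rfl

/-- Turns statements that hold near `x` into statements on a full neighbourhood in `ℂ`, where the
theory of analytic functions applies. -/
lemma map_coord_nhds {x : X} (hx : x ∈ e.source) (hc : ¬ e.Crossing x)
    (hh : ¬ e.kind.IsHalf) : map e.coord (𝓝 x) = 𝓝 (e.coord x) := by
  obtain ⟨φ, h1, h2, h3⟩ := e.exists_openPartialHomeomorph hx hc hh
  rw [← h3 x h1, ← φ.map_nhds_eq h1]
  refine map_congr ?_
  filter_upwards [φ.open_source.mem_nhds h1] with y hy
  exact (h3 y hy).symm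

/-- In the half plane models, coordinates have nonnegative imaginary part. -/
lemma coord_im_nonneg (h : e.kind.IsHalf) (x : X) : 0 ≤ (e.coord x).im := by
  obtain ⟨k, -, hk⟩ := axis_or (e.val_mem x)
  rw [e.coord_eq_axis hk]
  exact ModelKind.mem_half (e.val_mem x) h

end NodalChart

/-! ### Invariance of the boundary, and separation of conic nodes from boundary nodes -/

namespace NodalSurface

variable {X : Type u} [TopologicalSpace X] {S : NodalSurface X}

lemma not_crossing_of_notMem_nodes {e : NodalChart X} (he : e ∈ S.atlas) {x : X}
    (hx : x ∉ S.nodes) : ¬ e.Crossing x := by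
  intro h
  apply hx
  rw [nodes_eq]
  exact Or.inl ⟨e, he, h⟩

/-- The boundary does not depend on the chart, outside the nodes of a Klein surface. -/
lemma IsKlein.not_boundary (hS : S.IsKlein) {e e' : NodalChart X} (he : e ∈ S.atlas)
    (he' : e' ∈ S.atlas) {x : X} (hx : x ∈ e.source) (hx' : x ∈ e'.source) (hn : x ∉ S.nodes)
    (hh : ¬ e.kind.IsHalf) (hh' : e'.kind.IsHalf) : (e'.coord x).im ≠ 0 := by
  intro h0
  have hc := not_crossing_of_notMem_nodes he hn
  have hc' := not_crossing_of_notMem_nodes he' hn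
  have hmap := e.map_coord_nhds hx hc hh
  -- The sign `s = ±1` treats analytic and antianalytic transitions together: conjugation only
  -- changes the sign of the imaginary part.
  obtain ⟨F, hF, s, hs, hsF⟩ : ∃ F : ℂ → ℂ, AnalyticAt ℂ F (e.coord x) ∧ ∃ s : ℝ, s ≠ 0 ∧
      ∀ᶠ y in 𝓝 x, (e'.coord y).re = (F (e.coord y)).re ∧
        (e'.coord y).im = s * (F (e.coord y)).im := by
    rcases hS e he e' he' x ⟨hx, hx'⟩ hn with ⟨F, hF, h⟩ | ⟨F, hF, h⟩
    · exact ⟨F, hF, 1, one_ne_zero, h.mono fun y hy => by simp [hy]⟩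
    · exact ⟨F, hF, -1, by norm_num, h.mono fun y hy => by simp [hy]⟩
  have hpos : ∀ᶠ u in 𝓝 (e.coord x), 0 ≤ s * (F u).im := by
    rw [← hmap, eventually_map]
    filter_upwards [hsF] with y hy
    rw [← hy.2]
    exact e'.coord_im_nonneg hh' y
  have hF0 : (F (e.coord x)).im = 0 := by
    have := hsF.self_of_nhds.2
    rw [h0] at this
    exact (mul_eq_zero.1 this.symm).resolve_left hs
  -- Open mapping dichotomy. A constant `F` would make `x` isolated, because `e'.coord` is injective
  -- nearby, yet `x` has a neighbourhood homeomorphic to a plane open set. An open `F` takes values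
  -- on both sides of the real axis.
  rcases hF.eventually_constant_or_nhds_le_map_nhds with h | h
  · obtain ⟨U, hU, hUi⟩ := e'.exists_injOn_coord hx' hc'
    have h1 : ∀ᶠ y in 𝓝 x, y = x := by
      have h2 : ∀ᶠ y in 𝓝 x, F (e.coord y) = F (e.coord x) :=
        (e.continuousAt_coord hx).eventually h
      filter_upwards [h2, hsF, hU] with y h3 h4 h5
      refine hUi h5 (mem_of_mem_nhds hU) (Complex.ext ?_ ?_)
      · rw [h4.1, hsF.self_of_nhds.1, h3]
      · rw [h4.2, hsF.self_of_nhds.2, h3]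
    have h2 : ∀ᶠ u in 𝓝 (e.coord x), u = e.coord x := by
      rw [← hmap, eventually_map]
      filter_upwards [h1] with y hy
      rw [hy]
    have h3 : ∀ᶠ u in 𝓝[≠] (e.coord x), u = e.coord x := h2.filter_mono nhdsWithin_le_nhds
    obtain ⟨u, hu, hu'⟩ := (h3.and self_mem_nhdsWithin).exists
    exact hu' hu
  · have h1 : ∀ᶠ v in 𝓝 (F (e.coord x)), 0 ≤ s * v.im := h hpos
    -- These values have imaginary part `-t * s`, so `s` times it is `-t * s ^ 2 < 0`, against
    -- `hpos`.
    have h2 : Tendsto (fun t : ℝ => F (e.coord x) - (t * s : ℝ) * Complex.I) (𝓝[>] 0)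
        (𝓝 (F (e.coord x))) := by
      have : Continuous (fun t : ℝ => F (e.coord x) - (t * s : ℝ) * Complex.I) := by fun_prop
      have h3 := this.tendsto 0
      simp only [zero_mul, Complex.ofReal_zero, sub_zero] at h3
      exact h3.mono_left nhdsWithin_le_nhds
    obtain ⟨t, ht, ht0⟩ := ((h2.eventually h1).and self_mem_nhdsWithin).exists
    have ht0' : 0 < t := ht0
    simp only [Complex.sub_im, hF0, Complex.mul_im, Complex.ofReal_re, Complex.ofReal_im,
      Complex.I_re, Complex.I_im] at ht
    nlinarith [mul_pos ht0' (mul_self_pos.2 hs)]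

/-- A crossing point of a Klein surface cannot be both a conic node and a boundary node. -/
lemma IsKlein.disjoint_conic (hS : S.IsKlein) : Disjoint S.conic S.boundaryNodes := by
  rw [Set.disjoint_left]
  rintro x ⟨e, he, hc, hh⟩ ⟨e', he', hc', hh'⟩
  obtain ⟨U, hU, hUn⟩ := S.exists_nhds_nodes x
  -- Real points on one branch of the half model tend to the crossing. Close to it, but off it, they
  -- are no nodes and lie on the edge in `e'`, while `e` has no edge.
  have hm : ∀ s : ℝ, (s : ℂ) ∈ e'.kind.half := fun s _ => by simp
  let g : ℝ → e'.kind.carrier := fun s =>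
    ⟨inject false s, inject_mem_half (Or.inl hc'.2.1) (hm s)⟩
  have hg : Continuous g :=
    ((continuous_inject false).comp Complex.continuous_ofReal).subtype_mk _
  have hg0 : g 0 = e'.homeo x := by
    apply Subtype.ext
    change inject false ((0 : ℝ) : ℂ) = e'.val x
    rw [hc'.2.2]
    simp [inject]
  have h1 : ∀ᶠ q in 𝓝 (e'.homeo x), q ∈ e'.homeo.target ∧ e'.homeo.symm q ∈ U ∩ e.source := by
    refine (e'.homeo.open_target.eventually_mem (e'.homeo.map_source hc'.1)).and ?_
    have h2 := e'.homeo.continuousAt_symm (e'.homeo.map_source hc'.1)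
    refine h2.eventually_mem ?_
    rw [e'.homeo.left_inv hc'.1]
    exact inter_mem hU (e.isOpen_source.mem_nhds hc.1)
  have h3 : ∀ᶠ s in 𝓝[≠] (0 : ℝ), g s ∈ e'.homeo.target ∧ e'.homeo.symm (g s) ∈ U ∩ e.source :=
    (hg.continuousAt.eventually (by rwa [hg0])).filter_mono nhdsWithin_le_nhds
  obtain ⟨s, ⟨hs1, hs2, hs3⟩, hs0⟩ := (h3.and self_mem_nhdsWithin).exists
  have hv : e'.val (e'.homeo.symm (g s)) = inject false s := by
    rw [NodalChart.val, e'.homeo.right_inv hs1]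
  refine hS.not_boundary he he' (x := e'.homeo.symm (g s)) hs3 (e'.homeo.map_target hs1) ?_ hh hh' ?_
  · intro hn
    have h4 : e'.homeo.symm (g s) = x := hUn ⟨hs2, hn⟩
    rw [h4, hc'.2.2, eq_comm, inject_eq_zero_iff] at hv
    exact hs0 (by exact_mod_cast hv)
  · rw [NodalChart.coord, hv, coord_inject, Complex.ofReal_im]

end NodalSurface

end Nodal

namespace Nodal

/-! ### The atlas of the normalization -/

lemma ModelKind.not_isNodal_flat (κ : ModelKind) : ¬ κ.flat.IsNodal := by
  cases κ <;> simp [flat, IsNodal]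

lemma ModelKind.isHalf_flat (κ : ModelKind) : κ.flat.IsHalf ↔ κ.IsHalf := by
  cases κ <;> simp [flat, IsHalf]

namespace NodalSurface

variable {X : Type u} [TopologicalSpace X] {S : NodalSurface X}

lemma branchChart_coord {x : X} {k : Bool} (hk : (S.chartAt x).kind.IsNodal ∨ k = false)
    (q : S.Normalization) :
    (S.branchChart x k hk).coord q = axis k ((S.chartAt x).val (S.proj q)) :=
  add_zero _

lemma branchChart_coord_of_mem {x : X} {k : Bool} (hk : (S.chartAt x).kind.IsNodal ∨ k = false)
    {q : S.Normalization} (hq : q ∈ S.branchSource x k) :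
    (S.branchChart x k hk).coord q = (S.chartAt x).coord (S.proj q) := by
  rw [branchChart_coord, (S.chartAt x).coord_eq_axis hq.2.2.1]

lemma eventually_branchChart_coord {x : X} {k : Bool}
    (hk : (S.chartAt x).kind.IsNodal ∨ k = false) {q : S.Normalization}
    (hq : q ∈ S.branchSource x k) :
    ∀ᶠ q' in 𝓝 q, (S.branchChart x k hk).coord q' = (S.chartAt x).coord (S.proj q') := by
  filter_upwards [(S.isOpen_branchSource x hk).mem_nhds hq] with q' hq'
  exact branchChart_coord_of_mem hk hq'

lemma normalization_not_crossing {c : NodalChart S.Normalization} (hc : c ∈ S.normalization.atlas)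
    (q : S.Normalization) : ¬ c.Crossing q := by
  obtain ⟨x, k, hk, rfl⟩ := hc
  exact fun h => ModelKind.not_isNodal_flat _ h.2.1

lemma normalization_crossing : S.normalization.crossing = ∅ := by
  rw [eq_empty_iff_forall_notMem]
  rintro q ⟨c, hc, h⟩
  exact normalization_not_crossing hc q h

lemma normalization_nodes : S.normalization.nodes = ∅ := by
  rw [nodes_eq, normalization_crossing, empty_union]
  rfl

lemma mem_crossing_or_inessential {x : X} : x ∈ S.nodes ↔ x ∈ S.crossing ∨ x ∈ S.inessential := by
  rw [nodes_eq, mem_union]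

/-- The only chart of the normalization around a point over a node. -/
lemma branch_unique {x x' : X} {k k' : Bool} (hk : (S.chartAt x).kind.IsNodal ∨ k = false)
    (hk' : (S.chartAt x').kind.IsNodal ∨ k' = false) {q : S.Normalization}
    (hq : q ∈ S.branchSource x k) (hq' : q ∈ S.branchSource x' k') (hn : S.proj q ∈ S.nodes) :
    S.branchChart x k hk = S.branchChart x' k' hk' := by
  obtain rfl : S.proj q = x := hq.1 hn
  obtain rfl : S.proj q = x' := hq'.1 hn
  suffices k = k' by subst this; rfl
  by_cases hc : S.proj q ∈ S.crossing
  · rw [← hq.2.2.2 hc, ← hq'.2.2.2 hc]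
  -- Two different branches through `q` would put its value on both axes, hence at the origin; one
  -- of the two branches is `true`, so the model is nodal and the point is a crossing after all.
  · by_contra hkk
    have h0 : (S.chartAt (S.proj q)).val (S.proj q) = 0 := by
      have h1 := hq.2.2.1
      have h2 := hq'.2.2.1
      cases k <;> cases k' <;> simp_all [axis, Prod.ext_iff]
    refine hc ((S.crossing_iff (S.chartAt_mem _) hq.2.1).2 ⟨hq.2.1, ?_, h0⟩)
    rcases hk with h | h
    · exact h
    · rcases hk' with h' | h'
      · exact h'
      · exact absurd (h.trans h'.symm) hkk

/-- Off the nodes the transition maps are those of `S`. Over a node there is only one chart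
(`branch_unique`), so no condition arises there, although `S` imposes no compatibility at its nodes.
-/
lemma IsKlein.normalization (hS : S.IsKlein) : S.normalization.IsKlein := by
  rintro _ ⟨x, k, hk, rfl⟩ _ ⟨x', k', hk', rfl⟩ q ⟨hq, hq'⟩ -
  have hq : q ∈ S.branchSource x k := hq
  have hq' : q ∈ S.branchSource x' k' := hq'
  by_cases hn : S.proj q ∈ S.nodes
  · rw [branch_unique hk hk' hq hq' hn]
    exact Or.inl (AnalyticRel.of_eventuallyEq EventuallyEq.rfl)
  · have he := eventually_branchChart_coord hk hq
    have he' := eventually_branchChart_coord hk' hq'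
    have e1 : AnalyticRel (S.branchChart x k hk).coord (fun q => (S.chartAt x).coord (S.proj q)) q :=
      AnalyticRel.of_eventuallyEq (EventuallyEq.symm he)
    have e2 : AnalyticRel (fun q => (S.chartAt x').coord (S.proj q)) (S.branchChart x' k' hk').coord
      q := AnalyticRel.of_eventuallyEq he'
    rcases hS _ (S.chartAt_mem x) _ (S.chartAt_mem x') (S.proj q) ⟨hq.2.1, hq'.2.1⟩ hn with h | h
    · exact Or.inl (e1.trans ((h.comp S.continuous_proj.continuousAt).trans e2))
    · exact Or.inr (e1.trans_anti ((h.comp S.continuous_proj.continuousAt).trans_analytic e2))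

/-- The branch charts centred elsewhere omit the node, so the chart chosen at the node alone
decides. -/
lemma mem_normalization_boundary {q : S.Normalization} (hn : S.proj q ∈ S.nodes) :
    q ∈ S.normalization.boundary ↔ (S.chartAt (S.proj q)).kind.IsHalf ∧
      ((S.chartAt (S.proj q)).coord (S.proj q)).im = 0 := by
  constructor
  · rintro ⟨_, ⟨x, k, hk, rfl⟩, hq, hh, h0⟩
    have hq : q ∈ S.branchSource x k := hq
    obtain rfl : S.proj q = x := hq.1 hn
    rw [branchChart_coord_of_mem hk hq] at h0
    exact ⟨(ModelKind.isHalf_flat _).1 hh, h0⟩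
  · rintro ⟨hh, h0⟩
    obtain ⟨_, ⟨x, k, hk, rfl⟩, hq⟩ := S.normalization.cover q
    have hq : q ∈ S.branchSource x k := hq
    obtain rfl : S.proj q = x := hq.1 hn
    refine ⟨_, ⟨_, k, hk, rfl⟩, hq, (ModelKind.isHalf_flat _).2 hh, ?_⟩
    rwa [branchChart_coord_of_mem hk hq]

/-- The chosen chart crosses at the node, and it must be a half model since otherwise the node would
also be conic. -/
lemma IsKlein.mem_normalization_boundary (hS : S.IsKlein) {q : S.Normalization}
    (h : S.proj q ∈ S.boundaryNodes) : q ∈ S.normalization.boundary := by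
  have hc : S.proj q ∈ S.crossing := by
    rw [crossing_eq]
    exact Or.inr h
  have hc' := (S.crossing_iff (S.chartAt_mem _) (S.mem_chartAt _)).1 hc
  refine (NodalSurface.mem_normalization_boundary (mem_crossing_or_inessential.2 (Or.inl hc))).2
    ⟨?_, ?_⟩
  · by_contra hh
    exact Set.disjoint_left.1 hS.disjoint_conic ⟨_, S.chartAt_mem _, hc', hh⟩ h
  · simp [NodalChart.coord, hc'.2.2]

lemma IsKlein.notMem_normalization_boundary (hS : S.IsKlein) {q : S.Normalization}
    (h : S.proj q ∈ S.conic ∪ S.inessential) : q ∉ S.normalization.boundary := by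
  intro hb
  rcases h with h | h
  · have hc : S.proj q ∈ S.crossing := by
      rw [crossing_eq]
      exact Or.inl h
    have hb' := (NodalSurface.mem_normalization_boundary
      (mem_crossing_or_inessential.2 (Or.inl hc))).1 hb
    have hc' := (S.crossing_iff (S.chartAt_mem _) (S.mem_chartAt _)).1 hc
    exact Set.disjoint_left.1 hS.disjoint_conic h ⟨_, S.chartAt_mem _, hc', hb'.1⟩
  · exact (S.planar _ h _ (S.chartAt_mem _) (S.mem_chartAt _)).2
      ((NodalSurface.mem_normalization_boundary (mem_crossing_or_inessential.2 (Or.inr h))).1 hb)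

/-! ### Fibres of the normalization -/

lemma notMem_crossing_of_inessential {z : X} (h : z ∈ S.inessential) : z ∉ S.crossing := by
  rintro ⟨e, he, hc⟩
  exact (S.planar z h e he hc.1).1 hc

lemma proj_fibre_of_notMem {z : X} (h : z ∉ S.crossing) : ∃ z₁, S.proj ⁻¹' {z} = {z₁} := by
  refine ⟨S.liftPoint false z, ?_⟩
  ext q
  constructor
  · rintro rfl
    exact (S.lift_proj fun hc => absurd hc h).symm
  · rintro rfl
    rfl

lemma proj_fibre_of_mem {z : X} (h : z ∈ S.crossing) :
    ∃ z₁ z₂, z₁ ≠ z₂ ∧ S.proj ⁻¹' {z} = {z₁, z₂} := by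
  refine ⟨⟨(z, false), by simp⟩, ⟨(z, true), fun _ => h⟩, ?_, ?_⟩
  · intro h
    have := congrArg (fun q : S.Normalization => q.1.2) h
    simp at this
  · ext ⟨⟨y, b⟩, hb⟩
    constructor
    · intro hy
      obtain rfl : y = z := hy
      cases b
      · exact Or.inl rfl
      · exact Or.inr rfl
    · rintro (h | h)
      · exact congrArg S.proj h
      · exact congrArg S.proj h

lemma IsRiemann.boundary_eq (hS : S.IsRiemann) : S.boundary = ∅ := by
  rw [eq_empty_iff_forall_notMem]
  rintro x ⟨e, he, -, hh, -⟩
  exact hS.2.1 e he hh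

end NodalSurface

/-! ### Ramification -/

section Ramification

open Asymptotics

lemma fold_eq_self {w : ℂ} (h : 0 ≤ w.im) : fold w = w :=
  Complex.ext rfl (abs_of_nonneg h)

lemma fold_eq_conj {w : ℂ} (h : w.im ≤ 0) : fold w = conj w :=
  Complex.ext rfl (abs_of_nonpos h)

/-- Away from the real axis, the folding map is locally the identity or the conjugation. -/
lemma eventually_fold {w : ℂ} (h : w.im ≠ 0) :
    (∀ᶠ v in 𝓝 w, fold v = v) ∨ ∀ᶠ v in 𝓝 w, fold v = conj v := by
  rcases h.lt_or_gt with h | h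
  · right
    filter_upwards [Complex.continuous_im.continuousAt.eventually (gt_mem_nhds h)] with v hv
    exact fold_eq_conj (le_of_lt hv)
  · left
    filter_upwards [Complex.continuous_im.continuousAt.eventually (lt_mem_nhds h)] with v hv
    exact fold_eq_self (le_of_lt hv)

/-- Folding preserves distances to a real point, and off the real axis it is locally the identity or
conjugation. Hence it does not affect the rate at which a map approaches its value. -/
lemma eventually_norm_fold_sub (w : ℂ) : ∀ᶠ v in 𝓝 w, ‖fold v - fold w‖ = ‖v - w‖ := by
  by_cases h : w.im = 0
  · refine Eventually.of_forall fun v => ?_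
    rw [Complex.norm_eq_sqrt_sq_add_sq, Complex.norm_eq_sqrt_sq_add_sq]
    simp [fold, h]
  · rcases eventually_fold h with h | h
    · filter_upwards [h] with v hv
      rw [hv, h.self_of_nhds]
    · filter_upwards [h] with v hv
      rw [hv, h.self_of_nhds, ← map_sub, Complex.norm_conj]

variable {X Y : Type u} [TopologicalSpace X] [TopologicalSpace Y]

lemma LocalRep.eventually_norm {e : NodalChart X} {e' : NodalChart Y} {f : X → Y} {x : X}
    {F : ℂ → ℂ} (h : LocalRep e e' f x F) :
    ∀ᶠ y in 𝓝 x, ‖e'.coord (f y) - e'.coord (f x)‖ = ‖F (e.coord y) - F (e.coord x)‖ := by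
  obtain ⟨h1, h2, h3, h4⟩ := h
  rcases h4 with ⟨-, h⟩ | ⟨-, h⟩ | ⟨-, h⟩
  · have h5 : ContinuousAt (fun y => F (e.coord y)) x :=
      h3.continuousAt.comp (e.continuousAt_coord h1)
    filter_upwards [h, h5.eventually (eventually_norm_fold_sub (F (e.coord x)))] with y hy hy'
    rw [hy, h.self_of_nhds, hy']
  · filter_upwards [h] with y hy
    rw [hy, h.self_of_nhds]
  · filter_upwards [h] with y hy
    rw [hy, h.self_of_nhds, ← map_sub, Complex.norm_conj]

/-- Expresses the order of vanishing as a growth rate of the map itself, which survives folding,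
conjugation and changes of coordinates. -/
lemma LocalRep.isTheta {e : NodalChart X} {e' : NodalChart Y} {f : X → Y} {x : X}
    {F : ℂ → ℂ} (h : LocalRep e e' f x F) {n : ℕ}
    (hn : analyticOrderAt (fun u => F u - F (e.coord x)) (e.coord x) = n) :
    (fun y => e'.coord (f y) - e'.coord (f x)) =Θ[𝓝 x] (fun y => (e.coord y - e.coord x) ^ n) := by
  have hF : AnalyticAt ℂ (fun u => F u - F (e.coord x)) (e.coord x) :=
    h.2.2.1.sub analyticAt_const
  obtain ⟨g, hg, hg0, hge⟩ := hF.analyticOrderAt_eq_natCast.1 hn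
  have h1 : (fun u => F u - F (e.coord x)) =Θ[𝓝 (e.coord x)] (fun u => (u - e.coord x) ^ n) := by
    -- The cofactor left after dividing by the `n`-th power does not vanish, so near the centre it
    -- is bounded and stays above half its norm there.
    have h2 : g =Θ[𝓝 (e.coord x)] (fun _ => (1 : ℂ)) := by
      refine ⟨hg.continuousAt.tendsto.isBigO_one ℂ, ?_⟩
      exact (isBigO_const_left_iff_pos_le_norm one_ne_zero).2
        ⟨‖g (e.coord x)‖ / 2, by positivity, by
          filter_upwards [hg.continuousAt.norm.eventually (lt_mem_nhds
            (half_lt_self (norm_pos_iff.2 hg0)))] with u hu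
          exact le_of_lt hu⟩
    have h3 := (isTheta_refl (fun u => (u - e.coord x) ^ n) (𝓝 (e.coord x))).mul h2
    simp only [mul_one] at h3
    refine EventuallyEq.trans_isTheta ?_ h3
    filter_upwards [hge] with u hu
    rw [hu, smul_eq_mul]
  have h4 : (fun y => F (e.coord y) - F (e.coord x)) =Θ[𝓝 x]
      (fun y => (e.coord y - e.coord x) ^ n) :=
    ⟨h1.1.comp_tendsto (e.continuousAt_coord h.1), h1.2.comp_tendsto (e.continuousAt_coord h.1)⟩
  refine IsTheta.trans (IsTheta.of_norm_eventuallyEq_norm ?_) h4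
  exact h.eventually_norm

lemma le_of_pow_isBigO {a : ℂ} {n m : ℕ}
    (h : (fun u => (u - a) ^ n) =O[𝓝 a] (fun u => (u - a) ^ m)) : m ≤ n := by
  by_contra! hlt
  have h1 : (fun u : ℂ => (u - a) ^ m) =o[𝓝 a] (fun u => (u - a) ^ n) := by
    have := isLittleO_pow_sub_pow_sub a hlt
    simp only [← norm_pow] at this
    exact this.of_norm_norm
  -- The centre is removed so that the power is nonzero and cannot be negligible against itself.
  have h2 := (h.trans_isLittleO h1).mono (nhdsWithin_le_nhds (s := {a}ᶜ))
  refine isLittleO_irrefl (Eventually.frequently ?_) h2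
  filter_upwards [self_mem_nhdsWithin] with u hu
  exact pow_ne_zero _ (sub_ne_zero.2 hu)

lemma NodalSurface.IsKlein.isBigO {T : NodalSurface Y} (hT : T.IsKlein) {e e' : NodalChart Y}
    (he : e ∈ T.atlas) (he' : e' ∈ T.atlas) {y : Y} (hy : y ∈ e.source) (hy' : y ∈ e'.source)
    (hn : y ∉ T.nodes) :
    (fun t => e'.coord t - e'.coord y) =O[𝓝 y] (fun t => e.coord t - e.coord y) := by
  rcases hT e he e' he' y ⟨hy, hy'⟩ hn with h | h
  · exact h.isBigO (e.continuousAt_coord hy)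
  · exact h.isBigO (e.continuousAt_coord hy)

lemma NodalSurface.IsRiemann.isKlein {S : NodalSurface X} (hS : S.IsRiemann) : S.IsKlein :=
  fun e he e' he' x hx hn => Or.inl (hS.2.2 e he e' he' x hx hn)

/-- Passing between the two pairs of charts costs only bounded factors, so the two growth exponents
can be compared; both inequalities together give uniqueness. The source being Riemann makes its
coordinate cover a full neighbourhood in `ℂ`. -/
lemma HasRamificationIndex.le {S : NodalSurface X} {T : NodalSurface Y} {f : X → Y} {x : X}
    {n m : ℕ} (hn : HasRamificationIndex S T f x n) (hm : HasRamificationIndex S T f x m)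
    (hS : S.IsRiemann) (hT : T.IsKlein) (hx : x ∉ S.nodes) (hfx : f x ∉ T.nodes)
    (hf : ContinuousAt f x) : m ≤ n := by
  obtain ⟨e, he, e', he', F, hF, hFn⟩ := hn
  obtain ⟨d, hd, d', hd', G, hG, hGm⟩ := hm
  have h1 := (hF.isTheta hFn).2
  have h2 := (hT.isBigO hd' he' hG.2.1 hF.2.1 hfx).comp_tendsto hf
  have h3 := (hG.isTheta hGm).1
  have h4 := (hS.isKlein.isBigO he hd hF.1 hG.1 hx).pow m
  have h5 := h1.trans (h2.trans (h3.trans h4))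
  rw [show (fun y => (e.coord y - e.coord x) ^ n) = (fun u => (u - e.coord x) ^ n) ∘ e.coord from rfl,
    show (fun y => (e.coord y - e.coord x) ^ m) = (fun u => (u - e.coord x) ^ m) ∘ e.coord from rfl,
    ← isBigO_map, e.map_coord_nhds hF.1 (NodalSurface.not_crossing_of_notMem_nodes he hx)
      (hS.2.1 e he)] at h5
  exact le_of_pow_isBigO h5

lemma deriv_ne_zero_of_order_eq_one {F : ℂ → ℂ} {a : ℂ} (hF : AnalyticAt ℂ F a)
    (h : analyticOrderAt (fun u => F u - F a) a = 1) : deriv F a ≠ 0 := by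
  rw [← hF.analyticOrderAt_deriv_add_one] at h
  have h1 : analyticOrderAt (deriv F) a = 0 := by
    generalize analyticOrderAt (deriv F) a = t at h
    enat_to_nat
    simpa using h
  exact hF.deriv.analyticOrderAt_eq_zero.1 h1

end Ramification

/-! ### Fibres of the complex double -/

section ComplexDouble

variable {X W : Type u} [TopologicalSpace X] [TopologicalSpace W]
  {T : NodalSurface W} {S : NodalSurface X} {π : W → X} {σ : W → W}

lemma relativeDegree_of_boundary_eq (hT : T.boundary = ∅) {w : W} (h : π w ∈ S.boundary) :
    relativeDegree T S π w = 2 := by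
  simp [relativeDegree, hT, h]

lemma relativeDegree_of_notMem {w : W} (h : π w ∉ S.boundary) :
    relativeDegree T S π w = 1 := by
  simp [relativeDegree, h]

/-- The weights `ι` in a double cover are just some ramification indices, and being unbranched just
provides the index 1; uniqueness of the index identifies the two. -/
lemma IsKleinComplexDouble.finsum_eq (hT : IsKleinComplexDouble T S π σ) (hS : S.IsKlein)
    (hSn : S.nodes = ∅) (y : X) :
    (π ⁻¹' {y}).Finite ∧ ∑ᶠ x ∈ π ⁻¹' {y}, relativeDegree T S π x = 2 := by
  obtain ⟨hR, hn, -, -, ⟨⟨hm, ι, hι, hsum⟩, h1⟩, -⟩ := hT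
  refine ⟨(hsum y).1, ?_⟩
  rw [← (hsum y).2]
  have h2 : ∀ x, ι x = 1 := fun x =>
    le_antisymm ((h1 x).le (hι x) hR hS (by simp [hn]) (by simp [hSn]) hm.1.continuousAt)
      ((hι x).le (h1 x) hR hS (by simp [hn]) (by simp [hSn]) hm.1.continuousAt)
  simp [h2]

/-- The double has no boundary, so each point over the boundary has relative degree 2 and exhausts
the count alone. -/
lemma IsKleinComplexDouble.fibre_of_mem (hT : IsKleinComplexDouble T S π σ) (hS : S.IsKlein)
    (hSn : S.nodes = ∅) {y : X} (hy : y ∈ S.boundary) : ∃ w, π ⁻¹' {y} = {w} := by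
  obtain ⟨hf, hs⟩ := hT.finsum_eq hS hSn y
  rw [finsum_mem_eq_finite_toFinset_sum _ hf, Finset.sum_congr rfl (g := fun _ => 2)] at hs
  · rw [Finset.sum_const, smul_eq_mul] at hs
    obtain ⟨w, hw⟩ := Finset.card_eq_one.1 (show hf.toFinset.card = 1 by omega)
    refine ⟨w, ?_⟩
    rw [← hf.coe_toFinset, hw, Finset.coe_singleton]
  · intro x hx
    rw [Finite.mem_toFinset] at hx
    have hx : π x = y := hx
    exact relativeDegree_of_boundary_eq hT.1.boundary_eq (hx ▸ hy)

lemma IsKleinComplexDouble.fibre_of_notMem (hT : IsKleinComplexDouble T S π σ) (hS : S.IsKlein)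
    (hSn : S.nodes = ∅) {y : X} (hy : y ∉ S.boundary) :
    ∃ w₁ w₂, w₁ ≠ w₂ ∧ π ⁻¹' {y} = {w₁, w₂} := by
  classical
  obtain ⟨hf, hs⟩ := hT.finsum_eq hS hSn y
  rw [finsum_mem_eq_finite_toFinset_sum _ hf, Finset.sum_congr rfl (g := fun _ => 1)] at hs
  · rw [Finset.sum_const, smul_eq_mul, mul_one] at hs
    obtain ⟨w₁, w₂, hne, hw⟩ := Finset.card_eq_two.1 hs
    refine ⟨w₁, w₂, hne, ?_⟩
    rw [← hf.coe_toFinset, hw, Finset.coe_insert, Finset.coe_singleton]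
  · intro x hx
    rw [Finite.mem_toFinset] at hx
    have hx : π x = y := hx
    exact relativeDegree_of_notMem (hx ▸ hy)

/-- Over an interior point, `π` is locally an analytic function up to conjugation. -/
lemma LocalRep.exists_injective {e : NodalChart W} {e' : NodalChart X} {w : W} {F : ℂ → ℂ}
    (h : LocalRep e e' π w F) (hb : ¬ (e'.kind.IsHalf ∧ (e'.coord (π w)).im = 0)) :
    ∃ L : ℂ → ℂ, Function.Injective L ∧ ∀ᶠ y in 𝓝 w, e'.coord (π y) = L (F (e.coord y)) := by
  obtain ⟨h1, h2, h3, h4⟩ := h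
  have hconj : Function.Injective (fun z : ℂ => conj z) := (starRingEnd ℂ).injective
  rcases h4 with ⟨hh, h⟩ | ⟨-, h⟩ | ⟨-, h⟩
  · have h5 : ContinuousAt (fun y => F (e.coord y)) w :=
      h3.continuousAt.comp (e.continuousAt_coord h1)
    have h6 : (F (e.coord w)).im ≠ 0 := by
      intro h0
      apply hb
      refine ⟨hh, ?_⟩
      rw [h.self_of_nhds, fold, h0, abs_zero]
    rcases eventually_fold h6 with h7 | h7
    · refine ⟨id, Function.injective_id, ?_⟩
      filter_upwards [h, h5.eventually h7] with y hy hy'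
      rw [hy, hy', id]
    · refine ⟨_, hconj, ?_⟩
      filter_upwards [h, h5.eventually h7] with y hy hy'
      rw [hy, hy']
  · exact ⟨id, Function.injective_id, h⟩
  · exact ⟨_, hconj, h⟩

/-- An antianalytic germ cannot be a deck transformation of a local analytic isomorphism. -/
lemma not_eventually_comp_conj {F H : ℂ → ℂ} {a : ℂ} (hF : AnalyticAt ℂ F a)
    (hF' : deriv F a ≠ 0) (hH : AnalyticAt ℂ H a) (ha : conj (H a) = a) :
    ¬ ∀ᶠ u in 𝓝 a, F (conj (H u)) = F u := by
  intro h
  have hd : HasFDerivAt F (ContinuousLinearMap.toSpanSingleton ℂ (deriv F a)) a :=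
    hF.differentiableAt.hasDerivAt.hasFDerivAt
  have hd1 := hd.restrictScalars ℝ
  have hd2 : HasFDerivAt H _ a := hH.differentiableAt.hasDerivAt.hasFDerivAt.restrictScalars ℝ
  have hd3 : HasFDerivAt (fun u => conj (H u)) _ a :=
    (Complex.conjCLE.toContinuousLinearMap.hasFDerivAt (x := H a)).comp a hd2
  rw [← ha] at hd1
  have hd4 := hd1.comp a hd3
  rw [ha] at hd4 hd1
  have hd5 := (hd1.congr_of_eventuallyEq h).unique hd4
  -- The real derivative on one side is complex linear, on the other antilinear. Evaluating at `1`
  -- and at `I` gives `I * deriv F a = -(I * deriv F a)`.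
  have e1 := DFunLike.congr_fun hd5 1
  have e2 := DFunLike.congr_fun hd5 Complex.I
  simp at e1 e2
  rw [mul_assoc, ← e1, self_eq_neg, mul_eq_zero] at e2
  exact e2.elim Complex.I_ne_zero hF'

/-- Near a fixed point over the interior, `π ∘ σ = π` would make `σ` an antianalytic deck
transformation of a local analytic isomorphism. Consequently `σ` exchanges the two points of such a
fibre. -/
lemma IsKleinComplexDouble.sigma_ne (hT : IsKleinComplexDouble T S π σ) {w : W}
    (hw : π w ∉ S.boundary) : σ w ≠ w := by
  intro hfix
  obtain ⟨hR, hn, ⟨⟨hσc, -⟩, hσ⟩, -, ⟨⟨hm, -⟩, h1⟩, hπσ⟩ := hT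
  have hwn : w ∉ T.nodes := by simp [hn]
  obtain ⟨e, he, e', he', F, hF, hFo⟩ := h1 w
  obtain ⟨e₁, he₁, e₂, he₂, hw₁, hw₂, hrel⟩ := hσ w hwn
  have hrel' : AntianalyticRel e.coord (fun y => e.coord (σ y)) w := by
    refine (hR.2.2 e he e₁ he₁ w ⟨hF.1, hw₁⟩ hwn).trans_anti (hrel.trans_analytic ?_)
    refine AnalyticRel.comp (a := e₂.coord) (b := e.coord) ?_ hσc.continuousAt
    refine hR.2.2 e₂ he₂ e he (σ w) ⟨hw₂, ?_⟩ ?_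
    · rw [hfix]
      exact hF.1
    · rwa [hfix]
  obtain ⟨H, hH, hHe⟩ := hrel'
  obtain ⟨L, hL, hLe⟩ := hF.exists_injective
    (fun h => hw ⟨e', he', hF.2.1, h.1, h.2⟩)
  refine not_eventually_comp_conj hF.2.2.1
    (deriv_ne_zero_of_order_eq_one hF.2.2.1 hFo) hH ?_ ?_
  · rw [← hHe.self_of_nhds]
    exact congrArg e.coord hfix
  · rw [← e.map_coord_nhds hF.1 (NodalSurface.not_crossing_of_notMem_nodes he hwn) (hR.2.1 e he),
      eventually_map]
    have hLe' : ∀ᶠ y in 𝓝 w, e'.coord (π (σ y)) = L (F (e.coord (σ y))) :=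
      hσc.continuousAt.eventually (by rwa [hfix])
    filter_upwards [hLe, hLe', hHe] with y h2 h3 h4
    rw [← h4]
    apply hL
    rw [← h3, ← h2, hπσ]

end ComplexDouble

end Nodal

namespace Nodal

/-! ### Equivalence relations given by involutions -/

section Involution

variable {W : Type u}

/-- The orbit relation of an involution. -/
def involutionSetoid (τ : W → W) (h : Function.Involutive τ) : Setoid W where
  r a b := a = b ∨ b = τ a
  iseqv :=
    { refl := fun _ => Or.inl rfl
      symm := by
        rintro a b (rfl | rfl)
        · exact Or.inl rfl
        · exact Or.inr (h a).symm
      trans := by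
        rintro a b c (rfl | rfl) (rfl | rfl)
        · exact Or.inl rfl
        · exact Or.inr rfl
        · exact Or.inr rfl
        · exact Or.inl (h a).symm }

lemma involutionSetoid_apply {τ : W → W} {h : Function.Involutive τ} {a b : W} :
    involutionSetoid τ h a b ↔ a = b ∨ b = τ a := Iff.rfl

lemma identify_apply (a b : W) : identify a b a b :=
  fun _ h => h

lemma identify_le {a b : W} {s : Setoid W} (h : s a b) : identify a b ≤ s := sInf_le h

lemma identify_comm (a b : W) : identify a b = identify b a :=
  le_antisymm (identify_le (Setoid.symm' _ (identify_apply b a)))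
    (identify_le (Setoid.symm' _ (identify_apply a b)))

lemma swap_involutive [DecidableEq W] (a b : W) : Function.Involutive (Equiv.swap a b) :=
  fun x => by simp

lemma identify_eq_involutionSetoid [DecidableEq W] (a b : W) :
    identify a b = involutionSetoid (Equiv.swap a b) (swap_involutive a b) := by
  apply le_antisymm
  · exact identify_le (Or.inr (Equiv.swap_apply_left a b).symm)
  · rintro x y (rfl | rfl)
    · exact Setoid.refl' _ x
    · rcases eq_or_ne x a with rfl | ha
      · rw [Equiv.swap_apply_left]
        exact identify_apply _ _
      · rcases eq_or_ne x b with rfl | hb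
        · rw [Equiv.swap_apply_right]
          exact Setoid.symm' _ (identify_apply _ _)
        · rw [Equiv.swap_apply_of_ne_of_ne ha hb]

lemma swap_mul_swap_involutive [DecidableEq W] {a b c d : W} (hac : a ≠ c) (had : a ≠ d)
    (hbc : b ≠ c) (hbd : b ≠ d) :
    Function.Involutive (fun x => Equiv.swap a b (Equiv.swap c d x)) := by
  intro x
  simp only [Equiv.swap_apply_def]
  grind

/-- The pairs are disjoint, so their transpositions commute and the product is an involution; the
generated relation thereby gets an explicit description. -/
lemma identify_sup_eq_involutionSetoid [DecidableEq W] {a b c d : W} (hac : a ≠ c) (had : a ≠ d)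
    (hbc : b ≠ c) (hbd : b ≠ d) :
    identify a b ⊔ identify c d = involutionSetoid
      (fun x => Equiv.swap a b (Equiv.swap c d x)) (swap_mul_swap_involutive hac had hbc hbd) := by
  apply le_antisymm
  · refine sup_le (identify_le (Or.inr ?_)) (identify_le (Or.inr ?_))
    · beta_reduce
      rw [Equiv.swap_apply_of_ne_of_ne hac had, Equiv.swap_apply_left]
    · beta_reduce
      rw [Equiv.swap_apply_left, Equiv.swap_apply_of_ne_of_ne had.symm hbd.symm]
  · rintro x y (rfl | rfl)
    · exact Setoid.refl' _ x
    · refine Setoid.trans' _ (y := Equiv.swap c d x) ?_ ?_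
      · refine (le_sup_right : _ ≤ identify a b ⊔ identify c d) ?_
        rw [identify_eq_involutionSetoid]
        exact Or.inr rfl
      · refine (le_sup_left : _ ≤ identify a b ⊔ identify c d) ?_
        rw [identify_eq_involutionSetoid]
        exact Or.inr rfl

end Involution

/-! ### The identifications over a node -/

section Identifications

variable {X W : Type u} [TopologicalSpace X] {S : NodalSurface X} {π : W → S.Normalization}

/-- Commutation with `σ` comes for free: over a boundary node `σ` fixes both points, over an
inessential node it is the same exchange as `t`, and over a conic node it exchanges the points in
each of the two fibres, which either pairing respects. -/
lemma IsIdentificationAt.exists_involution {z : X} {s : Setoid W} (h : IsIdentificationAt S π z s)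
    {σ : W → W} (hσ : ∀ w, π (σ w) = π w)
    (hσ' : ∀ w, S.proj (π w) ∈ S.conic ∪ S.inessential → σ w ≠ w) :
    ∃ (t : W → W) (ht : Function.Involutive t),
      (∀ w, S.proj (π w) ≠ z → t w = w) ∧
      (∀ w, S.proj (π w) = z → t w ≠ w ∧ S.proj (π (t w)) = z ∧
        S.proj ⁻¹' {z} = {π w, π (t w)} ∧ t (σ w) = σ (t w)) ∧
      s = involutionSetoid t ht := by
  classical
  cases h with
  | boundary z₁ z₂ w₁ w₂ hz hne hp h₁ h₂ =>
    refine ⟨_, _, ?_, ?_, identify_eq_involutionSetoid w₁ w₂⟩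
    all_goals
      simp only [Set.ext_iff, mem_preimage, mem_singleton_iff, mem_insert_iff] at hp h₁ h₂
      have hw₁ := (h₁ w₁).2 rfl
      have hw₂ := (h₂ w₂).2 rfl
      have hww : w₁ ≠ w₂ := fun h => hne (by rw [← hw₁, ← hw₂, h])
      intro w hw
    · refine Equiv.swap_apply_of_ne_of_ne ?_ ?_
      · rintro rfl
        exact hw ((hp _).2 (Or.inl hw₁))
      · rintro rfl
        exact hw ((hp _).2 (Or.inr hw₂))
    · have hσ₁ : σ w₁ = w₁ := (h₁ _).1 ((hσ _).trans hw₁)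
      have hσ₂ : σ w₂ = w₂ := (h₂ _).1 ((hσ _).trans hw₂)
      rcases (hp _).1 hw with h | h
      · obtain rfl := (h₁ _).1 h
        rw [hσ₁, Equiv.swap_apply_left, hσ₂]
        refine ⟨hww.symm, (hp _).2 (Or.inr hw₂), ?_, rfl⟩
        ext q
        simp [hp, hw₁, hw₂]
      · obtain rfl := (h₂ _).1 h
        rw [hσ₂, Equiv.swap_apply_right, hσ₁]
        refine ⟨hww, (hp _).2 (Or.inl hw₁), ?_, rfl⟩
        ext q
        simp [hp, hw₁, hw₂, or_comm]
  | inessential z₁ w₁ w₂ hz hp hww h₁ =>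
    refine ⟨_, _, ?_, ?_, identify_eq_involutionSetoid w₁ w₂⟩
    all_goals
      simp only [Set.ext_iff, mem_preimage, mem_singleton_iff, mem_insert_iff] at hp h₁
      have hw₁ := (h₁ w₁).2 (Or.inl rfl)
      have hw₂ := (h₁ w₂).2 (Or.inr rfl)
      intro w hw
    · refine Equiv.swap_apply_of_ne_of_ne ?_ ?_
      · rintro rfl
        exact hw ((hp _).2 hw₁)
      · rintro rfl
        exact hw ((hp _).2 hw₂)
    · have hσ₁ : σ w₁ = w₂ := ((h₁ _).1 ((hσ _).trans hw₁)).resolve_left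
        (hσ' _ (Or.inr (by rw [(hp _).2 hw₁]; exact hz)))
      have hσ₂ : σ w₂ = w₁ := ((h₁ _).1 ((hσ _).trans hw₂)).resolve_right
        (hσ' _ (Or.inr (by rw [(hp _).2 hw₂]; exact hz)))
      rcases (h₁ _).1 ((hp _).1 hw) with rfl | rfl
      · rw [hσ₁, Equiv.swap_apply_left, Equiv.swap_apply_right, hσ₂]
        refine ⟨hww.symm, (hp _).2 hw₂, ?_, rfl⟩
        ext q
        simp [hp, hw₁, hw₂]
      · rw [hσ₂, Equiv.swap_apply_left, Equiv.swap_apply_right, hσ₁]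
        refine ⟨hww, (hp _).2 hw₁, ?_, rfl⟩
        ext q
        simp [hp, hw₁, hw₂]
  | conic z₁ z₂ w₁₁ w₁₂ w₂₁ w₂₂ hz hne hp hw₁ hw₂ h₁ h₂ =>
    simp only [Set.ext_iff, mem_preimage, mem_singleton_iff, mem_insert_iff] at hp h₁ h₂
    have e₁₁ := (h₁ w₁₁).2 (Or.inl rfl)
    have e₁₂ := (h₁ w₁₂).2 (Or.inr rfl)
    have e₂₁ := (h₂ w₂₁).2 (Or.inl rfl)
    have e₂₂ := (h₂ w₂₂).2 (Or.inr rfl)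
    have n₁ : w₁₁ ≠ w₂₂ := fun h => hne (by rw [← e₁₁, ← e₂₂, h])
    have n₂ : w₂₁ ≠ w₁₂ := fun h => hne (by rw [← e₁₂, ← e₂₁, h])
    have n₃ : w₁₁ ≠ w₂₁ := fun h => hne (by rw [← e₁₁, ← e₂₁, h])
    have n₄ : w₁₂ ≠ w₂₂ := fun h => hne (by rw [← e₁₂, ← e₂₂, h])
    have i₁ : ∀ w, π w = z₁ → σ w ≠ w := fun w h => hσ' _ (Or.inl (by
      rw [(hp _).2 (Or.inl h)]; exact hz))
    have i₂ : ∀ w, π w = z₂ → σ w ≠ w := fun w h => hσ' _ (Or.inl (by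
      rw [(hp _).2 (Or.inr h)]; exact hz))
    -- `σ` preserves each two-point fibre without fixing a point, so it is the exchange.
    have s₁₁ : σ w₁₁ = w₁₂ := ((h₁ _).1 ((hσ _).trans e₁₁)).resolve_left (i₁ _ e₁₁)
    have s₁₂ : σ w₁₂ = w₁₁ := ((h₁ _).1 ((hσ _).trans e₁₂)).resolve_right (i₁ _ e₁₂)
    have s₂₁ : σ w₂₁ = w₂₂ := ((h₂ _).1 ((hσ _).trans e₂₁)).resolve_left (i₂ _ e₂₁)
    have s₂₂ : σ w₂₂ = w₂₁ := ((h₂ _).1 ((hσ _).trans e₂₂)).resolve_right (i₂ _ e₂₂)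
    refine ⟨_, _, ?_, ?_, identify_sup_eq_involutionSetoid hw₁ n₁ n₂ hw₂⟩
    · intro w hw
      have m₁ : π w ≠ z₁ := fun h => hw ((hp _).2 (Or.inl h))
      have m₂ : π w ≠ z₂ := fun h => hw ((hp _).2 (Or.inr h))
      have a₁₁ : w ≠ w₁₁ := fun h => m₁ (h ▸ e₁₁)
      have a₁₂ : w ≠ w₁₂ := fun h => m₁ (h ▸ e₁₂)
      have a₂₁ : w ≠ w₂₁ := fun h => m₂ (h ▸ e₂₁)
      have a₂₂ : w ≠ w₂₂ := fun h => m₂ (h ▸ e₂₂)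
      rw [Equiv.swap_apply_of_ne_of_ne a₁₂ a₂₂, Equiv.swap_apply_of_ne_of_ne a₁₁ a₂₁]
    · intro w hw
      have t₁₁ : Equiv.swap w₁₁ w₂₁ (Equiv.swap w₁₂ w₂₂ w₁₁) = w₂₁ := by
        rw [Equiv.swap_apply_of_ne_of_ne hw₁ n₁, Equiv.swap_apply_left]
      have t₂₁ : Equiv.swap w₁₁ w₂₁ (Equiv.swap w₁₂ w₂₂ w₂₁) = w₁₁ := by
        rw [Equiv.swap_apply_of_ne_of_ne n₂ hw₂, Equiv.swap_apply_right]
      have t₁₂ : Equiv.swap w₁₁ w₂₁ (Equiv.swap w₁₂ w₂₂ w₁₂) = w₂₂ := by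
        rw [Equiv.swap_apply_left, Equiv.swap_apply_of_ne_of_ne n₁.symm hw₂.symm]
      have t₂₂ : Equiv.swap w₁₁ w₂₁ (Equiv.swap w₁₂ w₂₂ w₂₂) = w₁₂ := by
        rw [Equiv.swap_apply_right, Equiv.swap_apply_of_ne_of_ne hw₁.symm n₂.symm]
      have fib : S.proj ⁻¹' {z} = {z₁, z₂} := by
        ext q
        simp [hp]
      rcases (hp _).1 hw with h | h
      · rcases (h₁ _).1 h with rfl | rfl
        · simp only [t₁₁, s₁₁, t₁₂, s₂₁, e₁₁, e₂₁]
          exact ⟨n₃.symm, (hp _).2 (Or.inr rfl), fib, trivial⟩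
        · simp only [t₁₂, s₁₂, t₁₁, s₂₂, e₁₂, e₂₂]
          exact ⟨n₄.symm, (hp _).2 (Or.inr rfl), fib, trivial⟩
      · rcases (h₂ _).1 h with rfl | rfl
        · simp only [t₂₁, s₂₁, t₂₂, s₁₁, e₁₁, e₂₁]
          exact ⟨n₃, (hp _).2 (Or.inl rfl), fib.trans (pair_comm _ _), trivial⟩
        · simp only [t₂₂, s₂₂, t₂₁, s₁₂, e₁₂, e₂₂]
          exact ⟨n₄, (hp _).2 (Or.inl rfl), fib.trans (pair_comm _ _), trivial⟩

/-- The involution of the double determined by a choice of identifications. -/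
lemma Choice.exists_involution (c : Choice S π) {σ : W → W} (hσ : ∀ w, π (σ w) = π w)
    (hσ' : ∀ w, S.proj (π w) ∈ S.conic ∪ S.inessential → σ w ≠ w) :
    ∃ (τ : W → W) (hτ : Function.Involutive τ),
      (∀ w, τ w ≠ w ↔ S.proj (π w) ∈ S.nodes) ∧
      (∀ w, S.proj (π (τ w)) = S.proj (π w)) ∧
      (∀ w, S.proj ⁻¹' {S.proj (π w)} = {π w, π (τ w)}) ∧
      (∀ w, τ (σ w) = σ (τ w)) ∧
      c.rel = involutionSetoid τ hτ ∧
      ∀ (z : S.nodes) (a b : W), (c z).1 a b ↔ a = b ∨ S.proj (π a) = z ∧ b = τ a := by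
  classical
  choose t ht h1 h2 h3 using fun z : S.nodes => (c z).2.exists_involution hσ hσ'
  -- The involutions at the single nodes act on disjoint fibres, so they combine into one map that
  -- is the identity off the nodes.
  let τ : W → W := fun w => if h : S.proj (π w) ∈ S.nodes then t ⟨_, h⟩ w else w
  have τ_of : ∀ (z : S.nodes) (w : W), S.proj (π w) = z → τ w = t z w := by
    rintro ⟨z, hz⟩ w rfl
    exact dif_pos hz
  have τ_not : ∀ w, S.proj (π w) ∉ S.nodes → τ w = w := fun w h => dif_neg h
  have hproj : ∀ w, S.proj (π (τ w)) = S.proj (π w) := by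
    intro w
    by_cases h : S.proj (π w) ∈ S.nodes
    · rw [τ_of ⟨_, h⟩ w rfl]
      exact (h2 ⟨_, h⟩ w rfl).2.1
    · rw [τ_not w h]
  have hτ : Function.Involutive τ := by
    intro w
    by_cases h : S.proj (π w) ∈ S.nodes
    · rw [τ_of ⟨_, h⟩ (τ w) (hproj w), τ_of ⟨_, h⟩ w rfl]
      exact ht _ w
    · rw [τ_not w h, τ_not w h]
  have hc : ∀ (z : S.nodes) (a b : W),
      (c z).1 a b ↔ a = b ∨ S.proj (π a) = z ∧ b = τ a := by
    intro z a b
    rw [h3 z, involutionSetoid_apply]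
    by_cases ha : S.proj (π a) = z
    · rw [τ_of z a ha]
      simp [ha]
    · rw [h1 z a ha]
      simp [ha, eq_comm]
  refine ⟨τ, hτ, ?_, hproj, ?_, ?_, ?_, hc⟩
  · intro w
    by_cases h : S.proj (π w) ∈ S.nodes
    · rw [τ_of ⟨_, h⟩ w rfl]
      exact iff_of_true (h2 ⟨_, h⟩ w rfl).1 h
    · exact iff_of_false (not_not.2 (τ_not w h)) h
  · intro w
    by_cases h : S.proj (π w) ∈ S.nodes
    · rw [τ_of ⟨_, h⟩ w rfl]
      exact (h2 ⟨_, h⟩ w rfl).2.2.1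
    · rw [τ_not w h, pair_eq_singleton]
      have h' : S.proj (π w) ∉ S.crossing := fun hx =>
        h (NodalSurface.mem_crossing_or_inessential.2 (Or.inl hx))
      obtain ⟨z₁, hz₁⟩ := NodalSurface.proj_fibre_of_notMem h'
      have h4 : π w ∈ S.proj ⁻¹' {S.proj (π w)} := rfl
      rw [hz₁] at h4 ⊢
      rw [show π w = z₁ from h4]
  · intro w
    by_cases h : S.proj (π w) ∈ S.nodes
    · rw [τ_of ⟨_, h⟩ w rfl, τ_of ⟨_, h⟩ (σ w) (by rw [hσ])]
      exact (h2 ⟨_, h⟩ w rfl).2.2.2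
    · rw [τ_not w h, τ_not (σ w) (by rwa [hσ])]
  · apply le_antisymm
    · refine iSup_le fun z a b h => ?_
      rcases (hc z a b).1 h with h | h
      · exact Or.inl h
      · exact Or.inr h.2
    · rintro a b (rfl | rfl)
      · exact Setoid.refl' _ a
      · by_cases h : S.proj (π a) ∈ S.nodes
        · exact (le_iSup (fun z => (c z).1) ⟨_, h⟩) ((hc ⟨_, h⟩ a (τ a)).2 (Or.inr ⟨rfl, rfl⟩))
        · rw [τ_not a h]

/-- Identifications over different nodes concern different points, so the generated relation
restricted to the fibre over a node is the one chosen there. -/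
lemma Choice.rel_injective {σ : W → W} (hσ : ∀ w, π (σ w) = π w)
    (hσ' : ∀ w, S.proj (π w) ∈ S.conic ∪ S.inessential → σ w ≠ w) :
    Function.Injective (fun c : Choice S π => c.rel) := by
  have key : ∀ (c : Choice S π) (z : S.nodes) (a b : W),
      (c z).1 a b ↔ a = b ∨ S.proj (π a) = z ∧ c.rel a b := by
    intro c z a b
    obtain ⟨τ, hτ, -, -, -, -, h1, h2⟩ := c.exists_involution hσ hσ'
    rw [h2, h1, involutionSetoid_apply]
    tauto
  intro c c' h
  have h : c.rel = c'.rel := h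
  funext z
  apply Subtype.ext
  ext a b
  rw [key, key, h]

/-- Two points `a`, `b` make up the whole fibre over a boundary node or an inessential node. -/
lemma isIdentificationAt_iff_of_pair {z : X} {a b : W}
    (hf : (fun w => S.proj (π w)) ⁻¹' {z} = {a, b}) (hc : z ∉ S.conic)
    (h : IsIdentificationAt S π z (identify a b)) {s : Setoid W} :
    IsIdentificationAt S π z s ↔ s = identify a b := by
  refine ⟨fun hs => ?_, fun hs => hs ▸ h⟩
  have hfib : ∀ w₁ w₂ : W, (fun w => S.proj (π w)) ⁻¹' {z} = {w₁, w₂} →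
      identify w₁ w₂ = identify a b := by
    intro w₁ w₂ h
    rw [hf, Set.pair_eq_pair_iff] at h
    rcases h with ⟨rfl, rfl⟩ | ⟨rfl, rfl⟩
    · rfl
    · exact identify_comm _ _
  have hpre : (fun w => S.proj (π w)) ⁻¹' {z} = π ⁻¹' (S.proj ⁻¹' {z}) := rfl
  cases hs with
  | boundary z₁ z₂ w₁ w₂ hz hne hp h₁ h₂ =>
    apply hfib
    rw [hpre, hp, insert_eq, preimage_union, h₁, h₂, singleton_union]
  | inessential z₁ w₁ w₂ hz hp hww h₁ =>
    apply hfib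
    rw [hpre, hp, h₁]
  | conic z₁ z₂ w₁₁ w₁₂ w₂₁ w₂₂ hz hne hp hw₁ hw₂ h₁ h₂ => exact absurd hz hc

/-- Reordering the two branches and the points in each fibre gives eight labellings, which collapse
to the two pairings by symmetry of `identify` and of the join. -/
lemma isIdentificationAt_iff_of_conic {z : X} (hz : z ∈ S.conic) (hb : z ∉ S.boundaryNodes)
    (hi : z ∉ S.inessential) {z₁ z₂ : S.Normalization} {a₁ a₂ b₁ b₂ : W} (hne : z₁ ≠ z₂)
    (hp : S.proj ⁻¹' {z} = {z₁, z₂}) (ha : a₁ ≠ a₂) (hb' : b₁ ≠ b₂)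
    (h₁ : π ⁻¹' {z₁} = {a₁, a₂}) (h₂ : π ⁻¹' {z₂} = {b₁, b₂}) {s : Setoid W} :
    IsIdentificationAt S π z s ↔
      s = identify a₁ b₁ ⊔ identify a₂ b₂ ∨ s = identify a₁ b₂ ⊔ identify a₂ b₁ := by
  constructor
  · intro hs
    cases hs with
    | boundary _ _ _ _ hz => exact absurd hz hb
    | inessential _ _ _ hz => exact absurd hz hi
    | conic y₁ y₂ c₁ c₂ d₁ d₂ _ hne' hp' hc hd k₁ k₂ =>
      rw [hp, Set.pair_eq_pair_iff] at hp'
      rcases hp' with ⟨rfl, rfl⟩ | ⟨rfl, rfl⟩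
      · rw [h₁, Set.pair_eq_pair_iff] at k₁
        rw [h₂, Set.pair_eq_pair_iff] at k₂
        rcases k₁ with ⟨rfl, rfl⟩ | ⟨rfl, rfl⟩ <;> rcases k₂ with ⟨rfl, rfl⟩ | ⟨rfl, rfl⟩
        · exact Or.inl rfl
        · exact Or.inr rfl
        · exact Or.inr (sup_comm _ _)
        · exact Or.inl (sup_comm _ _)
      · rw [h₂, Set.pair_eq_pair_iff] at k₁
        rw [h₁, Set.pair_eq_pair_iff] at k₂
        rw [identify_comm c₁, identify_comm c₂]
        rcases k₁ with ⟨rfl, rfl⟩ | ⟨rfl, rfl⟩ <;> rcases k₂ with ⟨rfl, rfl⟩ | ⟨rfl, rfl⟩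
        · exact Or.inl rfl
        · exact Or.inr (sup_comm _ _)
        · exact Or.inr rfl
        · exact Or.inl (sup_comm _ _)
  · rintro (rfl | rfl)
    · exact .conic z₁ z₂ a₁ a₂ b₁ b₂ hz hne hp ha hb' h₁ h₂
    · exact .conic z₁ z₂ a₁ a₂ b₂ b₁ hz hne hp ha hb'.symm h₁ (h₂.trans (pair_comm _ _))

/-- The two pairings of two pairs of points are different. -/
lemma identify_sup_ne {a₁ a₂ b₁ b₂ : W} (ha : a₁ ≠ a₂) (hb : b₁ ≠ b₂) (h₁₁ : a₁ ≠ b₁)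
    (h₂₂ : a₂ ≠ b₂) :
    identify a₁ b₁ ⊔ identify a₂ b₂ ≠ identify a₁ b₂ ⊔ identify a₂ b₁ := by
  classical
  intro h
  have h1 : (identify a₁ b₁ ⊔ identify a₂ b₂) a₁ b₁ :=
    (le_sup_left : identify a₁ b₁ ≤ _) (identify_apply a₁ b₁)
  rw [h, identify_sup_eq_involutionSetoid ha h₁₁ h₂₂.symm hb.symm] at h1
  rcases h1 with h1 | h1
  · exact h₁₁ h1
  · beta_reduce at h1
    rw [Equiv.swap_apply_of_ne_of_ne ha h₁₁, Equiv.swap_apply_left] at h1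
    exact hb h1

end Identifications

/-! ### Counting the choices -/

section Counting

variable {X W : Type u} [TopologicalSpace X] [TopologicalSpace W] {S : NodalSurface X}
  {T : NodalSurface W} {π : W → S.Normalization} {σ : W → W}

lemma mem_crossing_of_conic {z : X} (hz : z ∈ S.conic) : z ∈ S.crossing := by
  rw [S.crossing_eq]
  exact Or.inl hz

lemma mem_crossing_of_boundaryNodes {z : X} (hz : z ∈ S.boundaryNodes) : z ∈ S.crossing := by
  rw [S.crossing_eq]
  exact Or.inr hz

lemma ncard_isIdentificationAt_of_notMem_conic (hS : S.IsKlein)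
    (hT : IsKleinComplexDouble T S.normalization π σ) {z : X}
    (hz : z ∈ S.boundaryNodes ∪ S.inessential) : {s | IsIdentificationAt S π z s}.ncard = 1 := by
  have hSn := S.normalization_nodes
  suffices ∃ a b, (fun w => S.proj (π w)) ⁻¹' {z} = {a, b} ∧ z ∉ S.conic ∧
      IsIdentificationAt S π z (identify a b) by
    obtain ⟨a, b, h1, h2, h3⟩ := this
    rw [Set.ncard_eq_one]
    exact ⟨identify a b, Set.ext fun s => isIdentificationAt_iff_of_pair h1 h2 h3⟩
  have hpre : (fun w => S.proj (π w)) ⁻¹' {z} = π ⁻¹' (S.proj ⁻¹' {z}) := rfl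
  rcases hz with hz | hz
  · obtain ⟨z₁, z₂, hne, hp⟩ := NodalSurface.proj_fibre_of_mem (mem_crossing_of_boundaryNodes hz)
    have hb : ∀ q ∈ S.proj ⁻¹' {z}, q ∈ S.normalization.boundary := by
      rintro q rfl
      exact hS.mem_normalization_boundary hz
    obtain ⟨w₁, h₁⟩ := hT.fibre_of_mem hS.normalization hSn (hb z₁ (by simp [hp]))
    obtain ⟨w₂, h₂⟩ := hT.fibre_of_mem hS.normalization hSn (hb z₂ (by simp [hp]))
    refine ⟨w₁, w₂, ?_, Set.disjoint_right.1 hS.disjoint_conic hz,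
      .boundary z₁ z₂ w₁ w₂ hz hne hp h₁ h₂⟩
    rw [hpre, hp, insert_eq, preimage_union, h₁, h₂, singleton_union]
  · have hc := S.notMem_crossing_of_inessential hz
    obtain ⟨z₁, hp⟩ := NodalSurface.proj_fibre_of_notMem hc
    have hb : ∀ q ∈ S.proj ⁻¹' {z}, q ∉ S.normalization.boundary := by
      rintro q rfl
      exact hS.notMem_normalization_boundary (Or.inr hz)
    obtain ⟨w₁, w₂, hw, h₁⟩ := hT.fibre_of_notMem hS.normalization hSn (hb z₁ (by simp [hp]))
    exact ⟨w₁, w₂, by rw [hpre, hp, h₁], fun h => hc (mem_crossing_of_conic h),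
      .inessential z₁ w₁ w₂ hz hp hw h₁⟩

lemma ncard_isIdentificationAt_of_conic (hS : S.IsKlein)
    (hT : IsKleinComplexDouble T S.normalization π σ) {z : X}
    (hz : z ∈ S.conic) : {s | IsIdentificationAt S π z s}.ncard = 2 := by
  have hSn := S.normalization_nodes
  obtain ⟨z₁, z₂, hne, hp⟩ := NodalSurface.proj_fibre_of_mem (mem_crossing_of_conic hz)
  have hb : ∀ q ∈ S.proj ⁻¹' {z}, q ∉ S.normalization.boundary := by
    rintro q rfl
    exact hS.notMem_normalization_boundary (Or.inl hz)
  obtain ⟨a₁, a₂, ha, h₁⟩ := hT.fibre_of_notMem hS.normalization hSn (hb z₁ (by simp [hp]))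
  obtain ⟨b₁, b₂, hb', h₂⟩ := hT.fibre_of_notMem hS.normalization hSn (hb z₂ (by simp [hp]))
  have hab : ∀ a ∈ π ⁻¹' {z₁}, ∀ b ∈ π ⁻¹' {z₂}, a ≠ b := by
    rintro a rfl b hb rfl
    exact hne hb
  rw [h₁, h₂] at hab
  rw [Set.ncard_eq_two]
  refine ⟨identify a₁ b₁ ⊔ identify a₂ b₂, identify a₁ b₂ ⊔ identify a₂ b₁,
    identify_sup_ne ha hb' (hab _ (by simp) _ (by simp)) (hab _ (by simp) _ (by simp)),
    Set.ext fun s => ?_⟩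
  exact isIdentificationAt_iff_of_conic hz (Set.disjoint_left.1 hS.disjoint_conic hz)
    (fun h => S.notMem_crossing_of_inessential h (mem_crossing_of_conic hz)) hne hp ha hb' h₁ h₂

/-- Cardinals are used because the set of nodes may be infinite. -/
lemma mk_choice (hS : S.IsKlein) (hT : IsKleinComplexDouble T S.normalization π σ) :
    Cardinal.mk (Choice S π) = 2 ^ Cardinal.mk S.conic := by
  classical
  -- Functions from the proposition to `Bool` number two at a conic node and one elsewhere, so one
  -- formula covers all factors of the product.
  have h1 : ∀ z : S.nodes, Nonempty ({s : Setoid W // IsIdentificationAt S π z s} ≃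
      ((z : X) ∈ S.conic → Bool)) := by
    intro z
    by_cases hz : (z : X) ∈ S.conic
    · have h2 := ncard_isIdentificationAt_of_conic hS hT hz
      replace h2 : Nat.card {s : Setoid W // IsIdentificationAt S π z s} = _ := h2
      have : Finite {s : Setoid W // IsIdentificationAt S π z s} :=
        Nat.finite_of_card_ne_zero (by rw [h2]; norm_num)
      let _ := uniqueProp hz
      exact ⟨(Finite.card_eq.1 (show _ = Nat.card Bool from h2.trans (by simp))).some.trans
        (Equiv.funUnique _ Bool).symm⟩
    · have h2 := ncard_isIdentificationAt_of_notMem_conic hS hT (z := z) (by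
        have := z.2
        simp only [NodalSurface.nodes, mem_union] at this ⊢
        tauto)
      replace h2 : Nat.card {s : Setoid W // IsIdentificationAt S π z s} = _ := h2
      have : Finite {s : Setoid W // IsIdentificationAt S π z s} :=
        Nat.finite_of_card_ne_zero (by rw [h2]; norm_num)
      have : IsEmpty ((z : X) ∈ S.conic) := isEmpty_Prop.2 hz
      exact Finite.card_eq.1 (h2.trans (by simp))
  have e : Choice S π ≃ (S.conic → Bool) :=
    (Equiv.piCongrRight fun z => (h1 z).some).trans
      { toFun := fun f z => f ⟨z, Or.inl (Or.inl z.2)⟩ z.2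
        invFun := fun f z hz => f ⟨z, hz⟩
        left_inv := fun f => rfl
        right_inv := fun f => rfl }
  rw [Cardinal.mk_congr e]
  simp

end Counting

end Nodal

namespace Nodal

/-! ### Pinching a Riemann surface along an involution of a discrete set -/

/-- `r` is the orbit relation of an involution of a Riemann surface that moves only the points of a
closed discrete set. -/
structure IsPinching {W : Type u} [TopologicalSpace W] (T : NodalSurface W) (τ : W → W)
    (r : Setoid W) : Prop where
  riemann : T.IsRiemann
  nodes : T.nodes = ∅
  involutive : Function.Involutive τ
  rel : ∀ a b, r a b ↔ a = b ∨ b = τ a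
  discrete : ∀ w, ∃ U ∈ 𝓝 w, ∀ v ∈ U, τ v ≠ v → v = w

/-- A local coordinate that is compatible with the analytic structure of `T`. -/
def Admissible {W : Type u} [TopologicalSpace W] (T : NodalSurface W)
    (φ : OpenPartialHomeomorph W ℂ) : Prop :=
  ∀ e ∈ T.atlas, ∀ y ∈ e.source ∩ φ.source, AnalyticRel e.coord φ y ∧ AnalyticRel φ e.coord y

/-- Two local coordinates centred at two points that are exchanged by `τ`. -/
structure NodePair {W : Type u} [TopologicalSpace W] (τ : W → W)
    (φ : Bool → OpenPartialHomeomorph W ℂ) : Prop where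
  disjoint : Disjoint (φ false).source (φ true).source
  zero_mem : ∀ k, 0 ∈ (φ k).target
  swap : ∀ k, τ ((φ k).symm 0) = (φ (!k)).symm 0
  fixed : ∀ k, ∀ y ∈ (φ k).source, τ y ≠ y → φ k y = 0

namespace IsPinching

variable {W : Type u} [TopologicalSpace W] {T : NodalSurface W} {τ : W → W} {r : Setoid W}

lemma mk_eq_mk (h : IsPinching T τ r) {a b : W} :
    Quotient.mk r a = Quotient.mk r b ↔ a = b ∨ b = τ a :=
  Quotient.eq.trans (h.rel a b)

lemma mk_tau (h : IsPinching T τ r) (a : W) : Quotient.mk r (τ a) = Quotient.mk r a :=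
  (h.mk_eq_mk.2 (Or.inr rfl)).symm

lemma eq_of_mk_eq_mk (h : IsPinching T τ r) {a b : W} (hab : Quotient.mk r a = Quotient.mk r b)
    (ha : τ a = a) : a = b := by
  rcases h.mk_eq_mk.1 hab with h | h
  · exact h
  · rw [h, ha]

lemma preimage_image (h : IsPinching T τ r) {O : Set W} (hO : ∀ w ∈ O, τ w ∈ O) :
    Quotient.mk r ⁻¹' (Quotient.mk r '' O) = O := by
  apply Subset.antisymm
  · rintro w ⟨v, hv, hvw⟩
    rcases h.mk_eq_mk.1 hvw with rfl | rfl
    · exact hv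
    · exact hO v hv
  · exact subset_preimage_image _ _

lemma isOpen_image (h : IsPinching T τ r) {O : Set W} (hO : IsOpen O) (hτ : ∀ w ∈ O, τ w ∈ O) :
    IsOpen (Quotient.mk r '' O) := by
  rw [← isQuotientMap_quotient_mk'.isOpen_preimage]
  change IsOpen (Quotient.mk r ⁻¹' _)
  rwa [h.preimage_image hτ]

/-- Moved points do not accumulate, so any set of them may be removed from an open set. -/
lemma isClosed_of_subset (h : IsPinching T τ r) {B : Set W} (hB : ∀ w ∈ B, τ w ≠ w) :
    IsClosed B := by
  have := T.t2
  rw [← isOpen_compl_iff, isOpen_iff_mem_nhds]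
  intro w hw
  obtain ⟨U, hU, hUw⟩ := h.discrete w
  filter_upwards [hU] with v hv hvB
  exact hw (hUw v hv (hB v hvB) ▸ hvB)

/-- The open set `O` without the moved points other than `w` and `τ w`. -/
lemma exists_saturated (h : IsPinching T τ r) {O : Set W} (hO : IsOpen O) {w : W} (hw : w ∈ O)
    (hw' : τ w ∈ O) : ∃ O' ⊆ O, IsOpen O' ∧ w ∈ O' ∧ (∀ v ∈ O', τ v ∈ O') ∧
      ∀ v ∈ O', τ v ≠ v → v = w ∨ v = τ w := by
  refine ⟨O \ {v | τ v ≠ v ∧ v ≠ w ∧ v ≠ τ w}, Set.sdiff_subset,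
    hO.sdiff (h.isClosed_of_subset fun v hv => hv.1), ⟨hw, fun hv => hv.2.1 rfl⟩, ?_, ?_⟩
  · rintro v ⟨hv, hv'⟩
    by_cases hf : τ v = v
    · rw [hf]
      exact ⟨hv, hv'⟩
    · have : v = w ∨ v = τ w := by
        by_contra hcon
        push Not at hcon
        exact hv' ⟨hf, hcon⟩
      rcases this with rfl | rfl
      · exact ⟨hw', fun hv => hv.2.2 rfl⟩
      · rw [h.involutive]
        exact ⟨hw, fun hv => hv.2.1 rfl⟩
  · rintro v ⟨hv, hv'⟩ hf
    by_contra hcon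
    push Not at hcon
    exact hv' ⟨hf, hcon⟩

/-- Every neighbourhood of an unmoved point contains a saturated open one, whose image is open. This
is what lets analytic germs descend. -/
lemma map_mk_nhds (h : IsPinching T τ r) {y : W} (hy : τ y = y) :
    map (Quotient.mk r) (𝓝 y) = 𝓝 (Quotient.mk r y) := by
  apply le_antisymm
  · exact continuous_quotient_mk'.continuousAt
  · intro V hV
    obtain ⟨O, hOV, hO, hyO⟩ := mem_nhds_iff.1 (mem_map.1 hV)
    obtain ⟨O', hO'O, hO', hyO', hτ, -⟩ := h.exists_saturated hO hyO (by rwa [hy])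
    refine mem_of_superset ((h.isOpen_image hO' hτ).mem_nhds ⟨y, hyO', rfl⟩) ?_
    rintro _ ⟨v, hv, rfl⟩
    exact hOV (hO'O hv)

lemma t2Space (h : IsPinching T τ r) : T2Space (Quotient r) := by
  have := T.t2
  refine ⟨?_⟩
  rintro ⟨w⟩ ⟨v⟩ hne
  have hne : Quotient.mk r w ≠ Quotient.mk r v := hne
  have h1 : Disjoint ({w, τ w} : Set W) {v, τ v} := by
    rw [Set.disjoint_left]
    intro a ha hb
    have ha' : Quotient.mk r a = Quotient.mk r w := by
      rcases ha with rfl | rfl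
      · rfl
      · exact h.mk_tau w
    have hb' : Quotient.mk r a = Quotient.mk r v := by
      rcases hb with rfl | rfl
      · rfl
      · exact h.mk_tau v
    exact hne (ha'.symm.trans hb')
  -- Orbits are finite, hence compact: disjoint orbits are separated first, and the open sets are
  -- made saturated afterwards.
  obtain ⟨U, V, hU, hV, hwU, hvV, hUV⟩ :=
    SeparatedNhds.of_isCompact_isCompact (Set.toFinite {w, τ w}).isCompact
      (Set.toFinite {v, τ v}).isCompact h1
  obtain ⟨U', hU'U, hU', hwU', hτU, -⟩ := h.exists_saturated (w := w) hU (hwU (by simp)) (hwU (by simp))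
  obtain ⟨V', hV'V, hV', hvV', hτV, -⟩ := h.exists_saturated (w := v) hV (hvV (by simp)) (hvV (by simp))
  refine ⟨_, _, h.isOpen_image hU' hτU, h.isOpen_image hV' hτV, ⟨w, hwU', rfl⟩, ⟨v, hvV', rfl⟩, ?_⟩
  rw [Set.disjoint_left]
  rintro _ ⟨a, ha, rfl⟩ hb
  have haV : a ∈ Quotient.mk r ⁻¹' (Quotient.mk r '' V') := hb
  rw [h.preimage_image hτV] at haV
  exact Set.disjoint_left.1 hUV (hU'U ha) (hV'V haV)

/-- Admissible coordinates centred at a given point, with small domain. -/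
lemma exists_admissible (h : IsPinching T τ r) {O : Set W} (hO : IsOpen O) {w : W} (hw : w ∈ O) :
    ∃ φ, Admissible T φ ∧ w ∈ φ.source ∧ φ.source ⊆ O ∧ φ w = 0 := by
  have hn : ∀ v, v ∉ T.nodes := fun v => by simp [h.nodes]
  obtain ⟨φ, h1, h2, h3⟩ := (T.chartAt w).exists_openPartialHomeomorph (T.mem_chartAt w)
    (NodalSurface.not_crossing_of_notMem_nodes (T.chartAt_mem w) (hn w))
    (h.riemann.2.1 _ (T.chartAt_mem w))
  have hs : ((φ.restrOpen O hO).transHomeomorph (Homeomorph.subRight (φ w))).source =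
      φ.source ∩ O := rfl
  have hv : ∀ y, (φ.restrOpen O hO).transHomeomorph (Homeomorph.subRight (φ w)) y = φ y - φ w :=
    fun _ => rfl
  refine ⟨(φ.restrOpen O hO).transHomeomorph (Homeomorph.subRight (φ w)), ?_, ?_, ?_, ?_⟩
  · rintro e he y ⟨hye, hyφ⟩
    rw [hs] at hyφ
    have hyc := h2 hyφ.1
    have hev : ∀ᶠ t in 𝓝 y, φ t = (T.chartAt w).coord t := by
      filter_upwards [φ.open_source.mem_nhds hyφ.1] with t ht
      exact h3 t ht
    constructor
    · refine (h.riemann.2.2 e he _ (T.chartAt_mem w) y ⟨hye, hyc⟩ (hn y)).trans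
        ⟨fun u => u - φ w, by fun_prop, ?_⟩
      filter_upwards [hev] with t ht
      rw [hv, ht]
    · refine AnalyticRel.trans ⟨fun u => u + φ w, by fun_prop, ?_⟩
        (h.riemann.2.2 _ (T.chartAt_mem w) e he y ⟨hyc, hye⟩ (hn y))
      filter_upwards [hev] with t ht
      rw [hv, ht, sub_add_cancel]
  · rw [hs]
    exact ⟨h1, hw⟩
  · rw [hs]
    exact inter_subset_right
  · rw [hv, sub_self]

lemma _root_.Nodal.Admissible.trans {φ φ' : OpenPartialHomeomorph W ℂ}
    (hφ : Admissible T φ) (hφ' : Admissible T φ') {y : W} (hy : y ∈ φ.source)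
    (hy' : y ∈ φ'.source) : AnalyticRel φ φ' y :=
  (hφ _ (T.chartAt_mem y) y ⟨T.mem_chartAt y, hy⟩).2.trans
    (hφ' _ (T.chartAt_mem y) y ⟨T.mem_chartAt y, hy'⟩).1

/-- The charts of the quotient are computed on the representative `Quotient.out`; only these two
cases have to be shown to give the same value. -/
lemma out_mk (h : IsPinching T τ r) (y : W) :
    (Quotient.mk r y).out = y ∨ (Quotient.mk r y).out = τ y :=
  (h.mk_eq_mk.1 (Quotient.out_eq (Quotient.mk r y)).symm).imp Eq.symm id

/-! #### Charts at the points that are not moved -/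

/-- The chart of the quotient given by a coordinate whose domain contains no moved points. -/
noncomputable def planeChart (h : IsPinching T τ r) (φ : OpenPartialHomeomorph W ℂ)
    (hφ : ∀ y ∈ φ.source, τ y = y) : NodalChart (Quotient r) where
  kind := .plane
  homeo :=
    have hout : ∀ y ∈ φ.source, (Quotient.mk r y).out = y := fun y hy => by
      rcases h.out_mk y with h | h
      · exact h
      · rw [h, hφ y hy]
    have hsat : ∀ y ∈ φ.source, τ y ∈ φ.source := fun y hy => by rwa [hφ y hy]
    { toFun := fun q => ⟨(φ q.out, 0), rfl⟩
      invFun := fun a => Quotient.mk r (φ.symm (a : ℂ × ℂ).1)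
      source := Quotient.mk r '' φ.source
      target := {a | (a : ℂ × ℂ).1 ∈ φ.target}
      map_source' := by
        rintro _ ⟨y, hy, rfl⟩
        change φ (Quotient.mk r y).out ∈ φ.target
        rw [hout y hy]
        exact φ.map_source hy
      map_target' := fun a ha => ⟨_, φ.map_target ha, rfl⟩
      left_inv' := by
        rintro _ ⟨y, hy, rfl⟩
        change Quotient.mk r (φ.symm (φ (Quotient.mk r y).out)) = _
        rw [hout y hy, φ.left_inv hy]
      right_inv' := by
        rintro ⟨⟨a, b⟩, hb⟩ ha
        obtain rfl : b = 0 := hb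
        apply Subtype.ext
        change (φ (Quotient.mk r (φ.symm a)).out, (0 : ℂ)) = (a, 0)
        rw [hout _ (φ.map_target ha), φ.right_inv ha]
      open_source := h.isOpen_image φ.open_source hsat
      open_target := φ.open_target.preimage (continuous_fst.comp continuous_subtype_val)
      continuousOn_toFun := by
        rw [isQuotientMap_quotient_mk'.continuousOn_isOpen_iff (h.isOpen_image φ.open_source hsat)]
        change ContinuousOn _ (Quotient.mk r ⁻¹' _)
        rw [h.preimage_image hsat, Topology.IsInducing.subtypeVal.continuousOn_iff]
        refine ContinuousOn.congr (f := fun y => (φ y, 0)) (φ.continuousOn.prodMk continuousOn_const)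
          ?_
        intro y hy
        change (φ (Quotient.mk r y).out, (0 : ℂ)) = _
        rw [hout y hy]
      continuousOn_invFun := continuous_quotient_mk'.comp_continuousOn
        (φ.continuousOn_symm.comp (continuous_fst.comp continuous_subtype_val).continuousOn
          fun _ ha => ha) }

/-! #### Charts at the moved points -/

open Classical in
/-- The values of the chart given by two coordinates. -/
noncomputable def pairVal (φ : Bool → OpenPartialHomeomorph W ℂ) (y : W) : ℂ × ℂ :=
  if y ∈ (φ false).source then inject false (φ false y)
  -- The default 0 keeps the value in the nodal model everywhere.
  else if y ∈ (φ true).source then inject true (φ true y) else 0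

/-- The inverse of the chart given by two coordinates. -/
noncomputable def pairInv (r : Setoid W) (φ : Bool → OpenPartialHomeomorph W ℂ) (q : ℂ × ℂ) :
    Quotient r :=
  open Classical in
  if q.2 = 0 then Quotient.mk r ((φ false).symm q.1) else Quotient.mk r ((φ true).symm q.2)

variable {φ : Bool → OpenPartialHomeomorph W ℂ}

lemma pairVal_mem (φ : Bool → OpenPartialHomeomorph W ℂ) (y : W) :
    pairVal φ y ∈ ModelKind.node.carrier := by
  unfold pairVal
  split_ifs <;> simp [inject, ModelKind.carrier]

lemma pairVal_of_mem (hφ : NodePair τ φ) {k : Bool} {y : W} (hy : y ∈ (φ k).source) :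
    pairVal φ y = inject k (φ k y) := by
  cases k
  · rw [pairVal, if_pos hy]
  · rw [pairVal, if_neg (Set.disjoint_right.1 hφ.disjoint hy), if_pos hy]

lemma _root_.Nodal.NodePair.symm_zero_mem (hφ : NodePair τ φ) (k : Bool) :
    (φ k).symm 0 ∈ (φ k).source := (φ k).map_target (hφ.zero_mem k)

lemma eq_symm_zero {k : Bool} {y : W}
    (hy : y ∈ (φ k).source) (h0 : φ k y = 0) : y = (φ k).symm 0 := by
  rw [← h0, (φ k).left_inv hy]

/-- The choice of representative matters only at moved points; in these domains they are the two
centres, and both have value 0. -/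
lemma pairVal_out (h : IsPinching T τ r) (hφ : NodePair τ φ) {k : Bool} {y : W}
    (hy : y ∈ (φ k).source) : pairVal φ (Quotient.mk r y).out = inject k (φ k y) := by
  rcases h.out_mk y with ho | ho
  · rw [ho, pairVal_of_mem hφ hy]
  · rw [ho]
    by_cases hf : τ y = y
    · rw [hf, pairVal_of_mem hφ hy]
    · have h0 := hφ.fixed k y hy hf
      rw [eq_symm_zero hy h0, hφ.swap, pairVal_of_mem hφ (hφ.symm_zero_mem (!k)),
        (φ (!k)).right_inv (hφ.zero_mem _), (φ k).right_inv (hφ.zero_mem _),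
        inject_eq_zero_iff.2 rfl, inject_eq_zero_iff.2 rfl]

lemma mk_symm_zero (h : IsPinching T τ r) (hφ : NodePair τ φ) (k : Bool) :
    Quotient.mk r ((φ (!k)).symm 0) = Quotient.mk r ((φ k).symm 0) := by
  rw [← hφ.swap, h.mk_tau]

/-- At the origin `pairInv` always uses the first branch; this agrees with the second because the
centres are glued. -/
lemma pairInv_inject (h : IsPinching T τ r) (hφ : NodePair τ φ) (k : Bool) (a : ℂ) :
    pairInv r φ (inject k a) = Quotient.mk r ((φ k).symm a) := by
  cases k
  · simp [pairInv, inject]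
  · by_cases ha : a = 0
    · subst ha
      simp only [pairInv, inject, if_true]
      exact h.mk_symm_zero hφ true
    · simp [pairInv, inject, ha]

lemma exists_eq_inject {κ : ModelKind} {q : ℂ × ℂ} (hq : q ∈ κ.carrier) :
    ∃ k a, q = inject k a := by
  obtain ⟨k, -, hk⟩ := axis_or hq
  exact ⟨k, axis k q, (inject_axis hk).symm⟩

lemma inject_mem_target (hφ : NodePair τ φ) {k : Bool} {a : ℂ} :
    ((inject k a).1 ∈ (φ false).target ∧ (inject k a).2 ∈ (φ true).target) ↔ a ∈ (φ k).target := by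
  cases k <;> simp [inject, hφ.zero_mem]

/-- The chart of the quotient given by coordinates around two points that are glued together. -/
noncomputable def nodeChart (h : IsPinching T τ r) (φ : Bool → OpenPartialHomeomorph W ℂ)
    (hφ : NodePair τ φ) : NodalChart (Quotient r) where
  kind := .node
  homeo :=
    have hsat : ∀ y ∈ (φ false).source ∪ (φ true).source,
        τ y ∈ (φ false).source ∪ (φ true).source := by
      have key : ∀ k, ∀ y ∈ (φ k).source, τ y ∈ (φ k).source ∪ (φ (!k)).source := by
        intro k y hy
        by_cases hf : τ y = y
        · rw [hf]
          exact Or.inl hy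
        · rw [eq_symm_zero hy (hφ.fixed k y hy hf), hφ.swap]
          exact Or.inr (hφ.symm_zero_mem _)
      rintro y (hy | hy)
      · exact key false y hy
      · exact (key true y hy).symm
    have hopen := h.isOpen_image ((φ false).open_source.union (φ true).open_source) hsat
    { toFun := fun q => ⟨pairVal φ q.out, pairVal_mem φ _⟩
      invFun := fun a => pairInv r φ a
      source := Quotient.mk r '' ((φ false).source ∪ (φ true).source)
      target := {a | (a : ℂ × ℂ).1 ∈ (φ false).target ∧ (a : ℂ × ℂ).2 ∈ (φ true).target}
      map_source' := by
        have key : ∀ k, ∀ y ∈ (φ k).source, (pairVal φ (Quotient.mk r y).out).1 ∈ (φ false).target ∧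
            (pairVal φ (Quotient.mk r y).out).2 ∈ (φ true).target := by
          intro k y hy
          rw [h.pairVal_out hφ hy]
          exact (inject_mem_target hφ).2 ((φ k).map_source hy)
        rintro _ ⟨y, hy | hy, rfl⟩
        · exact key _ y hy
        · exact key _ y hy
      map_target' := by
        rintro ⟨q, hq⟩ hqt
        obtain ⟨k, a, rfl⟩ := exists_eq_inject hq
        have ha := (inject_mem_target hφ).1 hqt
        rw [h.pairInv_inject hφ]
        refine ⟨_, ?_, rfl⟩
        cases k
        · exact Or.inl ((φ false).map_target ha)
        · exact Or.inr ((φ true).map_target ha)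
      left_inv' := by
        have key : ∀ k, ∀ y ∈ (φ k).source,
            pairInv r φ (pairVal φ (Quotient.mk r y).out) = Quotient.mk r y := by
          intro k y hy
          rw [h.pairVal_out hφ hy, h.pairInv_inject hφ, (φ k).left_inv hy]
        rintro _ ⟨y, hy | hy, rfl⟩
        · exact key _ y hy
        · exact key _ y hy
      right_inv' := by
        rintro ⟨q, hq⟩ hqt
        obtain ⟨k, a, rfl⟩ := exists_eq_inject hq
        have ha := (inject_mem_target hφ).1 hqt
        apply Subtype.ext
        change pairVal φ (pairInv r φ (inject k a)).out = _
        rw [h.pairInv_inject hφ, h.pairVal_out hφ ((φ k).map_target ha), (φ k).right_inv ha]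
      open_source := hopen
      open_target := ((φ false).open_target.preimage (continuous_fst.comp continuous_subtype_val)).inter
        ((φ true).open_target.preimage (continuous_snd.comp continuous_subtype_val))
      continuousOn_toFun := by
        rw [isQuotientMap_quotient_mk'.continuousOn_isOpen_iff hopen]
        change ContinuousOn _ (Quotient.mk r ⁻¹' _)
        rw [h.preimage_image hsat, Topology.IsInducing.subtypeVal.continuousOn_iff]
        have key : ∀ k, ContinuousOn (fun y => pairVal φ (Quotient.mk r y).out) (φ k).source :=
          fun k => ((continuous_inject k).comp_continuousOn (φ k).continuousOn).congr
            fun y hy => h.pairVal_out hφ hy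
        exact (key false).union_of_isOpen (key true) (φ false).open_source (φ true).open_source
      continuousOn_invFun := by
        intro q hq
        -- The node is the union of its two closed axes, so continuity may be tested on each axis; a
        -- point off an axis is not in its closure and needs no argument there.
        have key : ∀ k, ContinuousWithinAt (fun a : ModelKind.node.carrier => pairInv r φ a)
            ({a | (a : ℂ × ℂ).1 ∈ (φ false).target ∧ (a : ℂ × ℂ).2 ∈ (φ true).target} ∩
              {a | axis (!k) (a : ℂ × ℂ) = 0}) q := by
          intro k
          have hclosed : IsClosed {a : ModelKind.node.carrier | axis (!k) (a : ℂ × ℂ) = 0} :=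
            isClosed_eq ((continuous_axis _).comp continuous_subtype_val) continuous_const
          by_cases hk : axis (!k) (q : ℂ × ℂ) = 0
          · have hmem : ∀ a : ModelKind.node.carrier, a ∈ {a : ModelKind.node.carrier |
                (a : ℂ × ℂ).1 ∈ (φ false).target ∧ (a : ℂ × ℂ).2 ∈ (φ true).target} ∩
                {a | axis (!k) (a : ℂ × ℂ) = 0} → axis k (a : ℂ × ℂ) ∈ (φ k).target := by
              rintro a ⟨ha, ha'⟩
              refine (inject_mem_target hφ).1 ?_
              rw [inject_axis ha']
              exact ha
            have hc : ContinuousOn (fun a : ModelKind.node.carrier =>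
                Quotient.mk r ((φ k).symm (axis k (a : ℂ × ℂ)))) _ :=
              continuous_quotient_mk'.comp_continuousOn ((φ k).continuousOn_symm.comp
                ((continuous_axis k).comp continuous_subtype_val).continuousOn hmem)
            refine (hc.congr ?_) q ⟨hq, hk⟩
            rintro a ⟨-, ha'⟩
            beta_reduce
            rw [← h.pairInv_inject hφ, inject_axis ha']
          · refine continuousWithinAt_of_notMem_closure fun hcl => hk ?_
            exact closure_minimal inter_subset_right hclosed hcl
        refine ((key false).union (key true)).mono ?_
        rintro ⟨a, ha⟩ hat
        obtain ⟨k, -, hk⟩ := axis_or ha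
        cases k
        · exact Or.inl ⟨hat, hk⟩
        · exact Or.inr ⟨hat, hk⟩ }

end IsPinching

end Nodal

namespace Nodal

/-! ### Sheets, atlas and normalization of the pinched surface -/

namespace IsPinching

variable {W : Type u} [TopologicalSpace W] {T : NodalSurface W} {τ : W → W} {r : Setoid W}

/-- The coordinate `φ` of `W` is the branch `k` of the chart `c` of the quotient. -/
structure IsSheet (T : NodalSurface W) (c : NodalChart (Quotient r)) (k : Bool)
    (φ : OpenPartialHomeomorph W ℂ) : Prop where
  admissible : Admissible T φ
  mem : ∀ y ∈ φ.source, Quotient.mk r y ∈ c.source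
  val : ∀ y ∈ φ.source, c.val (Quotient.mk r y) = inject k (φ y)
  exists_mem : ∀ q ∈ c.source, axis (!k) (c.val q) = 0 → ∃ y ∈ φ.source, Quotient.mk r y = q

lemma IsSheet.coord {c : NodalChart (Quotient r)} {k : Bool} {φ : OpenPartialHomeomorph W ℂ}
    (hs : IsSheet T c k φ) {y : W} (hy : y ∈ φ.source) : c.coord (Quotient.mk r y) = φ y := by
  rw [NodalChart.coord, hs.val y hy, coord_inject]

/-- The atlas of the pinched surface. -/
def pinchAtlas (h : IsPinching T τ r) : Set (NodalChart (Quotient r)) :=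
  {c | ∃ φ, ∃ hφ : ∀ y ∈ φ.source, τ y = y, Admissible T φ ∧ c = h.planeChart φ hφ} ∪
    {c | ∃ φ, ∃ hφ : NodePair τ φ, (∀ k, Admissible T (φ k)) ∧ c = h.nodeChart φ hφ}

lemma planeChart_isSheet (h : IsPinching T τ r) {φ : OpenPartialHomeomorph W ℂ}
    (hφ : ∀ y ∈ φ.source, τ y = y) (ha : Admissible T φ) :
    IsSheet T (h.planeChart φ hφ) false φ where
  admissible := ha
  mem y hy := ⟨y, hy, rfl⟩
  val y hy := by
    change (φ (Quotient.mk r y).out, (0 : ℂ)) = (φ y, 0)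
    rcases h.out_mk y with h | h
    · rw [h]
    · rw [h, hφ y hy]
  exists_mem := fun q hq _ => hq

lemma nodeChart_isSheet (h : IsPinching T τ r) {φ : Bool → OpenPartialHomeomorph W ℂ}
    (hφ : NodePair τ φ) (ha : ∀ k, Admissible T (φ k)) (k : Bool) :
    IsSheet T (h.nodeChart φ hφ) k (φ k) where
  admissible := ha k
  mem y hy := by
    refine ⟨y, ?_, rfl⟩
    cases k
    · exact Or.inl hy
    · exact Or.inr hy
  val y hy := h.pairVal_out hφ hy
  exists_mem := by
    have key : ∀ k', ∀ y ∈ (φ k').source,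
        axis (!k) ((h.nodeChart φ hφ).val (Quotient.mk r y)) = 0 →
        ∃ y' ∈ (φ k).source, Quotient.mk r y' = Quotient.mk r y := by
      intro k' y hy h0
      by_cases hk : k' = k
      · subst hk
        exact ⟨y, hy, rfl⟩
      · obtain rfl : k' = !k := by cases k <;> cases k' <;> simp_all
        have h1 : (h.nodeChart φ hφ).val (Quotient.mk r y) = inject (!k) (φ (!k) y) :=
          h.pairVal_out hφ hy
        -- A point of the other disc whose value lies on axis `k` is the centre of that disc, which
        -- is glued to the centre of disc `k`.
        rw [h1, axis_inject] at h0
        refine ⟨_, hφ.symm_zero_mem k, ?_⟩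
        rw [eq_symm_zero hy h0, h.mk_symm_zero hφ]
    rintro _ ⟨y, hy | hy, rfl⟩ h0
    · exact key false y hy h0
    · exact key true y hy h0

/-- Common description of both kinds of charts, so that later arguments do not distinguish them: one
sheet per branch, disjoint sheets at a node, moved points only at the crossing. For a plane chart
the sheet `true` is a dummy. -/
lemma exists_sheets (h : IsPinching T τ r) {c : NodalChart (Quotient r)} (hc : c ∈ h.pinchAtlas) :
    ∃ φ : Bool → OpenPartialHomeomorph W ℂ,
      (∀ k, c.kind.IsNodal ∨ k = false → IsSheet T c k (φ k)) ∧
      (c.kind.IsNodal → Disjoint (φ false).source (φ true).source) ∧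
      ∀ k, c.kind.IsNodal ∨ k = false → ∀ y ∈ (φ k).source, τ y ≠ y →
        c.Crossing (Quotient.mk r y) := by
  rcases hc with ⟨φ, hφ, ha, rfl⟩ | ⟨φ, hφ, ha, rfl⟩
  · refine ⟨fun _ => φ, ?_, fun hn => absurd hn id, ?_⟩
    · rintro k (hk | rfl)
      · exact absurd hk id
      · exact h.planeChart_isSheet hφ ha
    · intro k _ y hy hf
      exact absurd (hφ y hy) hf
  · refine ⟨φ, fun k _ => h.nodeChart_isSheet hφ ha k, fun _ => hφ.disjoint, ?_⟩
    intro k _ y hy hf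
    refine ⟨(h.nodeChart_isSheet hφ ha k).mem y hy, trivial, ?_⟩
    rw [(h.nodeChart_isSheet hφ ha k).val y hy, hφ.fixed k y hy hf, inject_eq_zero_iff.2 rfl]

lemma not_isHalf (h : IsPinching T τ r) {c : NodalChart (Quotient r)} (hc : c ∈ h.pinchAtlas) :
    ¬ c.kind.IsHalf := by
  rcases hc with ⟨φ, hφ, ha, rfl⟩ | ⟨φ, hφ, ha, rfl⟩
  · exact id
  · exact id

lemma pinchAtlas_cover (h : IsPinching T τ r) (x : Quotient r) :
    ∃ c ∈ h.pinchAtlas, x ∈ c.source := by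
  have := T.t2
  obtain ⟨w, rfl⟩ := Quotient.exists_rep x
  by_cases hf : τ w = w
  -- The only moved points left in `O` could be `w` and `τ w`, which are the same unmoved point, so
  -- a plane chart is available.
  · obtain ⟨O, -, hO, hwO, -, hm⟩ := h.exists_saturated isOpen_univ (mem_univ w) (mem_univ _)
    obtain ⟨φ, ha, hwφ, hφO, -⟩ := h.exists_admissible hO hwO
    refine ⟨_, Or.inl ⟨φ, ?_, ha, rfl⟩, ⟨w, hwφ, rfl⟩⟩
    intro y hy
    by_contra hy'
    rcases hm y (hφO hy) hy' with rfl | rfl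
    · exact hy' hf
    · exact hy' (by rw [hf, hf])
  · obtain ⟨U, V, hU, hV, hwU, hwV, hUV⟩ := t2_separation (Ne.symm hf)
    obtain ⟨O, -, hO, hwO, hτO, hm⟩ := h.exists_saturated isOpen_univ (mem_univ w) (mem_univ _)
    obtain ⟨φ, ha, hwφ, hφO, hφ0⟩ := h.exists_admissible (hU.inter hO) ⟨hwU, hwO⟩
    obtain ⟨ψ, hb, hwψ, hψO, hψ0⟩ := h.exists_admissible (hV.inter hO) ⟨hwV, hτO w hwO⟩
    have h1 : φ.symm 0 = w := by rw [← hφ0, φ.left_inv hwφ]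
    have h2 : ψ.symm 0 = τ w := by rw [← hψ0, ψ.left_inv hwψ]
    have hwV' : w ∉ V := Set.disjoint_left.1 hUV hwU
    have hwU' : τ w ∉ U := Set.disjoint_right.1 hUV hwV
    refine ⟨_, Or.inr ⟨fun k => if k then ψ else φ, ⟨?_, ?_, ?_, ?_⟩, ?_, rfl⟩,
      ⟨w, Or.inl hwφ, rfl⟩⟩
    · exact hUV.mono (fun y hy => (hφO hy).1) (fun y hy => (hψO hy).1)
    · rintro (_ | _)
      · exact hφ0 ▸ φ.map_source hwφ
      · exact hψ0 ▸ ψ.map_source hwψ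
    · rintro (_ | _)
      · change τ (φ.symm 0) = ψ.symm 0
        rw [h1, h2]
      · change τ (ψ.symm 0) = φ.symm 0
        rw [h1, h2, h.involutive]
    · rintro (_ | _) y hy hf'
      · change φ y = 0
        rcases hm y (hφO hy).2 hf' with rfl | rfl
        · exact hφ0
        · exact absurd (hφO hy).1 hwU'
      · change ψ y = 0
        rcases hm y (hψO hy).2 hf' with rfl | rfl
        · exact absurd (hψO hy).1 hwV'
        · exact hψ0
    · rintro (_ | _)
      · exact ha
      · exact hb

/-- The Riemann surface with nodes obtained by gluing each moved point to its image. -/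
def pinch (h : IsPinching T τ r) : NodalSurface (Quotient r) where
  t2 := h.t2Space
  atlas := h.pinchAtlas
  cover := h.pinchAtlas_cover
  inessential := ∅
  discrete := fun x => ⟨univ, Filter.univ_mem, by simp⟩
  planar := by simp

/-- A crossing has a preimage on each of two disjoint sheets, so its orbit has two points;
conversely a moved point on a sheet sits at the crossing. -/
lemma mk_mem_crossing (h : IsPinching T τ r) {w : W} :
    Quotient.mk r w ∈ h.pinch.crossing ↔ τ w ≠ w := by
  constructor
  · rintro ⟨c, hc, hx, hn, h0⟩ hf
    obtain ⟨φ, hs, hd, -⟩ := h.exists_sheets hc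
    obtain ⟨y, hy, hyw⟩ := (hs false (Or.inl hn)).exists_mem _ hx (by rw [h0, axis_zero])
    obtain ⟨y', hy', hyw'⟩ := (hs true (Or.inl hn)).exists_mem _ hx (by rw [h0, axis_zero])
    rw [← h.eq_of_mk_eq_mk hyw.symm hf] at hy
    rw [← h.eq_of_mk_eq_mk hyw'.symm hf] at hy'
    exact Set.disjoint_left.1 (hd hn) hy hy'
  · intro hf
    obtain ⟨c, hc, hx⟩ := h.pinchAtlas_cover (Quotient.mk r w)
    obtain ⟨φ, hs, -, hcr⟩ := h.exists_sheets hc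
    obtain ⟨k, hk, hkx⟩ := axis_or (c.val_mem (Quotient.mk r w))
    obtain ⟨y, hy, hyw⟩ := (hs k hk).exists_mem _ hx hkx
    refine ⟨c, hc, hyw ▸ hcr k hk y hy ?_⟩
    rcases h.mk_eq_mk.1 hyw with rfl | rfl
    · exact hf
    · rw [h.involutive] at hf
      exact hf.symm

lemma pinch_boundary (h : IsPinching T τ r) : h.pinch.boundary = ∅ := by
  rw [eq_empty_iff_forall_notMem]
  rintro x ⟨e, he, -, hh, -⟩
  exact h.not_isHalf he hh

lemma pinch_boundaryNodes (h : IsPinching T τ r) : h.pinch.boundaryNodes = ∅ := by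
  rw [eq_empty_iff_forall_notMem]
  rintro x ⟨e, he, -, hh⟩
  exact h.not_isHalf he hh

lemma pinch_conic (h : IsPinching T τ r) : h.pinch.conic = h.pinch.crossing := by
  rw [NodalSurface.crossing_eq, h.pinch_boundaryNodes, union_empty]

lemma pinch_nodes (h : IsPinching T τ r) : h.pinch.nodes = h.pinch.crossing := by
  rw [NodalSurface.nodes_eq]
  exact union_empty _

/-- Charts of the pinched surface at a point that is not moved. -/
lemma exists_sheet_of_fixed (h : IsPinching T τ r) {c : NodalChart (Quotient r)}
    (hc : c ∈ h.pinch.atlas) {y : W} (hy : τ y = y) (hyc : Quotient.mk r y ∈ c.source) :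
    ∃ k φ, IsSheet T c k φ ∧ y ∈ φ.source := by
  obtain ⟨φ, hs, -, -⟩ := h.exists_sheets hc
  obtain ⟨k, hk, hkx⟩ := axis_or (c.val_mem (Quotient.mk r y))
  obtain ⟨y', hy', hyy⟩ := (hs k hk).exists_mem _ hyc hkx
  rw [← h.eq_of_mk_eq_mk hyy.symm hy] at hy'
  exact ⟨k, φ k, hs k hk, hy'⟩

lemma IsSheet.eventually_coord {c : NodalChart (Quotient r)} {k : Bool}
    {φ : OpenPartialHomeomorph W ℂ} (hs : IsSheet T c k φ) {y : W} (hy : y ∈ φ.source) :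
    (fun t => c.coord (Quotient.mk r t)) =ᶠ[𝓝 y] φ := by
  filter_upwards [φ.open_source.mem_nhds hy] with t ht
  exact hs.coord ht

/-- At a point that is not moved, the charts of the pinched surface are compatible with those
of `T`. -/
lemma analyticRel_of_fixed (h : IsPinching T τ r) {c : NodalChart (Quotient r)}
    (hc : c ∈ h.pinch.atlas) {y : W} (hy : τ y = y) (hyc : Quotient.mk r y ∈ c.source)
    {e : NodalChart W} (he : e ∈ T.atlas) (hye : y ∈ e.source) :
    AnalyticRel e.coord (fun t => c.coord (Quotient.mk r t)) y ∧
      AnalyticRel (fun t => c.coord (Quotient.mk r t)) e.coord y := by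
  obtain ⟨k, φ, hs, hyφ⟩ := h.exists_sheet_of_fixed hc hy hyc
  have := hs.admissible e he y ⟨hye, hyφ⟩
  exact ⟨this.1.congr EventuallyEq.rfl (hs.eventually_coord hyφ).symm,
    this.2.congr (hs.eventually_coord hyφ).symm EventuallyEq.rfl⟩

lemma pinch_isRiemann (h : IsPinching T τ r) : h.pinch.IsRiemann := by
  refine ⟨rfl, fun e he => h.not_isHalf he, ?_⟩
  rintro e he e' he' x ⟨hx, hx'⟩ hn
  obtain ⟨y, rfl⟩ := Quotient.exists_rep x
  have hy : τ y = y := by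
    by_contra hf
    apply hn
    rw [h.pinch_nodes]
    exact h.mk_mem_crossing.2 hf
  refine AnalyticRel.descend (h.map_mk_nhds hy) ?_
  exact (h.analyticRel_of_fixed he hy hx (T.chartAt_mem y) (T.mem_chartAt y)).2.trans
    (h.analyticRel_of_fixed he' hy hx' (T.chartAt_mem y) (T.mem_chartAt y)).1

/-! #### The normalization of the pinched surface -/

/-- The branches of the chosen charts of the pinched surface. -/
noncomputable def sheet (h : IsPinching T τ r) (x : Quotient r) :
    Bool → OpenPartialHomeomorph W ℂ :=
  (h.exists_sheets (h.pinch.chartAt_mem x)).choose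

lemma sheet_isSheet (h : IsPinching T τ r) (x : Quotient r) {k : Bool}
    (hk : (h.pinch.chartAt x).kind.IsNodal ∨ k = false) :
    IsSheet T (h.pinch.chartAt x) k (h.sheet x k) :=
  (h.exists_sheets (h.pinch.chartAt_mem x)).choose_spec.1 k hk

lemma sheet_disjoint (h : IsPinching T τ r) (x : Quotient r)
    (hn : (h.pinch.chartAt x).kind.IsNodal) :
    Disjoint (h.sheet x false).source (h.sheet x true).source :=
  (h.exists_sheets (h.pinch.chartAt_mem x)).choose_spec.2.1 hn

open Classical in
/-- The lift of the quotient map to the normalization of the pinched surface. -/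
noncomputable def toNormalization (h : IsPinching T τ r) (w : W) : h.pinch.Normalization :=
  -- The label tells on which sheet of the chart chosen at its own image `w` lies. The first
  -- condition keeps unmoved points at the label `false`, as `Normalization` demands off the
  -- crossings.
  ⟨(Quotient.mk r w, decide (τ w ≠ w ∧ w ∈ (h.sheet (Quotient.mk r w) true).source)), fun hd =>
    h.mk_mem_crossing.2 (of_decide_eq_true hd).1⟩

lemma proj_toNormalization (h : IsPinching T τ r) (w : W) :
    h.pinch.proj (h.toNormalization w) = Quotient.mk r w := rfl

lemma toNormalization_mem (h : IsPinching T τ r) {x : Quotient r} {k : Bool}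
    (hk : (h.pinch.chartAt x).kind.IsNodal ∨ k = false) {y : W} (hy : y ∈ (h.sheet x k).source)
    (hx : Quotient.mk r y ∈ h.pinch.away x) : h.toNormalization y ∈ h.pinch.branchSource x k := by
  have hs := h.sheet_isSheet x hk
  refine ⟨hx, hs.mem y hy, ?_, fun hc => ?_⟩
  · rw [proj_toNormalization, hs.val y hy, axis_not_inject]
  · have hf := h.mk_mem_crossing.1 hc
    obtain rfl : Quotient.mk r y = x := h.pinch.eq_of_mem_away hx hc
    have hn := ((h.pinch.crossing_iff (h.pinch.chartAt_mem _) (h.pinch.mem_chartAt _)).1 hc).2.1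
    classical
    change decide (τ y ≠ y ∧ y ∈ (h.sheet (Quotient.mk r y) true).source) = k
    cases k
    · exact decide_eq_false fun hd => Set.disjoint_left.1 (h.sheet_disjoint _ hn) hy hd.2
    · simp [hf, hy]

/-- If `y` were off sheet `k`, that sheet would meet the orbit of `y` in `τ y` only; then `y` is
moved, lies on the other sheet, and carries the opposite label. -/
lemma mem_sheet (h : IsPinching T τ r) {x : Quotient r} {k : Bool}
    (hk : (h.pinch.chartAt x).kind.IsNodal ∨ k = false) {y : W}
    (hy : h.toNormalization y ∈ h.pinch.branchSource x k) : y ∈ (h.sheet x k).source := by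
  have hs := h.sheet_isSheet x hk
  obtain ⟨y', hy', hyy⟩ := hs.exists_mem _ hy.2.1 hy.2.2.1
  have hyy : Quotient.mk r y' = Quotient.mk r y := hyy
  by_contra hcon
  have hne : y ≠ y' := fun h => hcon (h ▸ hy')
  have hτ : y = τ y' := (h.mk_eq_mk.1 hyy).resolve_left hne.symm
  have hc : Quotient.mk r y ∈ h.pinch.crossing := by
    rw [h.mk_mem_crossing, hτ, h.involutive]
    exact fun h => hne (hτ.trans h.symm)
  have hyx : Quotient.mk r y = x := h.pinch.eq_of_mem_away hy.1 hc
  have hcr := (h.pinch.crossing_iff (h.pinch.chartAt_mem x) hy.2.1).1 hc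
  have hs' := h.sheet_isSheet x (k := !k) (Or.inl hcr.2.1)
  obtain ⟨y'', hy'', hyy'⟩ := hs'.exists_mem _ hy.2.1 (by
    rw [hcr.2.2, axis_zero])
  have hyy' : Quotient.mk r y'' = Quotient.mk r y := hyy'
  have hne' : y'' ≠ y' := by
    rintro rfl
    cases k
    · exact Set.disjoint_left.1 (h.sheet_disjoint x hcr.2.1) hy' hy''
    · exact Set.disjoint_right.1 (h.sheet_disjoint x hcr.2.1) hy' hy''
  have h2 : y'' = y := by
    rcases h.mk_eq_mk.1 (hyy.trans hyy'.symm) with h3 | h3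
    · exact absurd h3.symm hne'
    · rw [h3, hτ]
  subst h2
  have h3 := h.toNormalization_mem (Or.inl hcr.2.1) hy'' hy.1
  have h4 := (h3.2.2.2 hc).symm.trans (hy.2.2.2 hc)
  cases k <;> simp at h4

lemma branchChart_coord_toNormalization (h : IsPinching T τ r) {x : Quotient r} {k : Bool}
    (hk : (h.pinch.chartAt x).kind.IsNodal ∨ k = false) {y : W} (hy : y ∈ (h.sheet x k).source) :
    (h.pinch.branchChart x k hk).coord (h.toNormalization y) = h.sheet x k y := by
  rw [NodalSurface.branchChart_coord, proj_toNormalization, (h.sheet_isSheet x hk).val y hy,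
    axis_inject]

lemma toNormalization_injective (h : IsPinching T τ r) :
    Function.Injective h.toNormalization := by
  intro y y' hyy
  obtain ⟨_, ⟨x, k, hk, rfl⟩, hq⟩ := h.pinch.normalization.cover (h.toNormalization y)
  have h1 := h.mem_sheet hk hq
  have h2 := h.mem_sheet hk (y := y') (hyy ▸ hq)
  refine (h.sheet x k).injOn h1 h2 ?_
  rw [← h.branchChart_coord_toNormalization hk h1, ← h.branchChart_coord_toNormalization hk h2, hyy]

lemma toNormalization_surjective (h : IsPinching T τ r) :
    Function.Surjective h.toNormalization := by
  intro q
  obtain ⟨_, ⟨x, k, hk, rfl⟩, hq⟩ := h.pinch.normalization.cover q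
  have hq : q ∈ h.pinch.branchSource x k := hq
  obtain ⟨y, hy, hyq⟩ := (h.sheet_isSheet x hk).exists_mem _ hq.2.1 hq.2.2.1
  have h1 := h.toNormalization_mem hk hy (by rw [hyq]; exact hq.1)
  refine ⟨y, ?_⟩
  rw [← h.pinch.lift_proj hq.2.2.2, ← h.pinch.lift_proj h1.2.2.2, proj_toNormalization, hyq]

lemma toNormalization_bijective (h : IsPinching T τ r) :
    Function.Bijective h.toNormalization :=
  ⟨h.toNormalization_injective, h.toNormalization_surjective⟩

/-- The pinched surface has the original surface as its normalization. -/
noncomputable def normalizationHomeomorph (h : IsPinching T τ r) :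
    W ≃ₜ h.pinch.Normalization where
  toEquiv := Equiv.ofBijective h.toNormalization h.toNormalization_bijective
  continuous_toFun := by
    rw [continuous_iff_continuousAt]
    intro y
    change ContinuousAt h.toNormalization y
    obtain ⟨_, ⟨x, k, hk, rfl⟩, hq⟩ := h.pinch.normalization.cover (h.toNormalization y)
    have hq : h.toNormalization y ∈ h.pinch.branchSource x k := hq
    have hy := h.mem_sheet hk hq
    have hev : ∀ᶠ t in 𝓝 y, t ∈ (h.sheet x k).source ∧
        h.toNormalization t ∈ h.pinch.branchSource x k := by
      have hc : Continuous (Quotient.mk r) := continuous_quotient_mk'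
      filter_upwards [(h.sheet x k).open_source.mem_nhds hy,
        hc.continuousAt.preimage_mem_nhds ((h.pinch.isOpen_away x).mem_nhds hq.1)] with t h1 h2
      exact ⟨h1, h.toNormalization_mem hk h1 h2⟩
    let B := (h.pinch.branchChart x k hk).homeo
    -- Read in the branch chart, the map is the sheet coordinate; the inverse map is treated in the
    -- same way below.
    have hB : ContinuousAt (fun t => B (h.toNormalization t)) y := by
      rw [Topology.IsInducing.subtypeVal.continuousAt_iff]
      refine ContinuousAt.congr (f := fun t => (h.sheet x k t, (0 : ℂ)))
        (((h.sheet x k).continuousAt hy).prodMk continuousAt_const) ?_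
      filter_upwards [hev] with t ht
      refine Prod.ext ?_ rfl
      rw [← h.branchChart_coord_toNormalization hk ht.1, NodalSurface.branchChart_coord]
      rfl
    have h3 : ContinuousAt (fun t => B.symm (B (h.toNormalization t))) y :=
      ContinuousAt.comp (g := B.symm) (B.continuousAt_symm (B.map_source hq)) hB
    refine h3.congr ?_
    filter_upwards [hev] with t ht
    exact B.left_inv ht.2
  continuous_invFun := by
    rw [continuous_iff_continuousAt]
    intro q
    obtain ⟨_, ⟨x, k, hk, rfl⟩, hq⟩ := h.pinch.normalization.cover q
    have hq' : q ∈ h.pinch.branchSource x k := hq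
    have key : ∀ t ∈ h.pinch.branchSource x k, (Equiv.ofBijective h.toNormalization
        h.toNormalization_bijective).symm t ∈ (h.sheet x k).source ∧
        h.sheet x k ((Equiv.ofBijective h.toNormalization
        h.toNormalization_bijective).symm t) =
        (h.pinch.branchChart x k hk).coord t := by
      intro t ht
      obtain ⟨y, rfl⟩ := h.toNormalization_surjective t
      rw [Equiv.ofBijective_symm_apply_apply]
      exact ⟨h.mem_sheet hk ht, (h.branchChart_coord_toNormalization hk (h.mem_sheet hk ht)).symm⟩
    have hc := (h.pinch.branchChart x k hk).continuousAt_coord hq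
    have hc' : ContinuousAt (h.sheet x k).symm ((h.pinch.branchChart x k hk).coord q) := by
      rw [← (key q hq').2]
      exact (h.sheet x k).continuousAt_symm ((h.sheet x k).map_source (key q hq').1)
    refine (ContinuousAt.comp (g := (h.sheet x k).symm) hc' hc).congr ?_
    filter_upwards [(h.pinch.isOpen_branchSource x hk).mem_nhds hq'] with t ht
    change (h.sheet x k).symm ((h.pinch.branchChart x k hk).coord t) = _
    rw [← (key t ht).2, (h.sheet x k).left_inv (key t ht).1]
    rfl

/-- The normalization of the pinched surface is analytically isomorphic to `T`. -/
lemma exists_branchChart (h : IsPinching T τ r) (w : W) :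
    ∃ c ∈ h.pinch.normalization.atlas, h.normalizationHomeomorph w ∈ c.source ∧
      ∀ e ∈ T.atlas, w ∈ e.source →
        AnalyticRel e.coord (fun y => c.coord (h.normalizationHomeomorph y)) w ∧
        AnalyticRel (fun y => c.coord (h.normalizationHomeomorph y)) e.coord w := by
  obtain ⟨_, ⟨x, k, hk, rfl⟩, hq⟩ := h.pinch.normalization.cover (h.normalizationHomeomorph w)
  refine ⟨_, ⟨x, k, hk, rfl⟩, hq, fun e he hw => ?_⟩
  have hs := h.mem_sheet hk hq
  have hev : (fun y => (h.pinch.branchChart x k hk).coord (h.normalizationHomeomorph y)) =ᶠ[𝓝 w]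
      h.sheet x k := by
    filter_upwards [(h.sheet x k).open_source.mem_nhds hs] with y hy
    exact h.branchChart_coord_toNormalization hk hy
  have := (h.sheet_isSheet x hk).admissible e he w ⟨hw, hs⟩
  exact ⟨this.1.congr EventuallyEq.rfl hev.symm, this.2.congr hev.symm EventuallyEq.rfl⟩

lemma pinch_normalization_boundary (h : IsPinching T τ r) :
    h.pinch.normalization.boundary = ∅ := by
  rw [eq_empty_iff_forall_notMem]
  rintro q ⟨_, ⟨x, k, hk, rfl⟩, -, hh, -⟩
  exact h.not_isHalf (h.pinch.chartAt_mem x) ((ModelKind.isHalf_flat _).1 hh)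

end IsPinching

end Nodal

namespace Nodal

/-! ### Transport of local representations -/

section Transport

variable {W X Y Z : Type u} [TopologicalSpace W] [TopologicalSpace X] [TopologicalSpace Y]
  [TopologicalSpace Z]

/-- Serves two purposes: `m` is the homeomorphism onto the normalization when lifting the
projection, and the quotient map at an unmoved point when descending it. -/
lemma LocalRep.transport {e : NodalChart W} {e' : NodalChart Y} {f : W → Y} {x : W} {F G : ℂ → ℂ}
    (h : LocalRep e e' f x F) {m : W → X} {c : NodalChart X} {c' : NodalChart Z} {g : X → Z}
    (hm : map m (𝓝 x) = 𝓝 (m x)) (hc : m x ∈ c.source) (hG : AnalyticAt ℂ G (c.coord (m x)))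
    (hGe : ∀ᶠ y in 𝓝 x, e.coord y = G (c.coord (m y))) (hc' : g (m x) ∈ c'.source)
    (hh : c'.kind.IsHalf ↔ e'.kind.IsHalf)
    (hev : ∀ᶠ y in 𝓝 x, c'.coord (g (m y)) = e'.coord (f y)) :
    LocalRep c c' g (m x) (F ∘ G) := by
  obtain ⟨-, -, h3, h4⟩ := h
  refine ⟨hc, hc', AnalyticAt.comp (by rwa [← hGe.self_of_nhds]) hG, ?_⟩
  rw [hh, ← hm]
  simp only [eventually_map]
  refine h4.imp (fun h => ⟨h.1, ?_⟩) (Or.imp (fun h => ⟨h.1, ?_⟩) (fun h => ⟨h.1, ?_⟩))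
  all_goals
    filter_upwards [h.2, hGe, hev] with y h5 h6 h7
    rw [h7, h5, h6]
    rfl

lemma isNodalMap_of_nodes_eq_empty {S : NodalSurface X} {T : NodalSurface Y} {f : X → Y}
    (hf : Continuous f) (hT : T.nodes = ∅) (hS : S.boundary = ∅) : IsNodalMap S T f := by
  have h1 : T.conic = ∅ := subset_empty_iff.1 (hT ▸ fun x hx => Or.inl (Or.inl hx))
  have h2 : T.inessential = ∅ := subset_empty_iff.1 (hT ▸ fun x hx => Or.inl (Or.inr hx))
  have h3 : T.boundaryNodes = ∅ := subset_empty_iff.1 (hT ▸ fun x hx => Or.inr hx)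
  refine ⟨hf, ?_, ?_, ?_, ?_⟩ <;> simp [h1, h2, h3, hS]

end Transport

namespace IsPinching

variable {W Y : Type u} [TopologicalSpace W] [TopologicalSpace Y] {T : NodalSurface W}
  {S : NodalSurface Y} {τ : W → W} {r : Setoid W} {π : W → Y}

lemma isAnalyticMap_normalizationHomeomorph (h : IsPinching T τ r) :
    IsAnalyticMap T h.pinch.normalization h.normalizationHomeomorph := by
  refine ⟨isNodalMap_of_nodes_eq_empty h.normalizationHomeomorph.continuous
    NodalSurface.normalization_nodes h.riemann.boundary_eq, fun w _ => ?_⟩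
  obtain ⟨c, hc, hw, hrel⟩ := h.exists_branchChart w
  exact ⟨_, T.chartAt_mem w, c, hc, T.mem_chartAt w, hw,
    (hrel _ (T.chartAt_mem w) (T.mem_chartAt w)).1⟩

lemma isAnalyticMap_normalizationHomeomorph_symm (h : IsPinching T τ r) :
    IsAnalyticMap h.pinch.normalization T h.normalizationHomeomorph.symm := by
  refine ⟨isNodalMap_of_nodes_eq_empty h.normalizationHomeomorph.symm.continuous
    h.nodes h.pinch_normalization_boundary, fun q _ => ?_⟩
  obtain ⟨w, rfl⟩ := h.normalizationHomeomorph.surjective q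
  obtain ⟨c, hc, hw, hrel⟩ := h.exists_branchChart w
  refine ⟨c, hc, _, T.chartAt_mem w, hw, ?_, ?_⟩
  · rw [Homeomorph.symm_apply_apply]
    exact T.mem_chartAt w
  · refine AnalyticRel.descend (h.normalizationHomeomorph.map_nhds_eq w) ?_
    simp only [Homeomorph.symm_apply_apply]
    exact (hrel _ (T.chartAt_mem w) (T.mem_chartAt w)).2

lemma hasRamificationIndex (h : IsPinching T τ r) {w : W} {n : ℕ}
    (hn : HasRamificationIndex T S π w n) :
    HasRamificationIndex h.pinch.normalization S (fun q => π (h.normalizationHomeomorph.symm q))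
      (h.normalizationHomeomorph w) n := by
  obtain ⟨e, he, e', he', F, hF, hFn⟩ := hn
  obtain ⟨c, hc, hw, hrel⟩ := h.exists_branchChart w
  obtain ⟨⟨H, hH, hHe⟩, ⟨G, hG, hGe⟩⟩ := hrel e he hF.1
  have hmap := h.normalizationHomeomorph.map_nhds_eq w
  refine ⟨c, hc, e', he', F ∘ G, hF.transport hmap hw hG hGe ?_ Iff.rfl ?_, ?_⟩
  · rw [Homeomorph.symm_apply_apply]
    exact hF.2.1
  · simp
  · have hhalf : ¬ c.kind.IsHalf := by
      obtain ⟨x, k, hk, rfl⟩ := hc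
      exact fun hh => h.not_isHalf (h.pinch.chartAt_mem x) ((ModelKind.isHalf_flat _).1 hh)
    have hmap' := c.map_coord_nhds hw (NodalSurface.normalization_not_crossing hc _) hhalf
    have hG0 : e.coord w = G (c.coord (h.normalizationHomeomorph w)) := hGe.self_of_nhds
    -- `H` inverts the coordinate change `G`, so precomposition with `G` leaves the order of
    -- vanishing unchanged.
    have hd : deriv G (c.coord (h.normalizationHomeomorph w)) ≠ 0 := by
      refine deriv_ne_zero_of_leftInverse (G := H) hG (hG0 ▸ hH) ?_
      rw [← hmap', ← hmap, eventually_map, eventually_map]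
      filter_upwards [hHe, hGe] with y h1 h2
      rw [← h2, ← h1]
    rw [← hFn]
    have h1 := analyticOrderAt_comp_of_deriv_ne_zero
      (f := fun u => F u - F (e.coord w)) hG hd
    rw [← hG0] at h1
    rw [← h1]
    simp only [Function.comp_def, ← hG0]

lemma isUnbranchedKleinDoubleCover (h : IsPinching T τ r)
    (hπ : IsUnbranchedKleinDoubleCover T S π) :
    IsUnbranchedKleinDoubleCover h.pinch.normalization S
      (fun q => π (h.normalizationHomeomorph.symm q)) := by
  obtain ⟨⟨⟨hc, -, -⟩, ι, hι, hsum⟩, h1⟩ := hπ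
  set ψ := h.normalizationHomeomorph
  have hram : ∀ q n, HasRamificationIndex T S π (ψ.symm q) n →
      HasRamificationIndex h.pinch.normalization S (fun q => π (ψ.symm q)) q n := by
    intro q n hq
    have := h.hasRamificationIndex hq
    rwa [Homeomorph.apply_symm_apply] at this
  have hb := h.pinch_normalization_boundary
  have hb' := h.riemann.boundary_eq
  refine ⟨⟨⟨hc.comp ψ.symm.continuous, by simp [hb], fun q => ?_⟩, fun q => ι (ψ.symm q),
    fun q => hram q _ (hι _), fun y => ?_⟩, fun q => hram q _ (h1 _)⟩
  · obtain ⟨e, he, e', he', F, hF, -⟩ := hram q _ (h1 _)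
    exact ⟨e, he, e', he', F, hF⟩
  · have hbij : BijOn ψ.symm ((fun q => π (ψ.symm q)) ⁻¹' {y}) (π ⁻¹' {y}) := by
      refine ⟨fun q hq => hq, ψ.symm.injective.injOn, fun w hw => ⟨ψ w, ?_, ?_⟩⟩
      · change π (ψ.symm (ψ w)) = y
        rw [Homeomorph.symm_apply_apply]
        exact hw
      · exact ψ.symm_apply_apply w
    refine ⟨hbij.finite_iff_finite.2 (hsum y).1, ?_⟩
    rw [← (hsum y).2]
    refine finsum_mem_eq_of_bijOn ψ.symm hbij fun q _ => ?_
    congr 1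
    -- Neither covering surface has boundary, so the relative degree depends on the image point
    -- only.
    by_cases hq : π (ψ.symm q) ∈ S.boundary
    · rw [relativeDegree_of_boundary_eq hb (π := fun q => π (ψ.symm q)) hq,
        relativeDegree_of_boundary_eq hb' hq]
    · rw [relativeDegree_of_notMem (π := fun q => π (ψ.symm q)) hq, relativeDegree_of_notMem hq]

end IsPinching

/-! ### The complex double of a Klein surface with nodes -/

section Main

variable {X W : Type u} [TopologicalSpace X] [TopologicalSpace W] {S : NodalSurface X}
  {T : NodalSurface W} {π : W → S.Normalization} {σ : W → W}

lemma IsKleinComplexDouble.sigma_ne_of_mem (hS : S.IsKlein)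
    (hT : IsKleinComplexDouble T S.normalization π σ) (w : W)
    (hw : S.proj (π w) ∈ S.conic ∪ S.inessential) : σ w ≠ w :=
  hT.sigma_ne (hS.notMem_normalization_boundary hw)

lemma IsKleinComplexDouble.surjective (hS : S.IsKlein)
    (hT : IsKleinComplexDouble T S.normalization π σ) : Function.Surjective π := by
  intro y
  by_contra hcon
  have h1 := (hT.finsum_eq hS.normalization S.normalization_nodes y).2
  rw [show π ⁻¹' {y} = ∅ from eq_empty_iff_forall_notMem.2 fun w hw => hcon ⟨w, hw⟩,
    finsum_mem_empty] at h1
  exact absurd h1 (by norm_num)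

lemma isPinching_of_choice (hS : S.IsKlein)
    (hT : IsKleinComplexDouble T S.normalization π σ) {τ : W → W} (hτ : Function.Involutive τ)
    (hnodes : ∀ w, τ w ≠ w ↔ S.proj (π w) ∈ S.nodes)
    (hfib : ∀ w, S.proj ⁻¹' {S.proj (π w)} = {π w, π (τ w)}) :
    IsPinching T τ (involutionSetoid τ hτ) where
  riemann := hT.1
  nodes := hT.2.1
  involutive := hτ
  rel _ _ := Iff.rfl
  discrete w := by
    have := T.t2
    -- Nearby moved points lie over nodes, hence over the image of `w`, since nodes do not
    -- accumulate; the other points of that finite fibre are then removed.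
    have hfin : ((fun v => S.proj (π v)) ⁻¹' {S.proj (π w)} \ {w}).Finite := by
      refine Set.Finite.sdiff ?_
      change (π ⁻¹' (S.proj ⁻¹' {S.proj (π w)})).Finite
      rw [hfib, insert_eq, preimage_union]
      exact (hT.finsum_eq hS.normalization S.normalization_nodes _).1.union
        (hT.finsum_eq hS.normalization S.normalization_nodes _).1
    have hcont : Continuous π := hT.2.2.2.2.1.1.1.1
    obtain ⟨U, hU, hUn⟩ := S.exists_nhds_nodes (S.proj (π w))
    refine ⟨_, inter_mem ((S.continuous_proj.comp hcont).continuousAt.preimage_mem_nhds hU)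
      (hfin.isClosed.isOpen_compl.mem_nhds fun h => h.2 rfl), ?_⟩
    rintro v ⟨hvU, hv⟩ hf
    by_contra hne
    exact hv ⟨hUn ⟨hvU, (hnodes v).1 hf⟩, hne⟩

/-- The pinched complex double of the normalization is a complex double. -/
lemma isComplexDouble_pinch (hT : IsKleinComplexDouble T S.normalization π σ)
    (hsurj : Function.Surjective π) {τ : W → W} {r : Setoid W}
    (h : IsPinching T τ r) (hnodes : ∀ w, τ w ≠ w ↔ S.proj (π w) ∈ S.nodes)
    (hfib : ∀ w, S.proj ⁻¹' {S.proj (π w)} = {π w, π (τ w)})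
    (hcomm : ∀ w, τ (σ w) = σ (τ w)) {πc : Quotient r → X} {σc : Quotient r → Quotient r}
    (hπc : ∀ w, πc (Quotient.mk r w) = S.proj (π w))
    (hσc : ∀ w, σc (Quotient.mk r w) = Quotient.mk r (σ w)) :
    IsComplexDouble h.pinch S πc σc := by
  have hcont : Continuous π := hT.2.2.2.2.1.1.1.1
  obtain ⟨hR, hn, ⟨⟨hσcont, -⟩, hσ⟩, hσσ, hcover, hπσ⟩ := hT
  have hwn : ∀ w, w ∉ T.nodes := fun w => by simp [hn]
  have hmem : ∀ w, Quotient.mk r w ∈ h.pinch.nodes ↔ S.proj (π w) ∈ S.nodes := fun w => by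
    rw [h.pinch_nodes, h.mk_mem_crossing, hnodes]
  have hmem' : ∀ w, Quotient.mk r w ∈ h.pinch.conic ↔ S.proj (π w) ∈ S.nodes := fun w => by
    rw [h.pinch_conic, h.mk_mem_crossing, hnodes]
  have hfixed : ∀ w, Quotient.mk r w ∉ h.pinch.nodes → τ w = w := by
    intro w hw
    by_contra hf
    exact hw ((hmem w).2 ((hnodes w).1 hf))
  have hcπ : Continuous πc := by
    rw [isQuotientMap_quotient_mk'.continuous_iff]
    exact (S.continuous_proj.comp hcont).congr fun w => (hπc w).symm
  have hcσ : Continuous σc := by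
    rw [isQuotientMap_quotient_mk'.continuous_iff]
    exact (continuous_quotient_mk'.comp hσcont).congr fun w => (hσc w).symm
  set ψ := h.normalizationHomeomorph
  have hproj : ∀ w, h.pinch.proj (ψ w) = Quotient.mk r w := fun _ => rfl
  have hlift : IsLifting h.pinch S πc (fun q => π (ψ.symm q)) := by
    refine ⟨hcont.comp ψ.symm.continuous, fun q => ?_⟩
    obtain ⟨w, rfl⟩ := ψ.surjective q
    beta_reduce
    rw [ψ.symm_apply_apply, hproj, hπc]
  have hσπ : ∀ w, S.proj (π (σ w)) = S.proj (π w) := fun w => by rw [hπσ]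
  refine ⟨⟨h.pinch_isRiemann, ⟨⟨hcσ, ?_, ?_, ?_, ?_⟩, ?_⟩, ?_, ?_⟩,
    ⟨⟨⟨hcπ, ?_, ?_, ?_, ?_⟩, ?_, ⟨_, hlift, ?_⟩⟩,
      ⟨_, hlift, h.isUnbranchedKleinDoubleCover hcover⟩⟩, ?_, ?_⟩
  · rintro ⟨w⟩ hw
    have hw : σc (Quotient.mk r w) ∈ h.pinch.conic := hw
    rw [hσc, hmem', hσπ] at hw
    exact (hmem' w).2 hw
  · rintro x hx
    exact absurd hx (notMem_empty _)
  · rw [h.pinch_boundaryNodes]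
    simp
  · simp [h.pinch_boundary]
  · intro x hx
    obtain ⟨w, rfl⟩ := Quotient.exists_rep x
    have hw := hfixed w hx
    -- Commutation keeps `σ w` unmoved, so coordinates of the double can be used at both ends.
    have hw' : τ (σ w) = σ w := by rw [hcomm, hw]
    obtain ⟨e₁, he₁, e₂, he₂, hw₁, hw₂, hrel⟩ := hσ w (hwn w)
    refine ⟨_, h.pinch.chartAt_mem _, _, h.pinch.chartAt_mem (σc (Quotient.mk r w)),
      h.pinch.mem_chartAt _, h.pinch.mem_chartAt _, AntianalyticRel.descend (h.map_mk_nhds hw) ?_⟩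
    refine (h.analyticRel_of_fixed (h.pinch.chartAt_mem _) hw
      (h.pinch.mem_chartAt _) he₁ hw₁).2.trans_anti (hrel.trans_analytic ?_)
    simp only [hσc]
    exact (h.analyticRel_of_fixed (h.pinch.chartAt_mem _) hw'
      (h.pinch.mem_chartAt _) he₂ hw₂).1.comp hσcont.continuousAt
  -- The lift of `σc` is `σ` carried over by `ψ`; it is onto the fibres because `σ` is its own
  -- inverse.
  · refine ⟨fun q => ψ (σ (ψ.symm q)), ⟨ψ.continuous.comp (hσcont.comp ψ.symm.continuous), ?_⟩, ?_⟩
    · intro q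
      obtain ⟨w, rfl⟩ := ψ.surjective q
      beta_reduce
      rw [ψ.symm_apply_apply, hproj, hproj, hσc]
    · intro z
      obtain ⟨w, rfl⟩ := Quotient.exists_rep z
      apply Subset.antisymm
      · rintro _ ⟨q, hq, rfl⟩
        obtain ⟨v, rfl⟩ := ψ.surjective q
        have hq : Quotient.mk r v = Quotient.mk r w := hq
        change Quotient.mk r (σ (ψ.symm (ψ v))) = σc (Quotient.mk r w)
        rw [ψ.symm_apply_apply, ← hq, hσc]
      · intro q hq
        obtain ⟨v, rfl⟩ := ψ.surjective q
        have hq : Quotient.mk r v = σc (Quotient.mk r w) := hq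
        rw [hσc] at hq
        refine ⟨ψ (σ v), ?_, ?_⟩
        · change Quotient.mk r (σ v) = Quotient.mk r w
          rw [← hσc, hq, hσc, hσσ]
        · beta_reduce
          rw [ψ.symm_apply_apply, hσσ]
  · rintro ⟨w⟩
    change σc (σc (Quotient.mk r w)) = Quotient.mk r w
    rw [hσc, hσc, hσσ]
  · rintro ⟨w⟩ hw
    have hw : πc (Quotient.mk r w) ∈ S.conic := hw
    rw [hπc] at hw
    exact (hmem' w).2 (Or.inl (Or.inl hw))
  · rintro ⟨w⟩ hw
    have hw : πc (Quotient.mk r w) ∈ S.inessential := hw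
    rw [hπc] at hw
    exact Or.inr ((hmem' w).2 (Or.inl (Or.inr hw)))
  · rintro ⟨w⟩ hw
    have hw : πc (Quotient.mk r w) ∈ S.boundaryNodes := hw
    rw [hπc] at hw
    exact Or.inr ((hmem' w).2 (Or.inr hw))
  · simp [h.pinch_boundary]
  · intro x hx
    obtain ⟨w, rfl⟩ := Quotient.exists_rep x
    have hw := hfixed w hx
    obtain ⟨e, he, _, ⟨y, k, hk, rfl⟩, F, hF, -⟩ := hcover.2 w
    -- On its domain a branch chart has the same coordinate, and the same kind of boundary, as the
    -- chart of `S` it comes from; the formula for `π` therefore serves for `πc`.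
    have hwb : π w ∈ S.branchSource y k := hF.2.1
    obtain ⟨G, hG, hGe⟩ := (h.analyticRel_of_fixed (h.pinch.chartAt_mem _) hw
      (h.pinch.mem_chartAt _) he hF.1).2
    refine ⟨_, h.pinch.chartAt_mem _, _, S.chartAt_mem y, F ∘ G,
      hF.transport (h.map_mk_nhds hw) (h.pinch.mem_chartAt _) hG hGe ?_ ?_ ?_⟩
    · rw [hπc]
      exact hwb.2.1
    · exact (ModelKind.isHalf_flat _).symm
    · filter_upwards [hcont.continuousAt.eventually
        (NodalSurface.eventually_branchChart_coord hk hwb)] with t ht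
      rw [hπc, ht]
  · intro z
    obtain ⟨w, rfl⟩ := Quotient.exists_rep z
    -- The fibre of the normalization is covered by `w` and its partner `τ w`, which have the same
    -- image in the quotient: this is completeness.
    rw [hπc, hfib]
    apply Subset.antisymm
    · rintro _ ⟨q, hq, rfl⟩
      obtain ⟨v, rfl⟩ := ψ.surjective q
      have hq : Quotient.mk r v = Quotient.mk r w := hq
      rw [← hfib]
      change S.proj (π (ψ.symm (ψ v))) = _
      rw [ψ.symm_apply_apply, ← hπc, hq, hπc]
    · rintro q (rfl | rfl)
      · exact ⟨ψ w, rfl, congrArg π (ψ.symm_apply_apply w)⟩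
      · exact ⟨ψ (τ w), h.mk_tau w, congrArg π (ψ.symm_apply_apply (τ w))⟩
  · rintro ⟨w⟩
    change πc (σc (Quotient.mk r w)) = πc (Quotient.mk r w)
    rw [hσc, hπc, hπc, hπσ]
  · apply Subset.antisymm
    · rintro _ ⟨⟨w⟩, hw, rfl⟩
      change πc (Quotient.mk r w) ∈ S.nodes
      rw [hπc]
      exact (hmem w).1 hw
    · intro z hz
      obtain ⟨w, hw⟩ := hsurj (S.liftPoint false z)
      have hwz : S.proj (π w) = z := by rw [hw, S.proj_lift]
      exact ⟨Quotient.mk r w, (hmem w).2 (hwz ▸ hz), (hπc w).trans hwz⟩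

end Main

end Nodal

/-! ### Assembly of the theorem -/

theorem mainTheorem2 {X W : Type u} [TopologicalSpace X] [TopologicalSpace W]
    (S : Nodal.NodalSurface X) (hS : S.IsKlein)
    (T : Nodal.NodalSurface W) (πh : W → S.Normalization) (σh : W → W)
    (hT : Nodal.IsKleinComplexDouble T S.normalization πh σh) :
    (∀ z ∈ S.boundaryNodes ∪ S.inessential, {s | Nodal.IsIdentificationAt S πh z s}.ncard = 1) ∧
    (∀ z ∈ S.conic, {s | Nodal.IsIdentificationAt S πh z s}.ncard = 2) ∧
    Cardinal.mk (Nodal.Choice S πh) = 2 ^ Cardinal.mk S.conic ∧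
    Function.Injective (fun c : Nodal.Choice S πh => c.rel) ∧
    ∀ c : Nodal.Choice S πh, ∃ R : Nodal.NodalSurface (Quotient c.rel),
      R.IsRiemann ∧
      (∃ ψ : W ≃ₜ R.Normalization, (∀ w, R.proj (ψ w) = Quotient.mk c.rel w) ∧
        Nodal.IsAnalyticMap T R.normalization ψ ∧ Nodal.IsAnalyticMap R.normalization T ψ.symm) ∧
      ∃ (πc : Quotient c.rel → X) (σc : Quotient c.rel → Quotient c.rel),
        (∀ f : Quotient c.rel → X, (∀ w, f (Quotient.mk c.rel w) = S.proj (πh w)) ↔ f = πc) ∧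
        (∀ f : Quotient c.rel → Quotient c.rel,
          (∀ w, f (Quotient.mk c.rel w) = Quotient.mk c.rel (σh w)) ↔ f = σc) ∧
        Nodal.IsComplexDouble R S πc σc := by
  have hπσ : ∀ w, πh (σh w) = πh w := hT.2.2.2.2.2
  have hσ := hT.sigma_ne_of_mem hS
  refine ⟨fun z hz => Nodal.ncard_isIdentificationAt_of_notMem_conic hS hT hz,
    fun z hz => Nodal.ncard_isIdentificationAt_of_conic hS hT hz, Nodal.mk_choice hS hT,
    Nodal.Choice.rel_injective hπσ hσ, fun c => ?_⟩
  obtain ⟨τ, hτ, hnodes, hproj, hfib, hcomm, hrel, -⟩ := c.exists_involution hπσ hσ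
  -- From here on the choice enters only through its involution `τ`.
  generalize c.rel = r at hrel
  subst hrel
  have h := Nodal.isPinching_of_choice hS hT hτ hnodes hfib
  have hπ : ∀ a b, Nodal.involutionSetoid τ hτ a b → S.proj (πh a) = S.proj (πh b) := by
    rintro a b (rfl | rfl)
    · rfl
    · exact (hproj a).symm
  have hσ' : ∀ a b, Nodal.involutionSetoid τ hτ a b →
      Quotient.mk (Nodal.involutionSetoid τ hτ) (σh a) =
        Quotient.mk (Nodal.involutionSetoid τ hτ) (σh b) := by
    rintro a b (rfl | rfl)
    · rfl
    -- Points exchanged by `τ` have images under `σh` that are again exchanged, since the two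
    -- involutions commute.
    · rw [← hcomm, h.mk_tau]
  refine ⟨h.pinch, h.pinch_isRiemann, ⟨h.normalizationHomeomorph, fun _ => rfl,
    h.isAnalyticMap_normalizationHomeomorph, h.isAnalyticMap_normalizationHomeomorph_symm⟩,
    Quotient.lift (fun w => S.proj (πh w)) hπ, Quotient.lift _ hσ', fun f => ?_, fun f => ?_,
    Nodal.isComplexDouble_pinch hT (hT.surjective hS) h hnodes hfib hcomm (fun _ => rfl)
      fun _ => rfl⟩
  · refine ⟨fun hf => funext ?_, fun hf w => by rw [hf]; rfl⟩
    rintro ⟨w⟩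
    exact hf w
  · refine ⟨fun hf => funext ?_, fun hf w => by rw [hf]; rfl⟩
    rintro ⟨w⟩
    exact hf w
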